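/- **Setting.** Fix a number $n$ of parties $\mathcal A_1,\dots,\mathcal A_n$. An instance consists of public parameters (a prime $p$; the number $m$ of samples; feature dimensions $d_1,\dots,d_n$; batches $B_1,\dots,B_T$, each a list of $b=|B|$ row indices; a learning rate $\alpha\in\mathbb F_p$; the index $k$ of the party holding the labels) and private inputs over $\mathbb F_p$: party $\mathcal A_i$ holds $\mathbf X^i\in\mathbb F_p^{m\times d_i}$ and initial coefficients $\mathbf w_i\in\mathbb F_p^{d_i}$, and $\mathcal A_k$ also holds $\mathbf y\in\mathbb F_p^m$. The functionality $f=(f_1,\dots,f_n)$ runs $\mathbf w\leftarrow\mathbf w-\frac{\alpha}{|B|}\mathbf X_{B_t}^T(\mathbf X_{B_t}\mathbf w-\mathbf y_{B_t})$ for $t=1,\dots,T$ on $\mathbf X=(\mathbf X^1,\dots,\mathbf X^n)$, starting from $\mathbf w^T=(\mathbf w_1^T,\dots,\mathbf w_n^T)$, and gives $\mathcal A_i$ the block $\mathbf w_i$ of the result. **SMM.** A secure matrix multiplication protocol is a polynomial-time two-party protocol (possibly with a trusted initializer) that securely computes, in the semi-honest simulation sense, the randomized functionality which, on inputs $A$ and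 $B$, hands the parties a uniformly random pair $(R_1,R_2)$ with $R_1+R_2=AB$: for each party there is a probabilistic polynomial-time simulator which, from $1^\kappa$, the party's input and its share, produces a view that is, jointly with $(R_1,R_2)$, computationally indistinguishable from the real view jointly with the real outputs. **Protocol.** Write $\langle\mathbf v\rangle_j$ for the share of $\mathbf v$ held by $\mathcal A_j$; the shares of $\mathbf v$ sum to $\mathbf v$. Each $\mathcal A_i$ splits $\mathbf w_i$ into uniformly random additive shares and sends $\langle\mathbf w_i\rangle_j$ to $\mathcal A_j$ for $j\ne i$. For $t=1,\dots,T$: (1) $\mathcal A_k$ shares $\mathbf y_{B_t}$ in the same way; (2) for all $i$, $\mathcal A_i$ computes $\mathbf X^i_{B_t}\langle\mathbf w_i\rangle_i$ locally, and for $j\neq i$ the parties $\mathcal A_i,\mathcal A_j$ obtain shares of $\mathbf X^i_{B_t}\langle\mathbf w_i\rangle_j$ by SMM; each $\mathcal A_j$ adds up its shares and subtracts $\langle\mathbf y_{B_t}\rangle_j$ to obtain $\langle\mathbf{err}\rangle_j$; (3) for all $i$, $\mathcal A_i$ computes $\langle\mathbf{err}\rangle_i^T\mathbf X^i_{B_t}$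 locally as a share of $\mathbf{grad}_i$, and for $j\ne i$ the parties $\mathcal A_i,\mathcal A_j$ obtain by SMM shares of $\langle\mathbf{err}\rangle_i^T\mathbf X^j_{B_t}$, which contribute to $\mathbf{grad}_j$; (4) each $\mathcal A_j$ adds up its shares of each $\mathbf{grad}_i$ and sets $\langle\mathbf w_i\rangle_j\leftarrow\langle\mathbf w_i\rangle_j-\frac{\alpha}{|B|}\langle\mathbf{grad}_i\rangle_j$. At the end each $\mathcal A_j$ sends $\langle\mathbf w_i\rangle_j$ to $\mathcal A_i$ for $i\ne j$, and $\mathcal A_i$ outputs $\sum_j\langle\mathbf w_i\rangle_j$. **Theorem.** For every $n$ and every secure matrix multiplication protocol used in the SMM steps, this protocol securely computes $f$ in the semi-honest model. That is, write $x_i$ for the input of $\mathcal A_i$ together with the public parameters, $x=(x_1,\dots,x_n)$, and $\mathsf{view}_i(x,\kappa)$ for $1^\kappa$, $x_i$, the random choices of $\mathcal A_i$ and the messages it receives (including those inside SMM). For each $i$ there is a probabilistic polynomial-time simulator $\mathcal S_i$ with $$\{\mathcal S_i(1^\kappa,x_i,f_i(x))\}_{x,\kappa}\cong\{\mathsf{view}_i(x,\kappa)\}_{x,\kappa},$$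 and the joint output satisfies $\{\mathsf{output}(x,\kappa)\}_{x,\kappa}\cong\{f(x)\}_{x,\kappa}$. Here $\cong$ is computational indistinguishability: for every non-uniform probabilistic polynomial-time distinguisher and every polynomial bound on the total length of $x$ in terms of $\kappa$, the distinguishing advantage is at most a negligible function of $\kappa$, uniformly in $x$. -/

import Mathlib

open scoped Matrix

/-! ## A machine model with a step count

Data are binary trees whose leaves are natural numbers. Programs are built from arithmetic on the
leaves, pairing, uniform sampling, branching and loops. Evaluating any program node is charged one
plus the size (in bits) of the data it reads, so a run of cost `c` can be carried out in time
polynomial in `c` on a Turing machine, and every polynomial-time machine can be programmed at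
polynomial cost. -/

/-- Data: binary trees with natural numbers at the leaves. -/
inductive Val where
  | num (n : ℕ) : Val
  | pair (a b : Val) : Val

namespace Val

/-- Size in bits (up to a constant factor). -/
def size : Val → ℕ
  | num n => n.size + 1
  | pair a b => a.size + b.size + 1

def toNat : Val → ℕ
  | num n => n
  | pair _ _ => 0

def fst : Val → Val
  | num _ => num 0
  | pair a _ => a

def snd : Val → Val
  | num _ => num 0
  | pair _ b => b

def isPair : Val → Val
  | num _ => num 0
  | pair _ _ => num 1

/-- Length of a tree read as a list (the length of its right spine). -/
def length : Val → ℕ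
  | num _ => 0
  | pair _ b => b.length + 1

/-- The `k`-th entry of a tree read as a list. -/
def nth (v : Val) : ℕ → Val
  | 0 => v.fst
  | k + 1 => nth v.snd k

/-- Lists as right-nested pairs. -/
def list : List Val → Val
  | [] => num 0
  | a :: l => pair a (list l)

/-- The number `k` in unary, as a list of length `k`; `unary κ` plays the role of `1^κ`. -/
def unary (k : ℕ) : Val := list (List.replicate k (num 0))

end Val

/-- Probabilistic programs. -/
inductive Prog where
  | id : Prog
  | const (n : ℕ) : Prog
  | fst : Prog
  | snd : Prog
  | isPair : Prog
  | add : Prog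
  | sub : Prog
  | mul : Prog
  | div : Prog
  | mod : Prog
  | rand : Prog
  | comp (g f : Prog) : Prog
  | pair (f g : Prog) : Prog
  | ite (c f g : Prog) : Prog
  | loop (f : Prog) : Prog

noncomputable section

/-- The uniform distribution on `{0, …, N - 1}` (the point `0` if `N = 0`). -/
def unifBelow (N : ℕ) : PMF ℕ :=
  PMF.uniformOfFinset (Finset.range (max N 1)) (by simp)

namespace Prog

/-- The joint distribution of the result and the cost of running a program on an input.
Arithmetic acts on a pair of numbers, `rand` draws a uniform natural number below its input,
`ite c f g` runs `g` if `c` returns the number `0` and `f` otherwise, and `loop f` on `(l, s)`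
applies `f` to `s` as many times as the list `l` is long. -/
def run : Prog → Val → PMF (Val × ℕ)
  | id, x => pure (x, 1 + x.size)
  | const n, x => pure (Val.num n, 1 + x.size)
  | fst, x => pure (x.fst, 1 + x.size)
  | snd, x => pure (x.snd, 1 + x.size)
  | isPair, x => pure (x.isPair, 1 + x.size)
  | add, x => pure (Val.num (x.fst.toNat + x.snd.toNat), 1 + x.size)
  | sub, x => pure (Val.num (x.fst.toNat - x.snd.toNat), 1 + x.size)
  | mul, x => pure (Val.num (x.fst.toNat * x.snd.toNat), 1 + x.size)
  | div, x => pure (Val.num (x.fst.toNat / x.snd.toNat), 1 + x.size)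
  | mod, x => pure (Val.num (x.fst.toNat % x.snd.toNat), 1 + x.size)
  | rand, x => do
      let r ← unifBelow x.toNat
      pure (Val.num r, 1 + x.size)
  | comp g f, x => do
      let y ← run f x
      let z ← run g y.1
      pure (z.1, 1 + x.size + y.2 + z.2)
  | pair f g, x => do
      let y ← run f x
      let z ← run g x
      pure (Val.pair y.1 z.1, 1 + x.size + y.2 + z.2)
  | ite c f g, x => do
      let y ← run c x
      let z ← (match y.1 with
        | Val.num 0 => run g x
        | _ => run f x)
      pure (z.1, 1 + x.size + y.2 + z.2)
  | loop f, x =>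
      Nat.rec (motive := fun _ => PMF (Val × ℕ)) (pure (x.snd, 1 + x.size))
        (fun _ prev => do
          let y ← prev
          let z ← run f y.1
          pure (z.1, y.2 + z.2))
        x.fst.length

/-- The distribution of the result of a program. -/
def eval (p : Prog) (x : Val) : PMF Val := (p.run x).map Prod.fst

/-- Strict polynomial running time, on all inputs and all random choices. -/
def PolyTime (p : Prog) : Prop :=
  ∃ P : Polynomial ℕ, ∀ x, ∀ o ∈ (p.run x).support, o.2 ≤ P.eval x.size

/-- The program uses no randomness. -/
def Deterministic (p : Prog) : Prop := ∀ x, ∃ y, p.eval x = PMF.pure y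

end Prog

/-! ## Computational indistinguishability -/

/-- Negligible functions of the security parameter. -/
def Negligible (μ : ℕ → ℝ) : Prop :=
  Asymptotics.SuperpolynomialDecay Filter.atTop (fun κ : ℕ => (κ : ℝ)) μ

/-- The probability that the distinguisher `D` with advice `z` outputs `1` on a sample of `X`. -/
def acceptProb (D : Prog) (z : Val) (X : PMF Val) : ℝ :=
  ((X.bind fun v => D.eval (Val.pair z v)) (Val.num 1)).toReal

/-- Computational indistinguishability of two ensembles, indexed by the security parameter and by
an index `a` (the inputs) of polynomial length, against non-uniform probabilistic polynomial-time
distinguishers, that is, polynomial-time programs with polynomial-size advice. -/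
def CompIndist {ι : Type} (size : ι → ℕ) (X Y : ℕ → ι → PMF Val) : Prop :=
  ∀ D : Prog, D.PolyTime →
  ∀ advice : ℕ → Val, (∃ Q : Polynomial ℕ, ∀ κ, (advice κ).size ≤ Q.eval κ) →
  ∀ P : Polynomial ℕ, ∃ μ : ℕ → ℝ, Negligible μ ∧
    ∀ κ a, size a ≤ P.eval κ →
      |acceptProb D (advice κ) (X κ a) - acceptProb D (advice κ) (Y κ a)| ≤ μ κ

/-! ## Security in the semi-honest model -/

/-- Simulation-based security in the semi-honest model, for a deterministic functionality `f` with
`n` parties (the usual definition for `n = 2`). The index `a` is the tuple of all inputs,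
`input a i` is what party `i` is given, `f a i` is its prescribed output, and `exec κ a` is the
joint distribution of the pairs (view, output) of all parties in an execution of the protocol. -/
def SecurelyComputes {n : ℕ} {ι : Type} (input : ι → Fin n → Val) (f : ι → Fin n → Val)
    (exec : ℕ → ι → PMF (Fin n → Val × Val)) : Prop :=
  (∀ i : Fin n, ∃ S : Prog, S.PolyTime ∧
    CompIndist (fun a => ∑ j, (input a j).size)
      (fun κ a => S.eval (Val.pair (Val.unary κ) (Val.pair (input a i) (f a i))))
      (fun κ a => (exec κ a).map fun o => (o i).1)) ∧
  CompIndist (fun a => ∑ j, (input a j).size)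
    (fun κ a => (exec κ a).map fun o => Val.list (List.ofFn fun i => (o i).2))
    (fun _ a => pure (Val.list (List.ofFn (f a))))

/-! ## Two-party protocols -/

/-- An interactive two-party protocol, possibly with a trusted initializer.
* `setup`: the trusted initializer; from `(1^κ, common input)` it produces a pair, whose components
  are handed to the two parties (a protocol without initializer returns a constant here);
* `tape i`: from `(1^κ, own input)`, the number of random tapes of party `i`;
* `rounds`: from `(1^κ, common input)`, a list whose length is the number of rounds;
* `next i`: from the current view of party `i`, its next message to the other party;
* `output i`: from the final view of party `i`, its output. -/
structure TwoPartyProtocol where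
  setup : Prog
  tape : Fin 2 → Prog
  rounds : Prog
  next : Fin 2 → Prog
  output : Fin 2 → Prog

namespace TwoPartyProtocol

/-- One round: both parties compute a message from their views, and each message is put in front of
the messages received by the other party. A view is a pair whose second component is the list of
received messages, most recent first. -/
def round (π : TwoPartyProtocol) (v : Val × Val) : PMF (Val × Val) := do
  let m₀ ← (π.next 0).eval v.1
  let m₁ ← (π.next 1).eval v.2
  pure (Val.pair v.1.fst (Val.pair m₁ v.1.snd), Val.pair v.2.fst (Val.pair m₀ v.2.snd))

/-- Execution on common input `c` and private inputs `x` and `y`: the joint distribution of the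
(view, output) pairs of the two parties. The view of a party consists of `1^κ`, its input
(with the common input), its random tape, its string from the initializer, and the messages that
it received. -/
def exec (π : TwoPartyProtocol) (κ : ℕ) (c x y : Val) : PMF ((Val × Val) × (Val × Val)) := do
  let x₀ := Val.pair (Val.unary κ) (Val.pair c x)
  let x₁ := Val.pair (Val.unary κ) (Val.pair c y)
  let s ← π.setup.eval (Val.pair (Val.unary κ) c)
  let N₀ ← (π.tape 0).eval x₀
  let r₀ ← unifBelow N₀.toNat
  let N₁ ← (π.tape 1).eval x₁
  let r₁ ← unifBelow N₁.toNat
  let k ← π.rounds.eval (Val.pair (Val.unary κ) c)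
  let v ← Nat.rec (motive := fun _ => PMF (Val × Val))
    (pure (Val.pair (Val.pair x₀ (Val.pair (Val.num r₀) s.fst)) (Val.num 0),
      Val.pair (Val.pair x₁ (Val.pair (Val.num r₁) s.snd)) (Val.num 0)))
    (fun _ prev => prev.bind π.round) k.length
  let o₀ ← (π.output 0).eval v.1
  let o₁ ← (π.output 1).eval v.2
  pure ((v.1, o₀), (v.2, o₁))

/-- All programs run in polynomial time, all randomness of a party comes from its tape, and the
views, hence the whole execution, stay of polynomial size in `κ` and the length of the inputs. -/
structure IsPolyTime (π : TwoPartyProtocol) : Prop where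
  setup_poly : π.setup.PolyTime
  tape_poly : ∀ i, (π.tape i).PolyTime
  tape_det : ∀ i, (π.tape i).Deterministic
  rounds_poly : π.rounds.PolyTime
  rounds_det : π.rounds.Deterministic
  next_poly : ∀ i, (π.next i).PolyTime
  next_det : ∀ i, (π.next i).Deterministic
  output_poly : ∀ i, (π.output i).PolyTime
  output_det : ∀ i, (π.output i).Deterministic
  views_poly : ∃ P : Polynomial ℕ, ∀ κ c x y, ∀ o ∈ (π.exec κ c x y).support,
    o.1.1.size + o.2.1.size ≤ P.eval (κ + c.size + x.size + y.size)

end TwoPartyProtocol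

/-! ## Encodings -/

def encVec {p d : ℕ} (v : Fin d → ZMod p) : Val :=
  Val.list (List.ofFn fun i => Val.num (v i).val)

def encMat {p r c : ℕ} (A : Matrix (Fin r) (Fin c) (ZMod p)) : Val :=
  Val.list (List.ofFn fun i => encVec (A i))

def decMat (p r c : ℕ) (v : Val) : Matrix (Fin r) (Fin c) (ZMod p) :=
  Matrix.of fun i j => (((v.nth i).nth j).toNat : ZMod p)

/-! ## Secure matrix multiplication -/

/-- An instance of secure matrix multiplication over the field with `p` elements: party `0` holds
`A`, party `1` holds `B`. -/
structure MatMulInstance where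
  p : ℕ
  prime : p.Prime
  r : ℕ
  s : ℕ
  c : ℕ
  A : Matrix (Fin r) (Fin s) (ZMod p)
  B : Matrix (Fin s) (Fin c) (ZMod p)

/-- The common input of secure matrix multiplication: the field and the dimensions. -/
def matMulCommon (p r s c : ℕ) : Val :=
  Val.list [Val.num p, Val.unary r, Val.unary s, Val.unary c]

namespace MatMulInstance

instance (a : MatMulInstance) : Fact a.p.Prime := ⟨a.prime⟩

def common (a : MatMulInstance) : Val := matMulCommon a.p a.r a.s a.c

/-- The private input of a party. -/
def input (a : MatMulInstance) (i : Fin 2) : Val :=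
  if i = 0 then encMat a.A else encMat a.B

def size (a : MatMulInstance) : ℕ :=
  a.common.size + (a.input 0).size + (a.input 1).size

/-- The randomized functionality: a uniformly random pair of matrices with sum `A * B`. -/
def shares (a : MatMulInstance) :
    PMF (Matrix (Fin a.r) (Fin a.c) (ZMod a.p) × Matrix (Fin a.r) (Fin a.c) (ZMod a.p)) := do
  let R ← PMF.uniformOfFintype (Fin a.r → Fin a.c → ZMod a.p)
  pure (Matrix.of R, a.A * a.B - Matrix.of R)

end MatMulInstance

/-- The protocol is a secure matrix multiplication (SMM) protocol: it securely computes, in the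
semi-honest model, the randomized functionality that hands the two parties a random additive sharing
of `A * B`. As the functionality is randomized, the view of the corrupted party is compared jointly
with the outputs of both parties. -/
def TwoPartyProtocol.IsSecureMatMul (π : TwoPartyProtocol) : Prop :=
  ∀ i : Fin 2, ∃ S : Prog, S.PolyTime ∧
    CompIndist MatMulInstance.size
      (fun κ a => do
        let R ← a.shares
        let v ← S.eval (Val.pair (Val.unary κ) (Val.pair (Val.pair a.common (a.input i))
          (if i = 0 then encMat R.1 else encMat R.2)))
        pure (Val.list [v, encMat R.1, encMat R.2]))
      (fun κ a => (π.exec κ a.common (a.input 0) (a.input 1)).map fun o =>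
        Val.list [if i = 0 then o.1.1 else o.2.1, o.1.2, o.2.2])

/-! ## Vertically partitioned linear regression -/

/-- An instance of training on data partitioned vertically among `n` parties, over the field with `p`
elements: `m` samples, of which party `i` holds `d i` features; `T` batches of size `b`, given by the
row indices; learning rate `α`; and the party that holds the labels are public. Party `i` holds the
feature matrix `X i` and its initial coefficients `w₀ i`, and party `owner` the labels `y`. -/
structure Regression (n : ℕ) where
  p : ℕ
  prime : p.Prime
  m : ℕ
  d : Fin n → ℕ
  b : ℕ
  T : ℕ
  batch : Fin T → Fin b → Fin m
  α : ZMod p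
  owner : Fin n
  X : ∀ i, Matrix (Fin m) (Fin (d i)) (ZMod p)
  w₀ : ∀ i, Fin (d i) → ZMod p
  y : Fin m → ZMod p

namespace Regression

variable {n : ℕ}

instance (a : Regression n) : Fact a.p.Prime := ⟨a.prime⟩

/-- The factor `α / |B|` of the update. -/
def rate (a : Regression n) : ZMod a.p := a.α / (a.b : ZMod a.p)

/-- The rows of the feature matrix of party `i` in the `t`-th batch. -/
def XB (a : Regression n) (i : Fin n) (t : Fin a.T) : Matrix (Fin a.b) (Fin (a.d i)) (ZMod a.p) :=
  (a.X i).submatrix (a.batch t) id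

/-- The labels in the `t`-th batch. -/
def yB (a : Regression n) (t : Fin a.T) : Fin a.b → ZMod a.p := fun r => a.y (a.batch t r)

/-- The public parameters. -/
def pub (a : Regression n) : Val :=
  Val.list [Val.num a.p, Val.unary a.m, Val.list (List.ofFn fun i => Val.unary (a.d i)),
    Val.unary a.b,
    Val.list (List.ofFn fun t => Val.list (List.ofFn fun r => Val.num (a.batch t r))),
    Val.num a.α.val, Val.num a.rate.val, Val.num a.owner]

/-- What party `i` is given: the public parameters, its features, its initial coefficients and, if
it is the owner of the labels, the labels. -/
def input (a : Regression n) (i : Fin n) : Val :=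
  Val.list [a.pub, encMat (a.X i), encVec (a.w₀ i),
    if i = a.owner then encVec a.y else Val.num 0]

/-! ### The functionality: mini-batch gradient descent on the joint data -/

/-- The batch `X_{B_t}` of the joint feature matrix `X = (X^1, …, X^n)`. -/
def jointXB (a : Regression n) (t : Fin a.T) :
    Matrix (Fin a.b) (Σ i, Fin (a.d i)) (ZMod a.p) :=
  Matrix.of fun r c => a.XB c.1 t r c.2

/-- The update `w ← w - (α / |B|) • X_Bᵀ (X_B w - y_B)`. -/
def update (a : Regression n) (w : (Σ i, Fin (a.d i)) → ZMod a.p) (t : Fin a.T) :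
    (Σ i, Fin (a.d i)) → ZMod a.p :=
  w - a.rate • ((a.jointXB t)ᵀ *ᵥ (a.jointXB t *ᵥ w - a.yB t))

/-- The trained coefficient vector. -/
def trained (a : Regression n) : (Σ i, Fin (a.d i)) → ZMod a.p :=
  (List.finRange a.T).foldl a.update fun c => a.w₀ c.1 c.2

/-- The prescribed output of party `i`: its block of the trained coefficient vector. -/
def functionality (a : Regression n) (i : Fin n) : Val :=
  encVec fun c : Fin (a.d i) => a.trained ⟨i, c⟩

/-! ### The protocol -/

/-- For each party, its random choices and the messages that it received, most recent first. -/
abbrev Log (n : ℕ) := Fin n → List Val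

/-- Party `j` records `v`. -/
def Log.record (L : Log n) (j : Fin n) (v : Val) : Log n := Function.update L j (v :: L j)

/-- Party `i` splits the vector `v` into random additive shares, one for each party, and distributes
them. Its random choices are the shares of the others; it records the whole list of shares. -/
def distribute {p D : ℕ} [NeZero p] (i : Fin n) (v : Fin D → ZMod p) (L : Log n) :
    PMF ((Fin n → Fin D → ZMod p) × Log n) := do
  let r ← PMF.uniformOfFintype (Fin n → Fin D → ZMod p)
  let s : Fin n → Fin D → ZMod p :=
    Function.update r i (v - ∑ j ∈ Finset.univ.erase i, r j)
  pure (s, fun j =>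
    (if j = i then Val.list (List.ofFn fun k => encVec (s k)) else encVec (s j)) :: L j)

/-- Party `i`, holding `A`, and party `j`, holding `B`, run the protocol `π` and obtain their shares
of `A * B`; each of them records its view of this run. -/
def multiply (π : TwoPartyProtocol) (κ : ℕ) {p r s c : ℕ} (i j : Fin n)
    (A : Matrix (Fin r) (Fin s) (ZMod p)) (B : Matrix (Fin s) (Fin c) (ZMod p)) (L : Log n) :
    PMF (Matrix (Fin r) (Fin c) (ZMod p) × Matrix (Fin r) (Fin c) (ZMod p) × Log n) := do
  let o ← π.exec κ (matMulCommon p r s c) (encMat A) (encMat B)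
  pure (decMat p r c o.1.2, decMat p r c o.2.2, (L.record i o.1.1).record j o.2.1)

/-- `W i j` is the share of the coefficients of party `i` that party `j` holds. -/
abbrev Shares (a : Regression n) := ∀ i : Fin n, Fin n → Fin (a.d i) → ZMod a.p

/-- Every party shares its initial coefficients. -/
def shareWeights (a : Regression n) : PMF (a.Shares × Log n) :=
  (List.finRange n).foldlM (init := ((0 : a.Shares), (fun _ => [] : Log n))) fun st i => do
    let q ← distribute i (a.w₀ i) st.2
    pure (Function.update st.1 i q.1, q.2)

/-- The shares of the prediction `X_{B_t} w`: for all `i`, party `i` adds `X^i_{B_t} ⟨w_i⟩_i` to its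
share, and for all `j ≠ i` parties `i` and `j` add their shares of `X^i_{B_t} ⟨w_i⟩_j`. -/
def predict (a : Regression n) (π : TwoPartyProtocol) (κ : ℕ) (t : Fin a.T) (W : a.Shares)
    (L : Log n) : PMF ((Fin n → Fin a.b → ZMod a.p) × Log n) :=
  (List.finRange n).foldlM (init := ((0 : Fin n → Fin a.b → ZMod a.p), L)) fun st i =>
    (List.finRange n).foldlM
      (init := (Function.update st.1 i (st.1 i + a.XB i t *ᵥ W i i), st.2)) fun st j =>
        if j = i then pure st else do
          let o ← multiply π κ i j (a.XB i t) (Matrix.replicateCol (Fin 1) (W i j)) st.2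
          pure (st.1 + Pi.single i (fun r => o.1 r 0) + Pi.single j (fun r => o.2.1 r 0), o.2.2)

/-- The shares of the gradients: `G i j` is the share of the gradient for party `i`'s coefficients
that party `j` holds. For all `i`, party `i` adds `⟨err⟩_iᵀ X^i_{B_t}` to its share of the `i`-th
gradient, and for all `j ≠ i` parties `i` and `j` add their shares of `⟨err⟩_iᵀ X^j_{B_t}` to their
shares of the `j`-th gradient. -/
def gradient (a : Regression n) (π : TwoPartyProtocol) (κ : ℕ) (t : Fin a.T)
    (err : Fin n → Fin a.b → ZMod a.p) (L : Log n) : PMF (a.Shares × Log n) :=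
  (List.finRange n).foldlM (init := ((0 : a.Shares), L)) fun st i =>
    (List.finRange n).foldlM
      (init := (st.1 + Pi.single i (Pi.single i (err i ᵥ* a.XB i t)), st.2)) fun st j =>
        if j = i then pure st else do
          let o ← multiply π κ i j (Matrix.replicateRow (Fin 1) (err i)) (a.XB j t) st.2
          pure (st.1 + Pi.single j (Pi.single i (o.1 0)) + Pi.single j (Pi.single j (o.2.1 0)),
            o.2.2)

/-- One iteration of the training loop: the labels of the batch are shared, the shares of prediction,
error and gradients are computed, and every party updates its shares of all coefficients. -/
def iteration (a : Regression n) (π : TwoPartyProtocol) (κ : ℕ) (st : a.Shares × Log n)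
    (t : Fin a.T) : PMF (a.Shares × Log n) := do
  let y ← distribute a.owner (a.yB t) st.2
  let z ← a.predict π κ t st.1 y.2
  let err : Fin n → Fin a.b → ZMod a.p := fun j => z.1 j - y.1 j
  let g ← a.gradient π κ t err z.2
  pure (fun i j => st.1 i j - a.rate • g.1 i j, g.2)

/-- Every party `j` sends to every other party `i` its share of the coefficients of `i`. -/
def reveal (a : Regression n) (W : a.Shares) (L : Log n) : Log n :=
  (List.finRange n).foldl (init := L) fun L i =>
    (List.finRange n).foldl (init := L) fun L j =>
      if j = i then L else L.record i (encVec (W i j))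

/-- Execution of the protocol: the joint distribution of the (view, output) pairs of the parties.
The view of a party consists of `1^κ`, its input, its random choices and the messages received (those
inside the matrix multiplication protocol included). -/
def exec (π : TwoPartyProtocol) (κ : ℕ) (a : Regression n) : PMF (Fin n → Val × Val) := do
  let st₀ ← a.shareWeights
  let st ← (List.finRange a.T).foldlM (a.iteration π κ) st₀
  let L := a.reveal st.1 st.2
  pure fun i => (Val.pair (Val.unary κ) (Val.pair (a.input i) (Val.list (L i))),
    encVec (∑ j, st.1 i j))

end Regression

end

open scoped Matrix

noncomputable section

/-! ## Polynomial-time kernels -/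

/-! Fix the corrupted party `i₀`. The argument has two halves: the secure multiplications are
replaced, one after the other, by the ideal functionality together with its simulator, at a
negligible cost; what remains is an execution whose view at `i₀` can be simulated perfectly.

For the first half the protocol is rewritten as a sequence of elementary steps acting on a state,
which consists of the variables of all parties and the log of `i₀` (`coupled_exec`). Security of the
multiplication compares a view jointly with both outputs, and the rest of the execution is a
polynomial-time function of these three and of the current state. The state can be given to the
distinguisher as advice, so one call can be exchanged inside an arbitrary context (`step_indist`).
Within an iteration the number of calls depends on `n` only, and finitely many exchanges are
composed (`steps_indist`). The number `T` of iterations grows with the input, so there the losses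
are added up explicitly, and this requires one negligible bound that serves all iterations and all
states at once (`CompIndist.unifIndist`, `loop_indist`, `final_indist`).

For the second half, in the ideal execution all shares add up exactly to the quantities of gradient
descent (`finalSt_mem`). This gives the correctness of the output. It also shows that, among the
shares of its coefficients that `i₀` receives at the end, any one equals the output minus the sum of
the others.

The simulator runs the ideal execution with the data of the other parties replaced by zeros, and
corrects the last message of one party `j₀` so that it matches the output (`simView`). Its view has
the right distribution by a coupling of the true and the dummy execution: the random masks of each
multiplication are shifted by a constant so that everything `i₀` records is the same on both sides.
The delicate point is the final opening. It discloses the shares of the coefficients of `i₀` held by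
the others, which depend on their error shares. The coupling therefore has to align the error shares
of all parties except `j₀`. This is done with the masks of the products of `j₀`, the last party
other than `i₀` in the order of the prediction (`leads_pred_steps`).

The remaining work is to show that all this can be programmed: a calculus of polynomial-time kernels
on trees, and programs for the steps that agree with the mathematical steps on encodings
(`stepV_enc`, `loopV_enc`, `simV_eq`). Polynomial time is demanded on all inputs, so sizes have to
be controlled on malformed trees as well. -/

theorem Polynomial.eval_nat_mono (P : Polynomial ℕ) {a b : ℕ} (h : a ≤ b) :
    P.eval a ≤ P.eval b := by
  rw [Polynomial.eval_eq_sum_range, Polynomial.eval_eq_sum_range]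
  gcongr

namespace Val

@[simp] theorem fst_pair (a b : Val) : (pair a b).fst = a := rfl

@[simp] theorem snd_pair (a b : Val) : (pair a b).snd = b := rfl

@[simp] theorem toNat_num (n : ℕ) : (num n).toNat = n := rfl

theorem one_le_size (v : Val) : 1 ≤ v.size := by cases v <;> simp [size]

theorem size_fst_le (v : Val) : v.fst.size ≤ v.size := by
  cases v <;> simp [size, fst]; omega

theorem size_snd_le (v : Val) : v.snd.size ≤ v.size := by
  cases v <;> simp [size, snd]; omega

theorem size_nth_le (v : Val) (k : ℕ) : (v.nth k).size ≤ v.size := by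
  induction k generalizing v with
  | zero => exact v.size_fst_le
  | succ k ih => exact (ih _).trans v.size_snd_le

theorem length_le_size (v : Val) : v.length ≤ v.size := by
  induction v with
  | num n => simp [length]
  | pair a b _ ih => simp only [length, size]; omega

theorem length_snd (v : Val) : v.snd.length = v.length - 1 := by
  cases v <;> simp [length, snd]

theorem size_toNat_le (v : Val) : v.toNat.size + 1 ≤ v.size := by
  cases v <;> simp [toNat, size]

@[simp] theorem length_list (l : List Val) : (list l).length = l.length := by
  induction l with
  | nil => rfl
  | cons a l ih => simp [list, length, ih]

@[simp] theorem length_unary (k : ℕ) : (unary k).length = k := by simp [unary]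

theorem nth_list (l : List Val) (k : ℕ) (h : k < l.length) : (list l).nth k = l[k] := by
  induction l generalizing k with
  | nil => simp at h
  | cons a l ih =>
    cases k with
    | zero => rfl
    | succ k => simpa [list, nth, snd] using ih k (by simpa using h)

@[simp] theorem nth_list_ofFn {n : ℕ} (f : Fin n → Val) (k : Fin n) :
    (list (List.ofFn f)).nth k = f k := by
  rw [nth_list _ _ (by simp)]; simp

end Val

theorem Nat.size_add_le (a b : ℕ) : (a + b).size ≤ a.size + b.size + 1 := by
  rw [Nat.size_le]
  have ha := Nat.lt_size_self a
  have hb := Nat.lt_size_self b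
  have h1 : 2 ^ a.size ≤ 2 ^ (a.size + b.size) := Nat.pow_le_pow_right (by norm_num) (by omega)
  have h2 : 2 ^ b.size ≤ 2 ^ (a.size + b.size) := Nat.pow_le_pow_right (by norm_num) (by omega)
  rw [pow_succ]; omega

theorem Nat.size_mul_le (a b : ℕ) : (a * b).size ≤ a.size + b.size := by
  rw [Nat.size_le, pow_add]
  exact Nat.mul_lt_mul'' (Nat.lt_size_self a) (Nat.lt_size_self b)

theorem lt_of_mem_support_unifBelow {N r : ℕ} (h : r ∈ (unifBelow N).support) : r < max N 1 := by
  simpa [unifBelow] using h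

theorem PMF.bind_congr_support {α β : Type} (p : PMF α) {f g : α → PMF β}
    (h : ∀ a ∈ p.support, f a = g a) : p.bind f = p.bind g := by
  ext b
  simp only [PMF.bind_apply]
  refine tsum_congr fun a => ?_
  by_cases ha : p a = 0
  · simp [ha]
  · rw [h a ((PMF.mem_support_iff ..).2 ha)]

/-! ### Semantics of programs and the size of their results. -/

namespace Prog

theorem run_comp (g f : Prog) (x : Val) : (comp g f).run x =
    (f.run x).bind fun y => (g.run y.1).bind fun z => PMF.pure (z.1, 1 + x.size + y.2 + z.2) := rfl

theorem run_pair (f g : Prog) (x : Val) : (pair f g).run x =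
    (f.run x).bind fun y => (g.run x).bind fun z =>
      PMF.pure (Val.pair y.1 z.1, 1 + x.size + y.2 + z.2) := rfl

theorem run_rand (x : Val) : rand.run x =
    (unifBelow x.toNat).bind fun r => PMF.pure (Val.num r, 1 + x.size) := rfl

theorem run_ite (c f g : Prog) (x : Val) : (ite c f g).run x =
    (c.run x).bind fun y => (match y.1 with
        | Val.num 0 => g.run x
        | _ => f.run x).bind fun z => PMF.pure (z.1, 1 + x.size + y.2 + z.2) := rfl

/-- The state and the accumulated cost after `k` passes through a loop. -/
def runLoop (f : Prog) (x : Val) : ℕ → PMF (Val × ℕ)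
  | 0 => PMF.pure (x.snd, 1 + x.size)
  | k + 1 => (runLoop f x k).bind fun y => (f.run y.1).bind fun z => PMF.pure (z.1, y.2 + z.2)

theorem run_loop (f : Prog) (x : Val) : (loop f).run x = runLoop f x x.fst.length := by
  have h : ∀ k, Nat.rec (motive := fun _ => PMF (Val × ℕ)) (pure (x.snd, 1 + x.size))
        (fun _ prev => do
          let y ← prev
          let z ← run f y.1
          pure (z.1, y.2 + z.2)) k = runLoop f x k := by
    intro k
    induction k with
    | zero => rfl
    | succ k ih => rw [runLoop, ← ih]; rfl
  exact h _

theorem run_ite_mem {c f g : Prog} {x : Val} {o : Val × ℕ} (h : o ∈ ((ite c f g).run x).support) :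
    ∃ y ∈ (c.run x).support, ∃ z, (z ∈ (f.run x).support ∨ z ∈ (g.run x).support) ∧
      o = (z.1, 1 + x.size + y.2 + z.2) := by
  rw [run_ite] at h
  simp only [PMF.mem_support_bind_iff, PMF.mem_support_pure_iff] at h
  obtain ⟨y, hy, z, hz, rfl⟩ := h
  refine ⟨y, hy, z, ?_, rfl⟩
  split at hz
  · exact Or.inr hz
  · exact Or.inl hz

/-- Every node is charged for the data it reads, so a result is never longer than the cost plus a
constant coming from the literals in the program. Thus a bound on the running time is also a bound
on the size of the output. -/
theorem size_le_cost (q : Prog) :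
    ∃ c, ∀ x, ∀ o ∈ (q.run x).support, o.1.size ≤ o.2 + c := by
  have det : ∀ (q : Prog) (F : Val → Val) (c : ℕ),
      (∀ x, q.run x = PMF.pure (F x, 1 + x.size)) → (∀ x, (F x).size ≤ 1 + x.size + c) →
      ∃ c, ∀ x, ∀ o ∈ (q.run x).support, o.1.size ≤ o.2 + c := by
    intro q F c h1 h2
    refine ⟨c, fun x o ho => ?_⟩
    rw [h1, PMF.mem_support_pure_iff] at ho
    subst ho
    exact h2 x
  have arith : ∀ x : Val, x.fst.toNat.size + x.snd.toNat.size ≤ x.size := by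
    intro x
    have h1 := x.fst.size_toNat_le
    have h2 := x.snd.size_toNat_le
    cases x with
    | num n => simp [Val.fst, Val.snd, Val.toNat]
    | pair a b => simp only [Val.fst, Val.snd, Val.size] at *; omega
  induction q with
  | id => exact det _ (fun x => x) 0 (fun _ => rfl) (fun x => by omega)
  | const n =>
    exact det _ (fun _ => Val.num n) (n.size + 1) (fun _ => rfl)
      (fun x => by simp [Val.size])
  | fst => exact det _ Val.fst 0 (fun _ => rfl) (fun x => by have := x.size_fst_le; omega)
  | snd => exact det _ Val.snd 0 (fun _ => rfl) (fun x => by have := x.size_snd_le; omega)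
  | isPair =>
    exact det _ Val.isPair 1 (fun _ => rfl)
      (fun x => by have := x.one_le_size; cases x <;> simp [Val.isPair, Val.size])
  | add =>
    exact det _ _ 1 (fun _ => rfl) (fun x => by
      have := arith x
      have := Nat.size_add_le x.fst.toNat x.snd.toNat
      simp only [Val.size]; omega)
  | sub =>
    exact det _ _ 1 (fun _ => rfl) (fun x => by
      have := arith x
      have : (x.fst.toNat - x.snd.toNat).size ≤ _ := Nat.size_le_size (Nat.sub_le _ _)
      simp only [Val.size]; omega)
  | mul =>
    exact det _ _ 1 (fun _ => rfl) (fun x => by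
      have := arith x
      have := Nat.size_mul_le x.fst.toNat x.snd.toNat
      simp only [Val.size]; omega)
  | div =>
    exact det _ _ 1 (fun _ => rfl) (fun x => by
      have := arith x
      have : (x.fst.toNat / x.snd.toNat).size ≤ _ := Nat.size_le_size (Nat.div_le_self _ _)
      simp only [Val.size]; omega)
  | mod =>
    exact det _ _ 1 (fun _ => rfl) (fun x => by
      have := arith x
      have : (x.fst.toNat % x.snd.toNat).size ≤ _ := Nat.size_le_size (Nat.mod_le _ _)
      simp only [Val.size]; omega)
  | rand =>
    refine ⟨1, fun x o ho => ?_⟩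
    rw [run_rand] at ho
    simp only [PMF.mem_support_bind_iff, PMF.mem_support_pure_iff] at ho
    obtain ⟨r, hr, rfl⟩ := ho
    have h1 : r ≤ x.toNat := by have := lt_of_mem_support_unifBelow hr; omega
    have h2 := Nat.size_le_size h1
    have h3 := x.size_toNat_le
    simp only [Val.size]; omega
  | comp g f hg hf =>
    obtain ⟨c, hc⟩ := hg
    refine ⟨c, fun x o ho => ?_⟩
    rw [run_comp] at ho
    simp only [PMF.mem_support_bind_iff, PMF.mem_support_pure_iff] at ho
    obtain ⟨y, hy, z, hz, rfl⟩ := ho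
    have := hc _ _ hz
    dsimp only; omega
  | pair f g hf hg =>
    obtain ⟨c, hc⟩ := hf
    obtain ⟨d, hd⟩ := hg
    refine ⟨c + d, fun x o ho => ?_⟩
    rw [run_pair] at ho
    simp only [PMF.mem_support_bind_iff, PMF.mem_support_pure_iff] at ho
    obtain ⟨y, hy, z, hz, rfl⟩ := ho
    have := hc _ _ hy
    have := hd _ _ hz
    simp only [Val.size]; omega
  | ite c f g hc hf hg =>
    obtain ⟨c, hc⟩ := hf
    obtain ⟨d, hd⟩ := hg
    refine ⟨c + d, fun x o ho => ?_⟩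
    obtain ⟨y, hy, z, hz, rfl⟩ := run_ite_mem ho
    dsimp only
    rcases hz with hz | hz
    · have := hc _ _ hz; omega
    · have := hd _ _ hz; omega
  | loop f hf =>
    obtain ⟨c, hc⟩ := hf
    refine ⟨c, fun x o ho => ?_⟩
    rw [run_loop] at ho
    generalize x.fst.length = k at ho
    -- The result of a loop is the result of its last pass, whose cost is part of the total; hence
    -- the constant for the body serves for the loop, whatever the number of passes.
    cases k with
    | zero =>
      simp only [runLoop, PMF.mem_support_pure_iff] at ho
      subst ho
      have := x.size_snd_le
      dsimp only; omega
    | succ k =>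
      simp only [runLoop, PMF.mem_support_bind_iff, PMF.mem_support_pure_iff] at ho
      obtain ⟨y, hy, z, hz, rfl⟩ := ho
      have := hc _ _ hz
      dsimp only; omega

theorem PolyTime.size_le {q : Prog} (h : q.PolyTime) :
    ∃ P : Polynomial ℕ, ∀ x, ∀ y ∈ (q.eval x).support, y.size ≤ P.eval x.size := by
  obtain ⟨P, hP⟩ := h
  obtain ⟨c, hc⟩ := q.size_le_cost
  refine ⟨P + Polynomial.C c, fun x y hy => ?_⟩
  rw [eval, PMF.mem_support_map_iff] at hy
  obtain ⟨o, ho, rfl⟩ := hy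
  have := hP x o ho
  have := hc x o ho
  simp only [Polynomial.eval_add, Polynomial.eval_C]; omega

theorem eval_comp (g f : Prog) (x : Val) : (comp g f).eval x = (f.eval x).bind g.eval := by
  simp only [eval, run_comp, PMF.map_bind, PMF.bind_map, PMF.pure_map, Function.comp_def]
  rfl

theorem eval_pair (f g : Prog) (x : Val) : (pair f g).eval x =
    (f.eval x).bind fun y => (g.eval x).map fun z => Val.pair y z := by
  simp only [eval, run_pair, PMF.map_bind, PMF.bind_map, PMF.pure_map, Function.comp_def,
    PMF.map_comp]
  rfl

theorem eval_ite (c f g : Prog) (x : Val) : (ite c f g).eval x =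
    (c.eval x).bind fun y => match y with
      | Val.num 0 => g.eval x
      | _ => f.eval x := by
  simp only [eval, run_ite, PMF.map_bind, PMF.bind_map, PMF.pure_map, Function.comp_def]
  congr 1; funext y
  split <;> rfl

theorem eval_rand (x : Val) : rand.eval x = (unifBelow x.toNat).map Val.num := by
  simp only [eval, run_rand, PMF.map_bind, PMF.pure_map]
  rfl

end Prog

/-- `k` successive applications of a kernel. -/
def iterM (f : Val → PMF Val) (x : Val) : ℕ → PMF Val
  | 0 => PMF.pure x
  | k + 1 => (iterM f x k).bind f

theorem Prog.map_fst_runLoop (f : Prog) (x : Val) (k : ℕ) :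
    (runLoop f x k).map Prod.fst = iterM f.eval x.snd k := by
  induction k with
  | zero => simp [runLoop, iterM, PMF.pure_map]
  | succ k ih =>
    simp only [iterM, ← ih, runLoop, PMF.map_bind, PMF.pure_map, PMF.bind_map, Function.comp_def]
    rfl

theorem Prog.eval_loop (f : Prog) (x : Val) :
    (loop f).eval x = iterM f.eval x.snd x.fst.length := by
  rw [eval, run_loop, map_fst_runLoop]

/-- The kernel is computed by a probabilistic polynomial-time program. -/
def PolyKernel (f : Val → PMF Val) : Prop := ∃ q : Prog, q.PolyTime ∧ ∀ x, q.eval x = f x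

/-- The function is computed by a polynomial-time program. -/
def PolyFun (f : Val → Val) : Prop := PolyKernel fun x => PMF.pure (f x)

/-- A numerical function computable in polynomial time, with values in binary. -/
def PolyNat (f : Val → ℕ) : Prop := PolyFun fun x => Val.num (f x)

/-- A numerical function computable in polynomial time, with values in unary. -/
def PolyUnary (f : Val → ℕ) : Prop := ∃ g, PolyFun g ∧ ∀ x, (g x).length = f x

/-! ### Closure properties of polynomial-time kernels and functions. -/

namespace PolyKernel

theorem size_le {f : Val → PMF Val} (hf : PolyKernel f) :
    ∃ P : Polynomial ℕ, ∀ x, ∀ y ∈ (f x).support, y.size ≤ P.eval x.size := by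
  obtain ⟨q, hq, e⟩ := hf
  obtain ⟨P, hP⟩ := hq.size_le
  exact ⟨P, fun x y hy => hP x y (by rwa [e])⟩

/-- The second program runs on a result whose size is polynomial in the input, so the two time
bounds compose. -/
theorem bind {f g : Val → PMF Val} (hg : PolyKernel g) (hf : PolyKernel f) :
    PolyKernel fun x => (f x).bind g := by
  obtain ⟨q, ⟨P, hP⟩, e⟩ := hf
  obtain ⟨r, ⟨R, hR⟩, e'⟩ := hg
  obtain ⟨S, hS⟩ := Prog.PolyTime.size_le ⟨P, hP⟩
  refine ⟨.comp r q, ⟨1 + Polynomial.X + P + R.comp S, fun x o ho => ?_⟩, fun x => ?_⟩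
  · rw [Prog.run_comp] at ho
    simp only [PMF.mem_support_bind_iff, PMF.mem_support_pure_iff] at ho
    obtain ⟨y, hy, z, hz, rfl⟩ := ho
    have h1 := hP _ _ hy
    have h2 := (hR _ _ hz).trans
      (R.eval_nat_mono (hS x y.1 ((PMF.mem_support_map_iff ..).2 ⟨y, hy, rfl⟩)))
    simp only [Polynomial.eval_add, Polynomial.eval_one, Polynomial.eval_X, Polynomial.eval_comp]
    omega
  · rw [Prog.eval_comp, e, funext e']

theorem prod {f g : Val → PMF Val} (hf : PolyKernel f) (hg : PolyKernel g) :
    PolyKernel fun x => (f x).bind fun y => (g x).map fun z => Val.pair y z := by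
  obtain ⟨q, ⟨P, hP⟩, e⟩ := hf
  obtain ⟨r, ⟨R, hR⟩, e'⟩ := hg
  refine ⟨.pair q r, ⟨1 + Polynomial.X + P + R, fun x o ho => ?_⟩, fun x => ?_⟩
  · rw [Prog.run_pair] at ho
    simp only [PMF.mem_support_bind_iff, PMF.mem_support_pure_iff] at ho
    obtain ⟨y, hy, z, hz, rfl⟩ := ho
    have h1 := hP _ _ hy
    have h2 := hR _ _ hz
    simp only [Polynomial.eval_add, Polynomial.eval_one, Polynomial.eval_X]
    omega
  · simp only [Prog.eval_pair, e, e']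

theorem of_run {f : Val → Val} (q : Prog) (h : ∀ x, q.run x = PMF.pure (f x, 1 + x.size)) :
    PolyFun f := by
  refine ⟨q, ⟨1 + Polynomial.X, fun x o ho => ?_⟩, fun x => ?_⟩
  · rw [h, PMF.mem_support_pure_iff] at ho
    subst ho
    simp
  · rw [Prog.eval, h, PMF.pure_map]

theorem comp {f : Val → PMF Val} {g : Val → Val} (hf : PolyKernel f) (hg : PolyFun g) :
    PolyKernel fun x => f (g x) := by
  simpa only [PMF.pure_bind] using PolyKernel.bind hf hg

theorem congr {f g : Val → PMF Val} (hf : PolyKernel f) (h : ∀ x, f x = g x) : PolyKernel g := by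
  rwa [← funext h]

/-- Sequential composition in which the second kernel still has access to the input. -/
theorem bind' {f : Val → PMF Val} {g : Val → Val → PMF Val} (hf : PolyKernel f)
    (hg : PolyKernel fun y => g y.fst y.snd) : PolyKernel fun x => (f x).bind (g x) := by
  have h := PolyKernel.bind hg (PolyKernel.prod (PolyKernel.of_run (f := fun x => x) .id
    fun _ => rfl) hf)
  refine h.congr fun x => ?_
  simp only [PMF.pure_bind, PMF.bind_map, Function.comp_def, Val.fst, Val.snd]

theorem rand {f : Val → ℕ} (hf : PolyNat f) : PolyKernel fun x => (unifBelow (f x)).map Val.num := by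
  have h : PolyKernel fun x => (unifBelow x.toNat).map Val.num := by
    refine ⟨.rand, ⟨1 + Polynomial.X, fun x o ho => ?_⟩, Prog.eval_rand⟩
    rw [Prog.run_rand] at ho
    simp only [PMF.mem_support_bind_iff, PMF.mem_support_pure_iff] at ho
    obtain ⟨r, hr, rfl⟩ := ho
    simp
  exact (h.comp (g := fun x => Val.num (f x)) hf).congr fun x => by simp only [Val.toNat_num]

theorem ite {c : Val → ℕ} {f g : Val → PMF Val} (hc : PolyNat c) (hf : PolyKernel f)
    (hg : PolyKernel g) : PolyKernel fun x => if c x = 0 then f x else g x := by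
  obtain ⟨s, ⟨Q, hQ⟩, e''⟩ := hc
  obtain ⟨q, ⟨P, hP⟩, e⟩ := hf
  obtain ⟨r, ⟨R, hR⟩, e'⟩ := hg
  refine ⟨.ite s r q, ⟨1 + Polynomial.X + Q + (P + R), fun x o ho => ?_⟩, fun x => ?_⟩
  · obtain ⟨y, hy, z, hz, rfl⟩ := Prog.run_ite_mem ho
    have h1 := hQ _ _ hy
    simp only [Polynomial.eval_add, Polynomial.eval_one, Polynomial.eval_X]
    rcases hz with hz | hz
    · have := hR _ _ hz; omega
    · have := hP _ _ hz; omega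
  · rw [Prog.eval_ite, e'', PMF.pure_bind]
    cases h : c x with
    | zero => simp only [h, e, if_true]
    | succ k => simp only [h, e', Nat.add_eq_zero_iff, one_ne_zero, and_false, if_false]

/-- A loop whose states stay of polynomial size. -/
theorem loop {b : Val → PMF Val} {pre : Val → Val} (hb : PolyKernel b) (hpre : PolyFun pre)
    (Q : Polynomial ℕ) (hQ : ∀ x, ∀ k ≤ (pre x).fst.length,
      ∀ y ∈ (iterM b (pre x).snd k).support, y.size ≤ Q.eval x.size) :
    PolyKernel fun x => iterM b (pre x).snd (pre x).fst.length := by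
  obtain ⟨q, ⟨P, hP⟩, e⟩ := hb
  obtain rfl : q.eval = b := funext e
  obtain ⟨S, hS⟩ := hpre.size_le
  obtain ⟨r, ⟨R, hR⟩, e'⟩ := hpre
  -- Each pass starts from a state of size at most `Q`, hence costs at most `P.comp Q`; the costs
  -- add up over the passes.
  have key : ∀ x, ∀ k ≤ (pre x).fst.length, ∀ o ∈ (Prog.runLoop q (pre x) k).support,
      o.2 ≤ 1 + (pre x).size + k * (P.comp Q).eval x.size := by
    intro x k
    induction k with
    | zero =>
      intro _ o ho
      simp only [Prog.runLoop, PMF.mem_support_pure_iff] at ho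
      subst ho
      simp
    | succ k ih =>
      intro hk o ho
      simp only [Prog.runLoop, PMF.mem_support_bind_iff, PMF.mem_support_pure_iff] at ho
      obtain ⟨y, hy, z, hz, rfl⟩ := ho
      have h1 := ih (by omega) y hy
      have h2 : y.1 ∈ (iterM q.eval (pre x).snd k).support := by
        rw [← Prog.map_fst_runLoop, PMF.mem_support_map_iff]
        exact ⟨y, hy, rfl⟩
      have h3 := (hP _ _ hz).trans (P.eval_nat_mono (hQ x k (by omega) _ h2))
      rw [Polynomial.eval_comp] at *
      dsimp only
      rw [add_mul, one_mul]; omega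
  refine ⟨.comp (.loop q) r, ⟨1 + Polynomial.X + R + (1 + S + S * P.comp Q), fun x o ho => ?_⟩,
    fun x => ?_⟩
  · rw [Prog.run_comp] at ho
    simp only [PMF.mem_support_bind_iff, PMF.mem_support_pure_iff] at ho
    obtain ⟨y, hy, z, hz, rfl⟩ := ho
    have h1 := hR _ _ hy
    have hy' : y.1 = pre x := by
      have : y.1 ∈ (r.eval x).support := (PMF.mem_support_map_iff ..).2 ⟨y, hy, rfl⟩
      rwa [e', PMF.mem_support_pure_iff] at this
    rw [hy', Prog.run_loop] at hz
    have h2 := key x _ le_rfl z hz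
    have h3 := hS x (pre x) (by simp)
    have h4 : (pre x).fst.length ≤ S.eval x.size :=
      (Val.length_le_size _).trans ((Val.size_fst_le _).trans h3)
    have h5 := Nat.mul_le_mul_right ((P.comp Q).eval x.size) h4
    simp only [Polynomial.eval_add, Polynomial.eval_one, Polynomial.eval_X, Polynomial.eval_mul]
    omega
  · rw [Prog.eval_comp, e', PMF.pure_bind, Prog.eval_loop]

end PolyKernel

namespace PolyFun

theorem size_le {f : Val → Val} (hf : PolyFun f) :
    ∃ P : Polynomial ℕ, ∀ x, (f x).size ≤ P.eval x.size := by
  obtain ⟨P, hP⟩ := PolyKernel.size_le hf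
  exact ⟨P, fun x => hP x _ (by simp)⟩

theorem comp {f g : Val → Val} (hf : PolyFun f) (hg : PolyFun g) : PolyFun fun x => f (g x) :=
  PolyKernel.comp (f := fun x => PMF.pure (f x)) hf hg

theorem id : PolyFun fun x => x := PolyKernel.of_run .id fun _ => rfl

theorem constNum (n : ℕ) : PolyFun fun _ => Val.num n := PolyKernel.of_run (.const n) fun _ => rfl

theorem fst {f : Val → Val} (hf : PolyFun f) : PolyFun fun x => (f x).fst :=
  (PolyKernel.of_run (f := Val.fst) .fst fun _ => rfl).comp hf

theorem snd {f : Val → Val} (hf : PolyFun f) : PolyFun fun x => (f x).snd :=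
  (PolyKernel.of_run (f := Val.snd) .snd fun _ => rfl).comp hf

theorem pair {f g : Val → Val} (hf : PolyFun f) (hg : PolyFun g) :
    PolyFun fun x => Val.pair (f x) (g x) := by
  have := PolyKernel.prod hf hg
  simp only [PMF.pure_bind, PMF.pure_map] at this
  exact this

theorem const (v : Val) : PolyFun fun _ => v := by
  induction v with
  | num n => exact constNum n
  | pair a b ha hb => exact ha.pair hb

theorem ite {c : Val → ℕ} {f g : Val → Val} (hc : PolyNat c) (hf : PolyFun f)
    (hg : PolyFun g) : PolyFun fun x => if c x = 0 then f x else g x := by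
  refine (PolyKernel.ite hc hf hg).congr fun x => ?_
  dsimp only
  split <;> rfl

theorem nthConst {f : Val → Val} (hf : PolyFun f) (k : ℕ) : PolyFun fun x => (f x).nth k := by
  induction k generalizing f with
  | zero => exact hf.fst
  | succ k ih => exact ih hf.snd

theorem list_ofFn {n : ℕ} {f : Fin n → Val → Val} (hf : ∀ i, PolyFun (f i)) :
    PolyFun fun x => Val.list (List.ofFn fun i => f i x) := by
  induction n with
  | zero => exact const _
  | succ n ih =>
    simp only [List.ofFn_succ, Val.list]
    exact (hf 0).pair (ih fun i => hf i.succ)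

end PolyFun

theorem PolyKernel.bindPure {f : Val → PMF Val} {g : Val → Val → Val} (hf : PolyKernel f)
    (hg : PolyFun fun y => g y.fst y.snd) : PolyKernel fun x => (f x).map (g x) :=
  (hf.bind' (g := fun x y => PMF.pure (g x y)) hg).congr fun _ => rfl

namespace PolyNat

theorem num {f : Val → ℕ} (hf : PolyNat f) : PolyFun fun x => Val.num (f x) := hf

theorem const (n : ℕ) : PolyNat fun _ => n := PolyFun.constNum n

theorem toNat {f : Val → Val} (hf : PolyFun f) : PolyNat fun x => (f x).toNat := by
  -- Reading a leaf is obtained from addition: the pair of the value and `0` is added up.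
  have h : PolyNat fun x => x.fst.toNat + x.snd.toNat :=
    PolyKernel.of_run .add fun _ => rfl
  have := h.comp (hf.pair (PolyFun.constNum 0))
  simpa [Val.fst, Val.snd, Val.toNat, PolyNat] using this

theorem add {f g : Val → ℕ} (hf : PolyNat f) (hg : PolyNat g) : PolyNat fun x => f x + g x :=
  (PolyKernel.of_run (f := fun x => Val.num (x.fst.toNat + x.snd.toNat)) .add fun _ => rfl).comp
    (hf.num.pair hg.num)

theorem sub {f g : Val → ℕ} (hf : PolyNat f) (hg : PolyNat g) : PolyNat fun x => f x - g x :=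
  (PolyKernel.of_run (f := fun x => Val.num (x.fst.toNat - x.snd.toNat)) .sub fun _ => rfl).comp
    (hf.num.pair hg.num)

theorem mul {f g : Val → ℕ} (hf : PolyNat f) (hg : PolyNat g) : PolyNat fun x => f x * g x :=
  (PolyKernel.of_run (f := fun x => Val.num (x.fst.toNat * x.snd.toNat)) .mul fun _ => rfl).comp
    (hf.num.pair hg.num)

theorem mod {f g : Val → ℕ} (hf : PolyNat f) (hg : PolyNat g) : PolyNat fun x => f x % g x :=
  (PolyKernel.of_run (f := fun x => Val.num (x.fst.toNat % x.snd.toNat)) .mod fun _ => rfl).comp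
    (hf.num.pair hg.num)

theorem comp {f : Val → ℕ} {g : Val → Val} (hf : PolyNat f) (hg : PolyFun g) :
    PolyNat fun x => f (g x) := PolyFun.comp hf hg

theorem ite {c f g : Val → ℕ} (hc : PolyNat c) (hf : PolyNat f) (hg : PolyNat g) :
    PolyNat fun x => if c x = 0 then f x else g x :=
  (PolyFun.ite hc hf hg).congr fun x => by dsimp only; split <;> rfl

theorem finset_sum {ι : Type} (s : Finset ι) {f : ι → Val → ℕ} (hf : ∀ i, PolyNat (f i)) :
    PolyNat fun x => ∑ i ∈ s, f i x := by
  classical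
  induction s using Finset.induction_on with
  | empty => simpa using const 0
  | insert a s ha ih => simpa only [Finset.sum_insert ha] using (hf a).add ih

end PolyNat

namespace PolyUnary

theorem length {f : Val → Val} (hf : PolyFun f) : PolyUnary fun x => (f x).length :=
  ⟨f, hf, fun _ => rfl⟩

theorem const (n : ℕ) : PolyUnary fun _ => n := ⟨_, PolyFun.const (Val.unary n), by simp⟩

theorem comp {f : Val → ℕ} {g : Val → Val} (hf : PolyUnary f) (hg : PolyFun g) :
    PolyUnary fun x => f (g x) := by
  obtain ⟨u, hu, e⟩ := hf
  exact ⟨_, hu.comp hg, fun x => e _⟩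

end PolyUnary

/-! ### Counted loops -/

/-- Apply `f (n - 1)`, …, `f 0` in turn. -/
def downM (f : ℕ → Val → PMF Val) : ℕ → Val → PMF Val
  | 0, a => PMF.pure a
  | n + 1, a => (f n a).bind (downM f n)

/-- A counted loop whose state grows by at most a polynomial in the size of the input per pass. -/
theorem PolyKernel.downM {n : Val → ℕ} {f : Val → ℕ → Val → PMF Val} {init : Val → Val}
    (hn : PolyUnary n) (hinit : PolyFun init)
    (hf : PolyKernel fun y => f y.fst y.snd.fst.length y.snd.snd)
    (Q : Polynomial ℕ)
    (hQ : ∀ x k a, k < n x → ∀ y ∈ (f x k a).support, y.size ≤ a.size + Q.eval x.size) :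
    PolyKernel fun x => downM (f x) (n x) (init x) := by
  obtain ⟨u, hu, hun⟩ := hn
  -- The loop state consists of the input, the list of the remaining passes and the accumulator. The
  -- tail of the list of remaining passes has the current index as its length, which is why the loop
  -- counts down.
  let b : Val → PMF Val := fun s =>
    (f s.fst s.snd.fst.snd.length s.snd.snd).map fun a => Val.pair s.fst (Val.pair s.snd.fst.snd a)
  have hb : PolyKernel b :=
    PolyKernel.bindPure (g := fun s a => Val.pair s.fst (Val.pair s.snd.fst.snd a))
      (hf.comp (g := fun s => Val.pair s.fst (Val.pair s.snd.fst.snd s.snd.snd))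
        (PolyFun.id.fst.pair (PolyFun.id.snd.fst.snd.pair PolyFun.id.snd.snd)))
      (PolyFun.id.fst.fst.pair (PolyFun.id.fst.snd.fst.snd.pair PolyFun.id.snd))
  let pre : Val → Val := fun x => Val.pair (u x) (Val.pair x (Val.pair (u x) (init x)))
  have hpre : PolyFun pre := hu.pair (PolyFun.id.pair (hu.pair hinit))
  obtain ⟨U, hU⟩ := hu.size_le
  obtain ⟨I, hI⟩ := hinit.size_le
  have key : ∀ x, ∀ k ≤ n x, ∀ y ∈ (iterM b (pre x).snd k).support,
      y.fst = x ∧ y.snd.fst.length = n x - k ∧ y.snd.fst.size ≤ (u x).size ∧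
      y.snd.snd.size ≤ (init x).size + k * Q.eval x.size ∧
      y = Val.pair y.fst (Val.pair y.snd.fst y.snd.snd) := by
    intro x k
    induction k with
    | zero =>
      intro _ y hy
      simp only [iterM, PMF.mem_support_pure_iff] at hy
      subst hy
      simp [pre, Val.fst, Val.snd, hun]
    | succ k ih =>
      intro hk y hy
      simp only [iterM, PMF.mem_support_bind_iff] at hy
      obtain ⟨s, hs, hy⟩ := hy
      obtain ⟨h1, h2, h3, h4, -⟩ := ih (by omega) s hs
      simp only [b, PMF.mem_support_map_iff] at hy
      obtain ⟨a, ha, rfl⟩ := hy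
      have h5 := hQ _ _ _ (by rw [Val.length_snd, h1, h2]; omega) a ha
      have h6 := Val.size_snd_le s.snd.fst
      rw [h1] at h5
      simp only [Val.fst_pair, Val.snd_pair, Val.length_snd, h1, h2, and_true, true_and]
      rw [add_mul, one_mul]
      omega
  have hloop := PolyKernel.loop hb hpre (2 + Polynomial.X + U + (I + U * Q)) fun x k hk y hy => by
    have hk' : k ≤ n x := by simpa [pre, Val.fst, hun] using hk
    obtain ⟨h1, -, h3, h4, h5⟩ := key x k hk' y hy
    rw [h5, h1]
    have h6 := hU x
    have h7 := hI x
    have h8 : k ≤ U.eval x.size := hk'.trans ((hun x).symm.le.trans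
      ((Val.length_le_size _).trans h6))
    have h9 := Nat.mul_le_mul_right (Q.eval x.size) h8
    simp only [Val.size, Polynomial.eval_add, Polynomial.eval_X, Polynomial.eval_mul,
      Polynomial.eval_ofNat]
    omega
  have hres := hloop.bindPure (g := fun _ y => y.snd.snd) (PolyFun.id.snd.snd.snd)
  refine hres.congr fun x => ?_
  -- Performing `k` passes of the loop and then the remaining `n x - k` ones as a recursion gives
  -- the same result for every `k`.
  have e : ∀ k ≤ n x, ((iterM b (pre x).snd k).bind fun s =>
      _root_.downM (f x) (n x - k) s.snd.snd) = _root_.downM (f x) (n x) (init x) := by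
    intro k hk
    induction k with
    | zero => simp [iterM, pre, PMF.pure_bind, Val.snd]
    | succ k ih =>
      rw [← ih (by omega)]
      simp only [iterM, PMF.bind_bind]
      refine PMF.bind_congr_support _ fun s hs => ?_
      obtain ⟨h1, h2, -⟩ := key x k (by omega) s hs
      have e1 : n x - k = (n x - (k + 1)) + 1 := by omega
      have e2 : s.snd.fst.snd.length = n x - (k + 1) := by rw [Val.length_snd, h2]; omega
      simp only [b, PMF.bind_map, Function.comp_def, e1, _root_.downM, h1, e2, Val.snd_pair]
  have := e (n x) le_rfl
  simp only [Nat.sub_self, _root_.downM] at this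
  rw [← this]
  simp only [pre, Val.fst, hun]
  rfl

/-! ### Tables, sums and random tables -/

theorem Val.size_unary (k : ℕ) : (Val.unary k).size = 2 * k + 1 := by
  induction k with
  | zero => simp [unary, list, size]
  | succ k ih =>
    simp only [unary, List.replicate_succ, list, size] at *
    rw [ih]; simp; omega

/-- The list of the values `f 0, …, f (n - 1)`. -/
def Val.tab (n : ℕ) (f : ℕ → Val) : Val := Val.list (List.ofFn fun i : Fin n => f i)

/-- The list of independent samples of `f 0, …, f (n - 1)`. -/
def tabM (n : ℕ) (f : ℕ → PMF Val) : PMF Val :=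
  downM (fun k a => (f k).map fun v => Val.pair v a) n (Val.num 0)

/-- The last index is processed first and new entries go in front, so the table comes out in its
natural order. -/
theorem downM_pure (f : ℕ → Val) (n : ℕ) (a : Val) :
    downM (fun k a => PMF.pure (Val.pair (f k) a)) n a =
      PMF.pure ((List.ofFn fun i : Fin n => f i).foldr Val.pair a) := by
  induction n generalizing a with
  | zero => simp [downM]
  | succ n ih =>
    rw [downM, PMF.pure_bind, ih, List.ofFn_succ']
    simp

theorem Val.foldr_pair (l : List Val) : l.foldr Val.pair (Val.num 0) = Val.list l := by
  induction l with
  | nil => rfl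
  | cons a l ih => simp [ih, Val.list]

theorem tabM_pure (f : ℕ → Val) (n : ℕ) : tabM n (fun k => PMF.pure (f k)) = PMF.pure (Val.tab n f) := by
  simp only [tabM, PMF.pure_map, downM_pure, Val.foldr_pair, Val.tab]

/-- An index below `n x` is no longer in unary than the list that witnesses `n`, so the bound in the
pair of input and index becomes a bound in the input alone, uniform in the index. This is the form
in which counted loops need it. -/
theorem PolyKernel.size_le_index {f : Val → ℕ → PMF Val} {n : Val → ℕ} (hn : PolyUnary n)
    (hf : PolyKernel fun y => f y.fst y.snd.length) :
    ∃ Q : Polynomial ℕ, ∀ x k, k < n x → ∀ v ∈ (f x k).support, v.size ≤ Q.eval x.size := by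
  obtain ⟨P, hP⟩ := hf.size_le
  obtain ⟨u, hu, hun⟩ := hn
  obtain ⟨U, hU⟩ := hu.size_le
  refine ⟨P.comp (Polynomial.X + 2 * U + 2), fun x k hk v hv => ?_⟩
  have h := hP (Val.pair x (Val.unary k)) v (by simpa using hv)
  refine h.trans ?_
  rw [Polynomial.eval_comp]
  refine P.eval_nat_mono ?_
  have h1 := hU x
  have h2 := (u x).length_le_size
  have h3 := hun x
  simp only [Val.size, Val.size_unary, Polynomial.eval_add, Polynomial.eval_X, Polynomial.eval_mul,
    Polynomial.eval_ofNat]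
  omega

theorem PolyKernel.tabM {n : Val → ℕ} {f : Val → ℕ → PMF Val} (hn : PolyUnary n)
    (hf : PolyKernel fun y => f y.fst y.snd.length) : PolyKernel fun x => tabM (n x) (f x) := by
  obtain ⟨Q, hQ⟩ := PolyKernel.size_le_index hn hf
  refine PolyKernel.downM (f := fun x k a => (f x k).map fun v => Val.pair v a) hn
    (PolyFun.constNum 0) ?_ (Q + 1) fun x k a hk y hy => ?_
  · exact PolyKernel.bindPure (g := fun y v => Val.pair v y.snd.snd)
      (hf.comp (g := fun y => Val.pair y.fst y.snd.fst) (PolyFun.id.fst.pair PolyFun.id.snd.fst))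
      (PolyFun.id.snd.pair PolyFun.id.fst.snd.snd)
  · rw [PMF.mem_support_map_iff] at hy
    obtain ⟨v, hv, rfl⟩ := hy
    have := hQ x k hk v hv
    simp only [Val.size, Polynomial.eval_add, Polynomial.eval_one]; omega

theorem PolyFun.tab {n : Val → ℕ} {f : Val → ℕ → Val} (hn : PolyUnary n)
    (hf : PolyFun fun y => f y.fst y.snd.length) : PolyFun fun x => Val.tab (n x) (f x) :=
  (PolyKernel.tabM (f := fun x k => PMF.pure (f x k)) hn hf).congr fun _ => tabM_pure _ _

theorem PolyNat.sum {n : Val → ℕ} {f : Val → ℕ → ℕ} (hn : PolyUnary n)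
    (hf : PolyNat fun y => f y.fst y.snd.length) :
    PolyNat fun x => ∑ k ∈ Finset.range (n x), f x k := by
  obtain ⟨Q, hQ⟩ := PolyKernel.size_le_index (f := fun x k => PMF.pure (Val.num (f x k))) hn hf
  have h := PolyKernel.downM (n := n) (init := fun _ => Val.num 0)
    (f := fun x k a => PMF.pure (Val.num (a.toNat + f x k))) hn
    (PolyFun.constNum 0) ?_ (Q + 1) fun x k a hk y hy => ?_
  · refine h.congr fun x => ?_
    -- The induction has to run over an arbitrary initial value of the accumulator, which is why it
    -- is not started at `0`.
    have : ∀ m (a : Val), downM (fun k a => PMF.pure (Val.num (a.toNat + f x k))) m (Val.num a.toNat)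
        = PMF.pure (Val.num (a.toNat + ∑ k ∈ Finset.range m, f x k)) := by
      intro m
      induction m with
      | zero => intro a; simp [_root_.downM]
      | succ m ih =>
        intro a
        rw [_root_.downM, PMF.pure_bind]
        have := ih (Val.num (a.toNat + f x m))
        simp only [Val.toNat_num] at this ⊢
        rw [this, Finset.sum_range_succ]
        congr 2; ring
    simpa using this (n x) (Val.num 0)
  · exact (PolyNat.toNat PolyFun.id.snd.snd).add
      (hf.comp (g := fun y => Val.pair y.fst y.snd.fst) (PolyFun.id.fst.pair PolyFun.id.snd.fst))
  · rw [PMF.mem_support_pure_iff] at hy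
    subst hy
    have h1 := hQ x k hk _ ((PMF.mem_support_pure_iff ..).2 rfl)
    have h2 := Nat.size_add_le a.toNat (f x k)
    have h3 := a.size_toNat_le
    simp only [Val.size, Polynomial.eval_add, Polynomial.eval_one] at *; omega

theorem PolyUnary.nat {n : Val → ℕ} (hn : PolyUnary n) : PolyNat n := by
  simpa using PolyNat.sum (f := fun _ _ => 1) hn (PolyNat.const 1)

theorem Val.fst_iterate_snd (v : Val) (k : ℕ) : (Val.snd^[k] v).fst = v.nth k := by
  induction k generalizing v with
  | zero => rfl
  | succ k ih => rw [Function.iterate_succ_apply, ih]; rfl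

theorem PolyFun.nth {n : Val → ℕ} {v : Val → Val} (hv : PolyFun v) (hn : PolyUnary n) :
    PolyFun fun x => (v x).nth (n x) := by
  have h := PolyKernel.downM (n := n) (init := v) (f := fun _ _ a => PMF.pure a.snd) hn hv
    PolyFun.id.snd.snd.snd 0 fun x k a _ y hy => by
      rw [PMF.mem_support_pure_iff] at hy
      subst hy
      simpa using a.size_snd_le
  have h' : PolyFun fun x => Val.snd^[n x] (v x) := h.congr fun x => by
    dsimp only
    generalize v x = a
    induction n x generalizing a with
    | zero => rfl
    | succ m ih => rw [_root_.downM, PMF.pure_bind, ih]; rfl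
  exact h'.fst.congr fun x => by simp only [Val.fst_iterate_snd]

/-- A number in binary may be exponentially larger than its length, so it can be converted to unary
only below a bound that is already available in unary. The loop adds one entry for each `k < n x`
with `k < f x`. -/
theorem PolyUnary.min {f n : Val → ℕ} (hf : PolyNat f) (hn : PolyUnary n) :
    PolyUnary fun x => min (f x) (n x) := by
  have h := PolyKernel.downM (n := n) (init := fun _ => Val.num 0)
    (f := fun x k a => PMF.pure (if f x - k = 0 then a else Val.pair (Val.num 0) a)) hn
    (PolyFun.constNum 0)
    (PolyFun.ite ((hf.comp PolyFun.id.fst).sub (PolyUnary.length PolyFun.id.snd.fst).nat)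
      PolyFun.id.snd.snd ((PolyFun.constNum 0).pair PolyFun.id.snd.snd)) 2 fun x k a _ y hy => by
      rw [PMF.mem_support_pure_iff] at hy
      subst hy
      split <;> simp [Val.size]; omega
  have e : ∀ x m a, ∃ b : Val, b.length = a.length + Nat.min (f x) m ∧
      _root_.downM (fun k a => PMF.pure (if f x - k = 0 then a else Val.pair (Val.num 0) a)) m a =
        PMF.pure b := by
    intro x m
    induction m with
    | zero => intro a; exact ⟨a, by simp, rfl⟩
    | succ m ih =>
      intro a
      obtain ⟨b, hb, e⟩ := ih (if f x - m = 0 then a else Val.pair (Val.num 0) a)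
      refine ⟨b, ?_, by rw [_root_.downM, PMF.pure_bind, e]⟩
      rw [hb]
      simp only [Nat.min_def]
      split_ifs <;> (try simp only [Val.length]) <;> omega
  choose g hg using fun x => e x (n x) (Val.num 0)
  exact ⟨g, h.congr fun x => (hg x).2, fun x => by rw [(hg x).1]; simp [Val.length]⟩

/-! ### Uniform distributions -/

section Uniform

variable {α β γ : Type} [Fintype α] [Nonempty α] [Fintype β] [Nonempty β]

theorem PMF.uniformOfFintype_map_equiv (e : α ≃ β) :
    (PMF.uniformOfFintype α).map e = PMF.uniformOfFintype β := by
  ext b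
  rw [PMF.map_apply, tsum_eq_single (e.symm b)]
  · simp [Fintype.card_congr e]
  · intro a ha
    rw [if_neg]
    rintro rfl
    simp at ha

theorem PMF.uniformOfFintype_prod :
    ((PMF.uniformOfFintype α).bind fun a => (PMF.uniformOfFintype β).map fun b => (a, b)) =
      PMF.uniformOfFintype (α × β) := by
  ext ⟨a, b⟩
  rw [PMF.bind_apply, tsum_eq_single a]
  · rw [PMF.map_apply, tsum_eq_single b]
    · simp only [PMF.uniformOfFintype_apply, if_true, Fintype.card_prod, Nat.cast_mul]
      rw [ENNReal.mul_inv] <;> simp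
    · intro b' hb
      rw [if_neg]
      simpa using hb.symm
  · intro a' ha
    rw [PMF.map_apply, mul_eq_zero]
    right
    refine ENNReal.tsum_eq_zero.2 fun b' => if_neg ?_
    simp only [Prod.mk.injEq, not_and]
    intro h
    exact absurd h.symm ha

/-- Independent uniform entries form a uniform vector. The last entry is drawn first, so the
induction splits a vector with `Fin.snocEquiv`. -/
theorem downM_uniform (e : α → Val) (n : ℕ) (a : Val) :
    downM (fun _ a => ((PMF.uniformOfFintype α).map e).map fun v => Val.pair v a) n a =
      (PMF.uniformOfFintype (Fin n → α)).map fun v =>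
        (List.ofFn fun i => e (v i)).foldr Val.pair a := by
  induction n generalizing a with
  | zero =>
    simp only [downM, List.ofFn_zero, List.foldr_nil]
    exact (PMF.bind_const _ _).symm
  | succ n ih =>
    simp only [downM, ih, PMF.bind_map, Function.comp_def]
    let E : α × (Fin n → α) ≃ (Fin (n + 1) → α) := Fin.snocEquiv fun _ => α
    rw [← PMF.uniformOfFintype_map_equiv E, ← PMF.uniformOfFintype_prod, PMF.map_bind, PMF.map_bind]
    congr 1; funext x
    rw [PMF.map_comp, PMF.map_comp]
    congr 1; funext v
    simp only [Function.comp_apply]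
    rw [List.ofFn_succ' (f := fun i => e (E (x, v) i))]
    simp [E, Fin.snocEquiv, -List.ofFn_succ]

theorem tabM_uniform (e : α → Val) (n : ℕ) :
    tabM n (fun _ => (PMF.uniformOfFintype α).map e) =
      (PMF.uniformOfFintype (Fin n → α)).map fun v => Val.list (List.ofFn fun i => e (v i)) := by
  simp only [tabM, downM_uniform, Val.foldr_pair]

end Uniform

theorem unifBelow_eq (p : ℕ) [NeZero p] :
    unifBelow p = (PMF.uniformOfFintype (ZMod p)).map ZMod.val := by
  ext k
  have hp : max p 1 = p := by have := NeZero.pos p; omega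
  rw [unifBelow, PMF.uniformOfFinset_apply, PMF.map_apply]
  by_cases hk : k < p
  · rw [tsum_eq_single (k : ZMod p)]
    · simp [hp, hk, ZMod.val_natCast, Nat.mod_eq_of_lt hk]
    · intro b hb
      rw [if_neg]
      rintro rfl
      simp at hb
  · rw [if_neg (by simpa [hp] using hk)]
    refine (ENNReal.tsum_eq_zero.2 fun b => if_neg ?_).symm
    rintro rfl
    exact hk (ZMod.val_lt b)

/-! ### Modular arithmetic on encodings -/

/-- Reduction modulo `p`, with value `0` if `p = 0`. -/
def modNat (a p : ℕ) : ℕ := if p = 0 then 0 else a % p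

/-- This is the reason for the value `0` at `p = 0`: there `a % p` would be `a`, and reduced entries
would not be bounded on malformed inputs. -/
theorem modNat_le (a p : ℕ) : modNat a p ≤ p := by
  unfold modNat
  split
  · omega
  · exact (Nat.mod_lt _ (by omega)).le

theorem modNat_eq (a p : ℕ) [NeZero p] : modNat a p = (a : ZMod p).val := by
  rw [modNat, if_neg (NeZero.ne p), ZMod.val_natCast]

theorem PolyNat.modNat {f g : Val → ℕ} (hf : PolyNat f) (hg : PolyNat g) :
    PolyNat fun x => modNat (f x) (g x) := PolyNat.ite hg (PolyNat.const 0) (hf.mod hg)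

/-- A vector of residues modulo `p`. -/
def tabMod (p d : ℕ) (f : ℕ → ℕ) : Val := Val.tab d fun k => Val.num (modNat (f k) p)

theorem PolyFun.tabMod {p d : Val → ℕ} {f : Val → ℕ → ℕ} (hp : PolyNat p) (hd : PolyUnary d)
    (hf : PolyNat fun y => f y.fst y.snd.length) :
    PolyFun fun x => tabMod (p x) (d x) (f x) :=
  PolyFun.tab (f := fun x k => Val.num (_root_.modNat (f x k) (p x))) hd
    (hf.modNat (hp.comp PolyFun.id.fst))

theorem Val.size_list_le {l : List Val} {c : ℕ} (h : ∀ v ∈ l, v.size ≤ c) :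
    (Val.list l).size ≤ l.length * (c + 1) + 1 := by
  induction l with
  | nil => simp [list, size]
  | cons a l ih =>
    have h1 := ih fun v hv => h v (by simp [hv])
    have h2 := h a (by simp)
    simp only [list, size, List.length_cons]
    rw [add_mul]; omega

/-- The bound does not involve `f`: reduction modulo `p` cuts off any growth, on arbitrary inputs.
-/
theorem size_tabMod_le (p d : ℕ) (f : ℕ → ℕ) : (tabMod p d f).size ≤ d * (p.size + 2) + 1 := by
  have := Val.size_list_le (l := List.ofFn fun i : Fin d => Val.num (modNat (f i) p))
    (c := p.size + 1) fun v hv => by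
      obtain ⟨i, rfl⟩ := List.mem_ofFn.1 hv
      have := Nat.size_le_size (modNat_le (f i) p)
      simp only [Val.size]; omega
  simpa [tabMod, Val.tab] using this

/-- Computations on natural numbers need to be right only modulo `p`. All local computations of the
protocol are verified through this lemma. -/
theorem tabMod_eq_encVec {p d : ℕ} [NeZero p] (f : ℕ → ℕ) (v : Fin d → ZMod p)
    (h : ∀ i : Fin d, (f i : ZMod p) = v i) : tabMod p d f = encVec v := by
  simp only [tabMod, Val.tab, encVec, modNat_eq, h]

/-- The entry of an encoded vector. -/
def Val.entry (v : Val) (k : ℕ) : ℕ := (v.nth k).toNat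

theorem PolyNat.entry {v : Val → Val} {n : Val → ℕ} (hv : PolyFun v) (hn : PolyUnary n) :
    PolyNat fun x => (v x).entry (n x) := PolyNat.toNat (hv.nth hn)

theorem PolyNat.entryConst {v : Val → Val} (hv : PolyFun v) (k : ℕ) :
    PolyNat fun x => (v x).entry k := PolyNat.toNat (hv.nthConst k)

@[simp] theorem entry_encVec {p d : ℕ} (v : Fin d → ZMod p) (i : Fin d) :
    (encVec v).entry i = (v i).val := by
  simp [Val.entry, encVec]

@[simp] theorem nth_encMat {p r c : ℕ} (A : Matrix (Fin r) (Fin c) (ZMod p)) (i : Fin r) :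
    (encMat A).nth i = encVec (A i) := by simp [encMat]

theorem nth_num_zero (k : ℕ) : (Val.num 0).nth k = Val.num 0 := by
  induction k with
  | zero => rfl
  | succ k ih => exact ih

@[simp] theorem decMat_encMat {p r c : ℕ} [NeZero p] (A : Matrix (Fin r) (Fin c) (ZMod p)) :
    decMat p r c (encMat A) = A := by
  ext i j
  simp [decMat, encVec]

/-! ## Indistinguishability, uniformly in the advice -/

theorem acceptProb_mem (D : Prog) (z : Val) (X : PMF Val) :
    0 ≤ acceptProb D z X ∧ acceptProb D z X ≤ 1 := by
  refine ⟨ENNReal.toReal_nonneg, ?_⟩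
  exact ENNReal.toReal_le_of_le_ofReal zero_le_one (by rw [ENNReal.ofReal_one]; exact PMF.coe_le_one _ _)

/-- The acceptance probability of a mixture is the average of the acceptance probabilities, so a
bound for every point of the support survives averaging. -/
theorem acceptProb_bind_le {α : Type} (D : Prog) (z : Val) (A : PMF α) (f g : α → PMF Val)
    {ε : ℝ} (hε : 0 ≤ ε)
    (h : ∀ a ∈ A.support, acceptProb D z (f a) ≤ acceptProb D z (g a) + ε) :
    acceptProb D z (A.bind f) ≤ acceptProb D z (A.bind g) + ε := by
  have key : ((A.bind f).bind fun v => D.eval (Val.pair z v)) (Val.num 1) ≤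
      ((A.bind g).bind fun v => D.eval (Val.pair z v)) (Val.num 1) + ENNReal.ofReal ε := by
    rw [PMF.bind_bind, PMF.bind_bind, PMF.bind_apply, PMF.bind_apply]
    calc _ ≤ ∑' a, (A a * ((g a).bind fun v => D.eval (Val.pair z v)) (Val.num 1) +
            A a * ENNReal.ofReal ε) := by
          refine ENNReal.tsum_le_tsum fun a => ?_
          by_cases ha : A a = 0
          · simp [ha]
          · rw [← mul_add]
            gcongr
            have := h a ((PMF.mem_support_iff ..).2 ha)
            rw [acceptProb, acceptProb] at this
            rw [← ENNReal.ofReal_toReal (PMF.apply_ne_top ((f a).bind _) _),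
              ← ENNReal.ofReal_toReal (PMF.apply_ne_top ((g a).bind _) _),
              ← ENNReal.ofReal_add ENNReal.toReal_nonneg hε]
            exact ENNReal.ofReal_le_ofReal this
      _ = _ := by rw [ENNReal.tsum_add, ENNReal.tsum_mul_right, PMF.tsum_coe, one_mul]
  have h2 := ENNReal.toReal_mono
    (ENNReal.add_ne_top.2 ⟨PMF.apply_ne_top _ _, ENNReal.ofReal_ne_top⟩) key
  rwa [ENNReal.toReal_add (PMF.apply_ne_top _ _) ENNReal.ofReal_ne_top,
    ENNReal.toReal_ofReal hε] at h2

theorem abs_acceptProb_bind_le {α : Type} (D : Prog) (z : Val) (A : PMF α) (f g : α → PMF Val)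
    {ε : ℝ} (hε : 0 ≤ ε)
    (h : ∀ a ∈ A.support, |acceptProb D z (f a) - acceptProb D z (g a)| ≤ ε) :
    |acceptProb D z (A.bind f) - acceptProb D z (A.bind g)| ≤ ε := by
  rw [abs_le]
  have h1 := acceptProb_bind_le D z A f g hε fun a ha => by have := (abs_le.1 (h a ha)).2; linarith
  have h2 := acceptProb_bind_le D z A g f hε fun a ha => by have := (abs_le.1 (h a ha)).1; linarith
  constructor <;> linarith

/-- Post-processing by a polynomial-time kernel, with extra advice, can be moved into the
distinguisher. -/
theorem exists_acceptProb_bind {D : Prog} (hD : D.PolyTime) {k : Val → Val → PMF Val}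
    (hk : PolyKernel fun y => k y.fst y.snd) :
    ∃ D' : Prog, D'.PolyTime ∧
      ∀ z e X, acceptProb D z (X.bind (k e)) = acceptProb D' (Val.pair z e) X := by
  have h1 : PolyKernel D.eval := ⟨D, hD, fun _ => rfl⟩
  have h2 : PolyKernel fun x => (k x.fst.snd x.snd).map fun y => Val.pair x.fst.fst y :=
    PolyKernel.bindPure (g := fun x y => Val.pair x.fst.fst y)
      (hk.comp (g := fun x => Val.pair x.fst.snd x.snd) (PolyFun.id.fst.snd.pair PolyFun.id.snd))
      (PolyFun.id.fst.fst.fst.pair PolyFun.id.snd)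
  obtain ⟨D', hD', e⟩ := h1.bind h2
  refine ⟨D', hD', fun z e' X => ?_⟩
  simp only [acceptProb, e, Val.fst_pair, Val.snd_pair, PMF.bind_bind, PMF.bind_map]
  rfl

/-- Indistinguishability of two ensembles with bounds that are uniform in the advice. The index
determines the security parameter. -/
def UnifIndist {ι : Type} (κ size : ι → ℕ) (X Y : ι → PMF Val) : Prop :=
  ∀ D : Prog, D.PolyTime → ∀ Q P : Polynomial ℕ, ∃ μ : ℕ → ℝ, Negligible μ ∧ (∀ k, 0 ≤ μ k) ∧
    ∀ a z, size a ≤ P.eval (κ a) → z.size ≤ Q.eval (κ a) →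
      |acceptProb D z (X a) - acceptProb D z (Y a)| ≤ μ (κ a)

theorem Negligible.abs {μ : ℕ → ℝ} (h : Negligible μ) : Negligible fun k => |μ k| :=
  by
  simpa [Negligible] using
    (Asymptotics.superpolynomialDecay_iff_superpolynomialDecay_abs _ _ μ).1 h

/-- Non-uniformity turns a bound for each advice sequence into one bound for all advice: for every
`κ`, fix advice for which some index attains at least half of the supremum of the advantage, and
apply the hypothesis to this single sequence. Uniformity is what allows states of the protocol to
serve as advice in the hybrid argument. -/
theorem CompIndist.unifIndist {ι : Type} {size : ι → ℕ} {X Y : ℕ → ι → PMF Val}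
    (h : CompIndist size X Y) :
    UnifIndist (ι := ℕ × ι) Prod.fst (fun a => size a.2) (fun a => X a.1 a.2)
      (fun a => Y a.1 a.2) := by
  intro D hD Q P
  let adv : ℕ → Val × ι → ℝ := fun κ w =>
    |acceptProb D w.1 (X κ w.2) - acceptProb D w.1 (Y κ w.2)|
  let good : ℕ → Set (Val × ι) := fun κ => {w | size w.2 ≤ P.eval κ ∧ w.1.size ≤ Q.eval κ}
  have hbd : ∀ κ, BddAbove (adv κ '' good κ) := by
    intro κ
    refine ⟨1, ?_⟩
    rintro _ ⟨w, -, rfl⟩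
    have h1 := acceptProb_mem D w.1 (X κ w.2)
    have h2 := acceptProb_mem D w.1 (Y κ w.2)
    exact abs_le.2 ⟨by linarith, by linarith⟩
  have hex : ∀ κ, ∃ z : Val, z.size ≤ (Q + 1).eval κ ∧ ((good κ).Nonempty → ∃ a, (z, a) ∈ good κ ∧
      ∀ w ∈ good κ, adv κ w ≤ 2 * adv κ (z, a)) := by
    intro κ
    by_cases hne : (good κ).Nonempty
    · by_cases hpos : 0 < sSup (adv κ '' good κ)
      · obtain ⟨_, ⟨w, hw, rfl⟩, hlt⟩ := exists_lt_of_lt_csSup (hne.image _) (half_lt_self hpos)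
        refine ⟨w.1, by have := hw.2; simp; omega, fun _ => ⟨w.2, hw, fun w' hw' => ?_⟩⟩
        have := le_csSup (hbd κ) ⟨w', hw', rfl⟩
        change _ ≤ 2 * adv κ w
        linarith
      · obtain ⟨w, hw⟩ := hne
        refine ⟨w.1, by have := hw.2; simp; omega, fun _ => ⟨w.2, hw, fun w' hw' => ?_⟩⟩
        have := le_csSup (hbd κ) ⟨w', hw', rfl⟩
        have h0 : 0 ≤ adv κ (w.1, w.2) := abs_nonneg _
        linarith
    · exact ⟨Val.num 0, by simp [Val.size], fun h => absurd h hne⟩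
  choose z hz hz' using hex
  obtain ⟨μ, hμ, hle⟩ := h D hD z ⟨Q + 1, hz⟩ P
  refine ⟨fun k => 2 * |μ k|, hμ.abs.const_mul 2, fun k => by positivity, fun a w ha hw => ?_⟩
  have hmem : (w, a.2) ∈ good a.1 := ⟨ha, hw⟩
  obtain ⟨b, hb, hmax⟩ := hz' a.1 ⟨_, hmem⟩
  have h1 := hmax _ hmem
  have h2 := hle a.1 b hb.1
  have h3 := le_abs_self (μ a.1)
  simp only [adv] at h1
  linarith

theorem UnifIndist.compIndist {ι : Type} {size : ι → ℕ} {X Y : ℕ → ι → PMF Val}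
    (h : UnifIndist (ι := ℕ × ι) Prod.fst (fun a => size a.2) (fun a => X a.1 a.2)
      (fun a => Y a.1 a.2)) : CompIndist size X Y := by
  intro D hD advice hadv P
  obtain ⟨Q, hQ⟩ := hadv
  obtain ⟨μ, hμ, -, hle⟩ := h D hD Q P
  exact ⟨μ, hμ, fun κ a ha => hle (κ, a) (advice κ) ha (hQ κ)⟩

theorem UnifIndist.of_eq {ι : Type} {κ size : ι → ℕ} {X Y : ι → PMF Val} (h : ∀ a, X a = Y a) :
    UnifIndist κ size X Y := fun D _ _ _ =>
  ⟨0, Asymptotics.superpolynomialDecay_zero _ _, fun _ => le_rfl, fun a z _ _ => by simp [h a]⟩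

/-- Passing to another index set and post-processing with extra advice. -/
theorem UnifIndist.post {ι ι' : Type} {κ size : ι → ℕ} {X Y : ι → PMF Val}
    (h : UnifIndist κ size X Y) {κ' size' : ι' → ℕ} (r : ι' → ι) (hκ : ∀ a, κ (r a) = κ' a)
    (R : Polynomial ℕ) (hsize : ∀ a, size (r a) ≤ R.eval (size' a))
    {k : Val → Val → PMF Val} (hk : PolyKernel fun y => k y.fst y.snd) (e : ι' → Val)
    (he : ∀ a, (e a).size ≤ R.eval (size' a)) :
    UnifIndist κ' size' (fun a => (X (r a)).bind (k (e a))) (fun a => (Y (r a)).bind (k (e a))) := by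
  intro D hD Q P
  obtain ⟨D', hD', hk'⟩ := exists_acceptProb_bind hD hk
  obtain ⟨μ, hμ, h0, hle⟩ := h D' hD' (Q + R.comp P + 1) (R.comp P)
  refine ⟨μ, hμ, h0, fun a z ha hz => ?_⟩
  have h1 : (R.eval (size' a)) ≤ (R.comp P).eval (κ' a) := by
    rw [Polynomial.eval_comp]; exact R.eval_nat_mono ha
  have := hle (r a) (Val.pair z (e a)) (by rw [hκ]; exact (hsize a).trans h1) (by
    have := (he a).trans h1
    simp only [Val.size, hκ, Polynomial.eval_add, Polynomial.eval_one]; omega)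
  rw [hk', hk', ← hκ]
  exact this

namespace Regression

variable {n : ℕ}

/-! ## The protocol as a sequence of elementary steps -/

/-- The state of all parties during an iteration: the current batch, the shares of the coefficients,
of the labels, of the prediction (later the error), and of the gradients. -/
structure Core (n : ℕ) where
  κ : ℕ
  a : Regression n
  XB : ∀ i, Matrix (Fin a.b) (Fin (a.d i)) (ZMod a.p)
  yB : Fin a.b → ZMod a.p
  W : a.Shares
  y : Fin n → Fin a.b → ZMod a.p
  z : Fin n → Fin a.b → ZMod a.p
  G : a.Shares

/-- A secure matrix multiplication: first and second party, for the prediction or the gradient. -/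
inductive Call (n : ℕ) where
  | pred (i j : Fin n) : Call n
  | grad (i j : Fin n) : Call n

namespace Call

def fst : Call n → Fin n
  | pred i _ => i
  | grad i _ => i

def snd : Call n → Fin n
  | pred _ j => j
  | grad _ j => j

/-- The matrices to be multiplied. -/
def inst (q : Call n) (c : Core n) : MatMulInstance :=
  match q with
  | pred i j => ⟨c.a.p, c.a.prime, c.a.b, c.a.d i, 1, c.XB i, Matrix.replicateCol (Fin 1) (c.W i j)⟩
  | grad i j => ⟨c.a.p, c.a.prime, 1, c.a.b, c.a.d j, Matrix.replicateRow (Fin 1) (c.z i), c.XB j⟩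

/-- The state after the outputs `u`, `v` of the two parties are added to their shares. -/
def after (q : Call n) (c : Core n) (u v : Val) : Core n :=
  match q with
  | pred i j => { c with
      z := c.z + Pi.single i (fun r => decMat c.a.p c.a.b 1 u r 0) +
        Pi.single j (fun r => decMat c.a.p c.a.b 1 v r 0) }
  | grad i j => { c with
      G := c.G + Pi.single j (Pi.single i (decMat c.a.p 1 (c.a.d j) u 0)) +
        Pi.single j (Pi.single j (decMat c.a.p 1 (c.a.d j) v 0)) }

/-- The role in the call of the corrupted party `i₀` (`0` if it does not take part). -/
def side (i₀ : Fin n) (q : Call n) : Fin 2 := if i₀ = q.snd then 1 else 0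

end Call

inductive Step (n : ℕ) where
  | distW (i : Fin n) : Step n
  | distY : Step n
  | localP (i : Fin n) : Step n
  | err : Step n
  | localG (i : Fin n) : Step n
  | upd : Step n
  | call (q : Call n) : Step n

/-- Whether party `i₀` records something in the step. -/
def Step.logs (i₀ : Fin n) : Step n → Bool
  | distW _ => true
  | distY => true
  | call q => q.fst ≠ q.snd ∧ (i₀ = q.fst ∨ i₀ = q.snd)
  | _ => false

/-- Random additive shares of `v`, the share of party `i` being the dependent one. -/
def share {p D : ℕ} [NeZero p] (i : Fin n) (v : Fin D → ZMod p) : PMF (Fin n → Fin D → ZMod p) :=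
  (PMF.uniformOfFintype (Fin n → Fin D → ZMod p)).map fun r =>
    Function.update r i (v - ∑ j ∈ Finset.univ.erase i, r j)

/-- What party `i₀` records when party `i` distributes the shares `s`. -/
def shareEntry {p D : ℕ} (i₀ i : Fin n) (s : Fin n → Fin D → ZMod p) : Val :=
  if i₀ = i then Val.list (List.ofFn fun k => encVec (s k)) else encVec (s i₀)

/-- A sample of the view of party `side` and of the outputs in the real execution. -/
def realSample (π : TwoPartyProtocol) (side : Fin 2) (κ : ℕ) (m : MatMulInstance) : PMF Val :=
  (π.exec κ m.common (m.input 0) (m.input 1)).map fun o =>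
    Val.list [if side = 0 then o.1.1 else o.2.1, o.1.2, o.2.2]

/-- A sample of the simulated view of party `side` and of the outputs of the functionality. -/
def idealSample (S : Fin 2 → Prog) (side : Fin 2) (κ : ℕ) (m : MatMulInstance) : PMF Val := do
  let R ← m.shares
  let v ← (S side).eval (Val.pair (Val.unary κ) (Val.pair (Val.pair m.common (m.input side))
    (if side = 0 then encMat R.1 else encMat R.2)))
  pure (Val.list [v, encMat R.1, encMat R.2])

/-- One step, in which `smp side κ m` describes the result of a secure multiplication. The second
component is the new entry of the log of party `i₀`. -/
def Step.exec (smp : Fin 2 → ℕ → MatMulInstance → PMF Val) (i₀ : Fin n) (st : Step n) (c : Core n) :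
    PMF (Core n × Val) :=
  match st with
  | distW i => (share i (c.a.w₀ i)).map fun s =>
      ({ c with W := Function.update c.W i s }, shareEntry i₀ i s)
  | distY => (share c.a.owner c.yB).map fun s => ({ c with y := s }, shareEntry i₀ c.a.owner s)
  | localP i => PMF.pure ({ c with z := Function.update c.z i (c.z i + c.XB i *ᵥ c.W i i) }, .num 0)
  | err => PMF.pure ({ c with z := fun j => c.z j - c.y j }, .num 0)
  | localG i => PMF.pure
      ({ c with G := c.G + Pi.single i (Pi.single i (c.z i ᵥ* c.XB i)) }, .num 0)
  | upd => PMF.pure ({ c with W := fun i j => c.W i j - c.a.rate • c.G i j }, .num 0)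
  | call q => if q.fst = q.snd then PMF.pure (c, .num 0) else
      (smp (q.side i₀) c.κ (q.inst c)).map fun v => (q.after c (v.nth 1) (v.nth 2), v.nth 0)

/-- A state with the log of party `i₀`. -/
abbrev St (n : ℕ) := Core n × List Val

def Step.execLog (smp : Fin 2 → ℕ → MatMulInstance → PMF Val) (i₀ : Fin n) (s : St n) (st : Step n) :
    PMF (St n) :=
  (st.exec smp i₀ s.1).map fun r => (r.1, if st.logs i₀ then r.2 :: s.2 else s.2)

/-! ### Encodings of states -/

def encFam {p : ℕ} {D : Fin n → ℕ} (v : ∀ i, Fin (D i) → ZMod p) : Val :=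
  Val.list (List.ofFn fun i => encVec (v i))

def encShares {p : ℕ} {D : Fin n → ℕ} (W : ∀ i, Fin n → Fin (D i) → ZMod p) : Val :=
  Val.list (List.ofFn fun i => Val.list (List.ofFn fun j => encVec (W i j)))

def encBatch {p b : ℕ} {D : Fin n → ℕ} (X : ∀ i, Matrix (Fin b) (Fin (D i)) (ZMod p))
    (y : Fin b → ZMod p) : Val :=
  Val.pair (Val.list (List.ofFn fun i => encMat (X i))) (encVec y)

/-- The data that stay fixed during the execution. The batches are listed in reverse order. -/
def encEnv (i₀ : Fin n) (κ : ℕ) (a : Regression n) : Val :=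
  Val.list [Val.unary κ, a.input i₀, Val.num a.p, Val.list (List.ofFn fun i => Val.unary (a.d i)),
    Val.unary a.b, Val.num a.rate.val,
    Val.list (List.ofFn fun i => Val.num (if i = a.owner then 1 else 0)), encFam a.w₀,
    Val.list (List.ofFn fun t : Fin a.T => encBatch (fun i => a.XB i t.rev) (a.yB t.rev))]

/-- The environment in front never changes during a run, and the sizes of all other components are
bounded in terms of it. -/
def encCore (i₀ : Fin n) (c : Core n) : Val :=
  Val.list [encEnv i₀ c.κ c.a, encBatch c.XB c.yB, encShares c.W, encFam c.y, encFam c.z,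
    encShares c.G]

def encSt (i₀ : Fin n) (s : St n) : Val := Val.pair (encCore i₀ s.1) (Val.list s.2)

/-! ### Reading an encoded state -/

namespace Read

/-- The numerals here and below are positions in the lists of `encCore` and, below position `0`, of
`encEnv`. -/
def p (x : Val) : ℕ := (x.nth 0).entry 2
def d (x : Val) (i : Fin n) : ℕ := (((x.nth 0).nth 3).nth i).length
def b (x : Val) : ℕ := ((x.nth 0).nth 4).length
def rate (x : Val) : ℕ := (x.nth 0).entry 5
def owner (x : Val) (i : Fin n) : ℕ := ((x.nth 0).nth 6).entry i
def w₀ (x : Val) (i : Fin n) : Val := ((x.nth 0).nth 7).nth i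
def XB (x : Val) (i : Fin n) : Val := (x.nth 1).fst.nth i
def yB (x : Val) : Val := (x.nth 1).snd
def W (x : Val) (i j : Fin n) : Val := ((x.nth 2).nth i).nth j
def y (x : Val) (i : Fin n) : Val := (x.nth 3).nth i
def z (x : Val) (i : Fin n) : Val := (x.nth 4).nth i
def G (x : Val) (i j : Fin n) : Val := ((x.nth 5).nth i).nth j

variable {f : Val → Val} (hf : PolyFun f) (i j : Fin n)
include hf

theorem poly_p : PolyNat fun x => p (f x) := PolyNat.entryConst (hf.nthConst 0) 2
theorem poly_d : PolyUnary fun x => d (f x) i :=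
  PolyUnary.length (((hf.nthConst 0).nthConst 3).nthConst i)
theorem poly_b : PolyUnary fun x => b (f x) := PolyUnary.length ((hf.nthConst 0).nthConst 4)
theorem poly_rate : PolyNat fun x => rate (f x) := PolyNat.entryConst (hf.nthConst 0) 5
theorem poly_owner : PolyNat fun x => owner (f x) i :=
  PolyNat.entryConst ((hf.nthConst 0).nthConst 6) i
theorem poly_w₀ : PolyFun fun x => w₀ (f x) i := ((hf.nthConst 0).nthConst 7).nthConst i
theorem poly_XB : PolyFun fun x => XB (f x) i := (hf.nthConst 1).fst.nthConst i
theorem poly_yB : PolyFun fun x => yB (f x) := (hf.nthConst 1).snd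
theorem poly_W : PolyFun fun x => W (f x) i j := ((hf.nthConst 2).nthConst i).nthConst j
theorem poly_y : PolyFun fun x => y (f x) i := (hf.nthConst 3).nthConst i
theorem poly_z : PolyFun fun x => z (f x) i := (hf.nthConst 4).nthConst i
theorem poly_G : PolyFun fun x => G (f x) i j := ((hf.nthConst 5).nthConst i).nthConst j

omit hf
variable (i₀ : Fin n) (c : Core n)

@[simp] theorem p_enc : p (encCore i₀ c) = c.a.p := rfl
@[simp] theorem d_enc : d (encCore i₀ c) i = c.a.d i := by
  change ((Val.list (List.ofFn fun i => Val.unary (c.a.d i))).nth i).length = _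
  simp
@[simp] theorem b_enc : b (encCore i₀ c) = c.a.b := Val.length_unary _
@[simp] theorem rate_enc : rate (encCore i₀ c) = c.a.rate.val := rfl
@[simp] theorem owner_enc : owner (encCore i₀ c) i = if i = c.a.owner then 1 else 0 := by
  change ((Val.list (List.ofFn fun i => Val.num (if i = c.a.owner then 1 else 0))).nth i).toNat = _
  simp
@[simp] theorem w₀_enc : w₀ (encCore i₀ c) i = encVec (c.a.w₀ i) := Val.nth_list_ofFn _ i
@[simp] theorem XB_enc : XB (encCore i₀ c) i = encMat (c.XB i) := Val.nth_list_ofFn _ i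
@[simp] theorem yB_enc : yB (encCore i₀ c) = encVec c.yB := rfl
@[simp] theorem W_enc : W (encCore i₀ c) i j = encVec (c.W i j) := by
  change ((encShares c.W).nth i).nth j = _
  simp [encShares]
@[simp] theorem y_enc : y (encCore i₀ c) i = encVec (c.y i) := Val.nth_list_ofFn _ i
@[simp] theorem z_enc : z (encCore i₀ c) i = encVec (c.z i) := Val.nth_list_ofFn _ i
@[simp] theorem G_enc : G (encCore i₀ c) i j = encVec (c.G i j) := by
  change ((encShares c.G).nth i).nth j = _
  simp [encShares]

end Read

/-- Replace the fields of an encoded state. -/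
def setW (x v : Val) : Val := Val.list [x.nth 0, x.nth 1, v, x.nth 3, x.nth 4, x.nth 5]
def setY (x v : Val) : Val := Val.list [x.nth 0, x.nth 1, x.nth 2, v, x.nth 4, x.nth 5]
def setZ (x v : Val) : Val := Val.list [x.nth 0, x.nth 1, x.nth 2, x.nth 3, v, x.nth 5]
def setG (x v : Val) : Val := Val.list [x.nth 0, x.nth 1, x.nth 2, x.nth 3, x.nth 4, v]

theorem _root_.PolyFun.list6 {f₁ f₂ f₃ f₄ f₅ f₆ : Val → Val} (h₁ : PolyFun f₁) (h₂ : PolyFun f₂)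
    (h₃ : PolyFun f₃) (h₄ : PolyFun f₄) (h₅ : PolyFun f₅) (h₆ : PolyFun f₆) :
    PolyFun fun x => Val.list [f₁ x, f₂ x, f₃ x, f₄ x, f₅ x, f₆ x] :=
  h₁.pair (h₂.pair (h₃.pair (h₄.pair (h₅.pair (h₆.pair (PolyFun.constNum 0))))))

section

variable {f g : Val → Val} (hf : PolyFun f) (hg : PolyFun g)
include hf hg

theorem poly_setW : PolyFun fun x => setW (f x) (g x) :=
  .list6 (hf.nthConst 0) (hf.nthConst 1) hg (hf.nthConst 3) (hf.nthConst 4) (hf.nthConst 5)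
theorem poly_setY : PolyFun fun x => setY (f x) (g x) :=
  .list6 (hf.nthConst 0) (hf.nthConst 1) (hf.nthConst 2) hg (hf.nthConst 4) (hf.nthConst 5)
theorem poly_setZ : PolyFun fun x => setZ (f x) (g x) :=
  .list6 (hf.nthConst 0) (hf.nthConst 1) (hf.nthConst 2) (hf.nthConst 3) hg (hf.nthConst 5)
theorem poly_setG : PolyFun fun x => setG (f x) (g x) :=
  .list6 (hf.nthConst 0) (hf.nthConst 1) (hf.nthConst 2) (hf.nthConst 3) (hf.nthConst 4) hg

end

/-! ### The local steps on encodings -/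

/-- Subtraction of natural numbers is truncated, so the programs subtract modulo `p` by adding a
multiple with factor `p - 1`. -/
theorem natCast_pred (p : ℕ) [NeZero p] : ((p - 1 : ℕ) : ZMod p) = -1 := by
  rw [Nat.cast_sub (NeZero.pos p)]; simp

theorem _root_.PolyNat.ite_prop {P : Prop} [Decidable P] {f g : Val → ℕ} (hf : PolyNat f)
    (hg : PolyNat g) : PolyNat fun x => if P then f x else g x := by
  split
  · exact hf
  · exact hg

/-- The linear combination `u + s • v` modulo `p`. -/
def axpy (p d s : ℕ) (u v : Val) : Val := tabMod p d fun k => u.entry k + s * v.entry k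

theorem poly_axpy {p d s : Val → ℕ} {u v : Val → Val} (hp : PolyNat p) (hd : PolyUnary d)
    (hs : PolyNat s) (hu : PolyFun u) (hv : PolyFun v) :
    PolyFun fun x => axpy (p x) (d x) (s x) (u x) (v x) :=
  PolyFun.tabMod hp hd ((PolyNat.entry (hu.comp PolyFun.id.fst) (.length PolyFun.id.snd)).add
    ((hs.comp PolyFun.id.fst).mul (PolyNat.entry (hv.comp PolyFun.id.fst) (.length PolyFun.id.snd))))

theorem axpy_encVec {p d : ℕ} [NeZero p] (s : ℕ) (u v : Fin d → ZMod p) :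
    axpy p d s (encVec u) (encVec v) = encVec (u + (s : ZMod p) • v) :=
  tabMod_eq_encVec _ _ fun i => by simp

/-- The product of a matrix and a vector. -/
def mulVecV (p r s : ℕ) (A v : Val) : Val :=
  tabMod p r fun i => ∑ k ∈ Finset.range s, (A.nth i).entry k * v.entry k

theorem poly_mulVecV {p r s : Val → ℕ} {A v : Val → Val} (hp : PolyNat p) (hr : PolyUnary r)
    (hs : PolyUnary s) (hA : PolyFun A) (hv : PolyFun v) :
    PolyFun fun x => mulVecV (p x) (r x) (s x) (A x) (v x) :=
  PolyFun.tabMod hp hr (PolyNat.sum (hs.comp PolyFun.id.fst)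
    ((PolyNat.entry ((hA.comp PolyFun.id.fst.fst).nth (.length PolyFun.id.fst.snd))
      (.length PolyFun.id.snd)).mul
      (PolyNat.entry (hv.comp PolyFun.id.fst.fst) (.length PolyFun.id.snd))))

theorem mulVecV_enc {p r s : ℕ} [NeZero p] (A : Matrix (Fin r) (Fin s) (ZMod p))
    (v : Fin s → ZMod p) : mulVecV p r s (encMat A) (encVec v) = encVec (A *ᵥ v) :=
  tabMod_eq_encVec _ _ fun i => by
    rw [Finset.sum_range]
    simp [Matrix.mulVec, dotProduct]

/-- The product of a row vector and a matrix. -/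
def vecMulV (p r s : ℕ) (v A : Val) : Val :=
  tabMod p s fun j => ∑ k ∈ Finset.range r, v.entry k * (A.nth k).entry j

theorem poly_vecMulV {p r s : Val → ℕ} {A v : Val → Val} (hp : PolyNat p) (hr : PolyUnary r)
    (hs : PolyUnary s) (hv : PolyFun v) (hA : PolyFun A) :
    PolyFun fun x => vecMulV (p x) (r x) (s x) (v x) (A x) :=
  PolyFun.tabMod hp hs (PolyNat.sum (hr.comp PolyFun.id.fst)
    ((PolyNat.entry (hv.comp PolyFun.id.fst.fst) (.length PolyFun.id.snd)).mul
      (PolyNat.entry ((hA.comp PolyFun.id.fst.fst).nth (.length PolyFun.id.snd))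
      (.length PolyFun.id.fst.snd))))

theorem vecMulV_enc {p r s : ℕ} [NeZero p] (A : Matrix (Fin r) (Fin s) (ZMod p))
    (v : Fin r → ZMod p) : vecMulV p r s (encVec v) (encMat A) = encVec (v ᵥ* A) :=
  tabMod_eq_encVec _ _ fun i => by
    rw [Finset.sum_range]
    simp [Matrix.vecMul, dotProduct]

/-- The difference of a product of matrices and a matrix. -/
def mulSubV (p r s c : ℕ) (A B R : Val) : Val :=
  Val.tab r fun i => tabMod p c fun j =>
    (∑ k ∈ Finset.range s, (A.nth i).entry k * (B.nth k).entry j) + (p - 1) * (R.nth i).entry j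

theorem poly_mulSubV {p r s c : Val → ℕ} {A B R : Val → Val} (hp : PolyNat p) (hr : PolyUnary r)
    (hs : PolyUnary s) (hc : PolyUnary c) (hA : PolyFun A) (hB : PolyFun B) (hR : PolyFun R) :
    PolyFun fun x => mulSubV (p x) (r x) (s x) (c x) (A x) (B x) (R x) :=
  PolyFun.tab hr (PolyFun.tabMod (hp.comp PolyFun.id.fst) (hc.comp PolyFun.id.fst)
    ((PolyNat.sum (hs.comp PolyFun.id.fst.fst)
      ((PolyNat.entry ((hA.comp PolyFun.id.fst.fst.fst).nth (.length PolyFun.id.fst.fst.snd))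
        (.length PolyFun.id.snd)).mul
      (PolyNat.entry ((hB.comp PolyFun.id.fst.fst.fst).nth (.length PolyFun.id.snd))
        (.length PolyFun.id.fst.snd)))).add
    (((hp.comp PolyFun.id.fst.fst).sub (.const 1)).mul
      (PolyNat.entry ((hR.comp PolyFun.id.fst.fst).nth (.length PolyFun.id.fst.snd))
        (.length PolyFun.id.snd)))))

theorem mulSubV_enc {p r s c : ℕ} [NeZero p] (A : Matrix (Fin r) (Fin s) (ZMod p))
    (B : Matrix (Fin s) (Fin c) (ZMod p)) (R : Matrix (Fin r) (Fin c) (ZMod p)) :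
    mulSubV p r s c (encMat A) (encMat B) (encMat R) = encMat (A * B - R) := by
  simp only [mulSubV, Val.tab]
  rw [encMat]
  congr 2; funext i
  refine tabMod_eq_encVec _ _ fun j => ?_
  rw [Finset.sum_range]
  simp [Matrix.mul_apply, natCast_pred, sub_eq_add_neg]

end Regression

namespace Regression

variable {n : ℕ}

/-! ### Random shares and simulated multiplications on encodings -/

/-- A uniformly random `r × c` matrix modulo `p`. -/
def randMat (p r c : ℕ) : PMF Val := tabM r fun _ => tabM c fun _ => (unifBelow p).map Val.num

theorem poly_randMat {p r c : Val → ℕ} (hp : PolyNat p) (hr : PolyUnary r) (hc : PolyUnary c) :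
    PolyKernel fun x => randMat (p x) (r x) (c x) :=
  PolyKernel.tabM hr (PolyKernel.tabM (hc.comp PolyFun.id.fst)
    (PolyKernel.rand (hp.comp PolyFun.id.fst.fst)))

theorem randMat_eq (p r c : ℕ) [NeZero p] :
    randMat p r c = (PMF.uniformOfFintype (Fin r → Fin c → ZMod p)).map fun R =>
      encMat (Matrix.of R) := by
  have h : (fun _ : ℕ => (unifBelow p).map Val.num) = fun _ =>
      (PMF.uniformOfFintype (ZMod p)).map fun a => Val.num a.val := by
    funext _; rw [unifBelow_eq, PMF.map_comp]; rfl
  simp only [randMat, h, tabM_uniform]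
  rfl

/-- Shares of `v`; the dependent share is the one of the party `k` with `cond k ≠ 0`. -/
def shareV (p D : ℕ) (cond : Fin n → ℕ) (v : Val) : PMF Val :=
  (randMat p n D).map fun R => Val.list (List.ofFn fun k : Fin n =>
    if cond k = 0 then R.nth k else tabMod p D fun c =>
      v.entry c + (p - 1) * ∑ j ∈ Finset.univ.erase k, (R.nth (j : Fin n)).entry c)

theorem poly_shareV {p D : Val → ℕ} {cond : Fin n → Val → ℕ} {v : Val → Val} (hp : PolyNat p)
    (hD : PolyUnary D) (hc : ∀ k, PolyNat (cond k)) (hv : PolyFun v) :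
    PolyKernel fun x => shareV (p x) (D x) (fun k => cond k x) (v x) := by
  refine PolyKernel.bindPure (g := fun x R => Val.list (List.ofFn fun k : Fin n =>
    if cond k x = 0 then R.nth k else tabMod (p x) (D x) fun c =>
      (v x).entry c + (p x - 1) * ∑ j ∈ Finset.univ.erase k, (R.nth (j : Fin n)).entry c))
    (poly_randMat hp (.const n) hD) ?_
  refine PolyFun.list_ofFn fun k => PolyFun.ite ((hc k).comp PolyFun.id.fst)
    (PolyFun.id.snd.nthConst k) (PolyFun.tabMod (hp.comp PolyFun.id.fst) (hD.comp PolyFun.id.fst) ?_)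
  exact (PolyNat.entry (hv.comp PolyFun.id.fst.fst) (.length PolyFun.id.snd)).add
    (((hp.comp PolyFun.id.fst.fst).sub (.const 1)).mul (PolyNat.finset_sum _ fun j =>
      PolyNat.entry (PolyFun.id.fst.snd.nthConst j) (.length PolyFun.id.snd)))

/-- The program draws the same uniform shares as `share`, and overwrites the one of party `i` by the
same difference. -/
theorem shareV_eq {p D : ℕ} [NeZero p] (i : Fin n) (v : Fin D → ZMod p) :
    shareV p D (fun k => if k = i then 1 else 0) (encVec v) =
      (share i v).map fun s => Val.list (List.ofFn fun k => encVec (s k)) := by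
  rw [shareV, randMat_eq, share, PMF.map_comp, PMF.map_comp]
  congr 1; funext r
  simp only [Function.comp_apply]
  congr 2; funext k
  by_cases hk : k = i
  · subst hk
    simp only [if_true, one_ne_zero, if_false, Function.update_self]
    refine tabMod_eq_encVec _ _ fun c => ?_
    simp [natCast_pred, sub_eq_add_neg]
  · simp [hk]
    rfl

/-- `idealSample` on encodings; the input lists `1^κ`, the common input and the two matrices. -/
def idealSampleV (S : Fin 2 → Prog) (side : Fin 2) (x : Val) : PMF Val :=
  (randMat ((x.nth 1).entry 0) ((x.nth 1).nth 1).length ((x.nth 1).nth 3).length).bind fun R =>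
    let R' := mulSubV ((x.nth 1).entry 0) ((x.nth 1).nth 1).length ((x.nth 1).nth 2).length
      ((x.nth 1).nth 3).length (x.nth 2) (x.nth 3) R
    ((S side).eval (Val.pair (x.nth 0) (Val.pair
      (Val.pair (x.nth 1) (if side = 0 then x.nth 2 else x.nth 3))
      (if side = 0 then R else R')))).map fun v => Val.list [v, R, R']

theorem _root_.PolyFun.ite_prop {P : Prop} [Decidable P] {f g : Val → Val} (hf : PolyFun f)
    (hg : PolyFun g) : PolyFun fun x => if P then f x else g x := by
  split
  · exact hf
  · exact hg

theorem poly_idealSampleV {S : Fin 2 → Prog} {side : Fin 2} (hS : (S side).PolyTime) :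
    PolyKernel (idealSampleV S side) := by
  have hx : PolyFun fun x => x := PolyFun.id
  have hy : PolyFun fun y => y.fst := hx.fst
  have hm : ∀ {f : Val → Val} {R : Val → Val}, PolyFun f → PolyFun R → PolyFun fun y =>
      mulSubV (((f y).nth 1).entry 0) (((f y).nth 1).nth 1).length (((f y).nth 1).nth 2).length
        (((f y).nth 1).nth 3).length ((f y).nth 2) ((f y).nth 3) (R y) := fun hf hR =>
    poly_mulSubV (PolyNat.entryConst (hf.nthConst 1) 0) (.length ((hf.nthConst 1).nthConst 1))
      (.length ((hf.nthConst 1).nthConst 2)) (.length ((hf.nthConst 1).nthConst 3))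
      (hf.nthConst 2) (hf.nthConst 3) hR
  refine PolyKernel.bind' (g := fun x R =>
    ((S side).eval (Val.pair (x.nth 0) (Val.pair
      (Val.pair (x.nth 1) (if side = 0 then x.nth 2 else x.nth 3))
      (if side = 0 then R else _)))).map fun v => Val.list [v, R, _])
    (poly_randMat (PolyNat.entryConst (hx.nthConst 1) 0) (.length ((hx.nthConst 1).nthConst 1))
      (.length ((hx.nthConst 1).nthConst 3))) ?_
  refine PolyKernel.bindPure (g := fun y v => Val.list [v, y.snd, _]) (PolyKernel.comp
    ⟨S side, hS, fun _ => rfl⟩ ((hy.nthConst 0).pair (((hy.nthConst 1).pair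
      (PolyFun.ite_prop (hy.nthConst 2) (hy.nthConst 3))).pair
      (PolyFun.ite_prop hx.snd (hm hy hx.snd))))) ?_
  exact hx.snd.pair (hx.fst.snd.pair ((hm hy.fst hx.fst.snd).pair (.constNum 0)))

/-- Shows that the ideal sample, which involves the second matrix as well, is computable from an
encoding of the instance. The simulation of a single party is not at stake here: in the hybrids the
whole state is known. -/
theorem idealSampleV_eq (S : Fin 2 → Prog) (side : Fin 2) (κ : ℕ) (m : MatMulInstance) :
    idealSampleV S side (Val.list [Val.unary κ, m.common, m.input 0, m.input 1]) =
      idealSample S side κ m := by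
  have h : ∀ R, mulSubV m.p m.r m.s m.c (encMat m.A) (encMat m.B) (encMat R) =
    encMat (m.A * m.B - R) := fun R => mulSubV_enc _ _ _
  have h1 : (Val.list [Val.unary κ, m.common, m.input 0, m.input 1]).nth 1 = m.common := rfl
  have h2 : m.common.entry 0 = m.p := rfl
  have h3 : (m.common.nth 1).length = m.r := Val.length_unary _
  have h4 : (m.common.nth 2).length = m.s := Val.length_unary _
  have h5 : (m.common.nth 3).length = m.c := Val.length_unary _
  have h6 : (Val.list [Val.unary κ, m.common, m.input 0, m.input 1]).nth 2 = encMat m.A := rfl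
  have h7 : (Val.list [Val.unary κ, m.common, m.input 0, m.input 1]).nth 3 = encMat m.B := rfl
  have h8 : (Val.list [Val.unary κ, m.common, m.input 0, m.input 1]).nth 0 = Val.unary κ := rfl
  simp only [idealSampleV, h1, h2, h3, h4, h5, h6, h7, h8, randMat_eq, PMF.bind_map, idealSample,
    MatMulInstance.shares, bind_assoc, pure_bind]
  change PMF.bind _ _ = PMF.bind _ _
  congr 1; funext R
  simp only [Function.comp_apply, h]
  have h9 : m.input side = if side = 0 then encMat m.A else encMat m.B := rfl
  rw [h9]
  rfl

/-! ### The steps on encodings -/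

def callInput (q : Call n) (x : Val) : Val :=
  match q with
  | .pred i j => Val.list [(x.nth 0).nth 0,
      Val.list [Val.num (Read.p x), (x.nth 0).nth 4, ((x.nth 0).nth 3).nth i, Val.unary 1],
      Read.XB x i, Val.tab (Read.d x i) fun k => Val.list [(Read.W x i j).nth k]]
  | .grad i j => Val.list [(x.nth 0).nth 0,
      Val.list [Val.num (Read.p x), Val.unary 1, (x.nth 0).nth 4, ((x.nth 0).nth 3).nth j],
      Val.list [Read.z x i], Read.XB x j]

theorem poly_callInput (q : Call n) : PolyFun (callInput q) := by
  have hx : PolyFun fun x => x := PolyFun.id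
  have h0 := hx.nthConst 0
  cases q with
  | pred i j =>
    exact (h0.nthConst 0).pair (PolyFun.pair ((Read.poly_p hx).num.pair ((h0.nthConst 4).pair
      (((h0.nthConst 3).nthConst i).pair ((PolyFun.const _).pair (.constNum 0)))))
      ((Read.poly_XB hx i).pair (PolyFun.pair (PolyFun.tab (Read.poly_d hx i)
        (((Read.poly_W hx.fst i j).nth (.length hx.snd)).pair (.constNum 0))) (.constNum 0))))
  | grad i j =>
    exact (h0.nthConst 0).pair (PolyFun.pair ((Read.poly_p hx).num.pair ((PolyFun.const _).pair
      ((h0.nthConst 4).pair (((h0.nthConst 3).nthConst j).pair (.constNum 0)))))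
      (((Read.poly_z hx i).pair (.constNum 0)).pair ((Read.poly_XB hx j).pair (.constNum 0))))

theorem callInput_enc (i₀ : Fin n) (q : Call n) (c : Core n) :
    callInput q (encCore i₀ c) = Val.list [Val.unary c.κ, (q.inst c).common, (q.inst c).input 0,
      (q.inst c).input 1] := by
  have h3 : ∀ i : Fin n, (((encCore i₀ c).nth 0).nth 3).nth i = Val.unary (c.a.d i) :=
    fun i => Val.nth_list_ofFn _ i
  have h0 : ((encCore i₀ c).nth 0).nth 0 = Val.unary c.κ := rfl
  have h4 : ((encCore i₀ c).nth 0).nth 4 = Val.unary c.a.b := rfl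
  cases q with
  | pred i j =>
    have h6 : (Call.inst (.pred i j) c).input 1 =
      encMat (Matrix.replicateCol (Fin 1) (c.W i j)) := rfl
    simp only [callInput, h0, h3, h4, Read.p_enc, Read.XB_enc, Read.d_enc, Read.W_enc, h6]
    have : (Val.tab (c.a.d i) fun k => Val.list [(encVec (c.W i j)).nth k]) =
        encMat (Matrix.replicateCol (Fin 1) (c.W i j)) := by
      simp only [Val.tab, encMat, encVec, Val.nth_list_ofFn, List.ofFn_succ, List.ofFn_zero]
      rfl
    rw [this]
    rfl
  | grad i j =>
    have h5 : (Call.inst (.grad i j) c).input 0 =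
      encMat (Matrix.replicateRow (Fin 1) (c.z i)) := rfl
    simp only [callInput, h0, h3, h4, Read.p_enc, Read.XB_enc, Read.z_enc, h5]
    simp only [encMat, List.ofFn_succ, List.ofFn_zero]
    rfl

def afterV (q : Call n) (x u v : Val) : Val :=
  match q with
  | .pred i j => setZ x (Val.list (List.ofFn fun k => tabMod (Read.p x) (Read.b x) fun r =>
      (Read.z x k).entry r + (if k = i then (u.nth r).entry 0 else 0) +
        (if k = j then (v.nth r).entry 0 else 0)))
  | .grad i j => setG x (Val.list (List.ofFn fun k => Val.list (List.ofFn fun l =>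
      tabMod (Read.p x) (Read.d x k) fun r =>
        (Read.G x k l).entry r + (if k = j ∧ l = i then (u.nth 0).entry r else 0) +
          (if k = j ∧ l = j then (v.nth 0).entry r else 0))))

theorem poly_afterV (q : Call n) : PolyFun fun y => afterV q y.fst (y.snd.nth 1) (y.snd.nth 2) := by
  have hx : PolyFun fun x => x := PolyFun.id
  cases q with
  | pred i j =>
    refine poly_setZ hx.fst (PolyFun.list_ofFn fun k => PolyFun.tabMod (Read.poly_p hx.fst)
      (Read.poly_b hx.fst) (((PolyNat.entry (Read.poly_z hx.fst.fst k) (.length hx.snd)).add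
        (.ite_prop ?_ (.const 0))).add (.ite_prop ?_ (.const 0))))
    · exact PolyNat.entryConst ((hx.fst.snd.nthConst 1).nth (.length hx.snd)) 0
    · exact PolyNat.entryConst ((hx.fst.snd.nthConst 2).nth (.length hx.snd)) 0
  | grad i j =>
    refine poly_setG hx.fst (PolyFun.list_ofFn fun k => PolyFun.list_ofFn fun l =>
      PolyFun.tabMod (Read.poly_p hx.fst)
      (Read.poly_d hx.fst k) (((PolyNat.entry (Read.poly_G hx.fst.fst k l) (.length hx.snd)).add
        (.ite_prop ?_ (.const 0))).add (.ite_prop ?_ (.const 0))))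
    · exact PolyNat.entry ((hx.fst.snd.nthConst 1).nthConst 0) (.length hx.snd)
    · exact PolyNat.entry ((hx.fst.snd.nthConst 2).nthConst 0) (.length hx.snd)

theorem afterV_enc (i₀ : Fin n) (q : Call n) (c : Core n) (u v : Val) :
    afterV q (encCore i₀ c) u v = encCore i₀ (q.after c u v) := by
  cases q with
  | pred i j =>
    have : encCore i₀ (Call.after (.pred i j) c u v) =
      setZ (encCore i₀ c) (encFam (Call.after (.pred i j) c u v).z) := rfl
    rw [this, afterV, encFam]
    congr 3; funext k
    rw [Read.p_enc, Read.b_enc]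
    refine tabMod_eq_encVec _ _ fun r => ?_
    simp only [Read.z_enc, entry_encVec, Call.after, Pi.add_apply, Pi.single_apply]
    push_cast
    simp only [ZMod.natCast_val, ZMod.cast_id', id]
    congr 1
    · congr 1
      split <;> simp [decMat, Val.entry]
    · split <;> simp [decMat, Val.entry]
  | grad i j =>
    have : encCore i₀ (Call.after (.grad i j) c u v) =
      setG (encCore i₀ c) (encShares (Call.after (.grad i j) c u v).G) := rfl
    rw [this, afterV, encShares]
    congr 3; funext k
    congr 2; funext l
    rw [Read.p_enc, Read.d_enc]
    refine tabMod_eq_encVec _ _ fun r => ?_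
    simp only [Read.G_enc, entry_encVec, Call.after, Pi.add_apply]
    push_cast
    simp only [ZMod.natCast_val, ZMod.cast_id', id]
    by_cases hk : k = j
    · subst hk
      simp only [true_and, Pi.single_eq_same, Pi.single_apply]
      congr 1
      · congr 1
        split <;> simp [decMat, Val.entry]
      · split <;> simp [decMat, Val.entry]
    · simp [hk]

/-- One step of the ideal execution on encodings. -/
def stepV (S : Fin 2 → Prog) (i₀ : Fin n) (st : Step n) (x : Val) : PMF Val :=
  match st with
  | .distW i => (shareV (Read.p x) (Read.d x i) (fun k => if k = i then 1 else 0)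
      (Read.w₀ x i)).map fun s => Val.pair (setW x (Val.list (List.ofFn fun k =>
        if k = i then s else (x.nth 2).nth k))) (if i₀ = i then s else s.nth i₀)
  | .distY => (shareV (n := n) (Read.p x) (Read.b x) (Read.owner x) (Read.yB x)).map fun s =>
      Val.pair (setY x s) (if Read.owner x i₀ = 0 then s.nth i₀ else s)
  | .localP i => PMF.pure (Val.pair (setZ x (Val.list (List.ofFn fun k => if k = i then
      axpy (Read.p x) (Read.b x) 1 (Read.z x i)
        (mulVecV (Read.p x) (Read.b x) (Read.d x i) (Read.XB x i) (Read.W x i i)) else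
      Read.z x k))) (.num 0))
  | .err => PMF.pure (Val.pair (setZ x (Val.list (List.ofFn fun k : Fin n =>
      axpy (Read.p x) (Read.b x) (Read.p x - 1) (Read.z x k) (Read.y x k)))) (.num 0))
  | .localG i => PMF.pure (Val.pair (setG x (Val.list (List.ofFn fun k => Val.list (List.ofFn fun l =>
      if k = i ∧ l = i then axpy (Read.p x) (Read.d x i) 1 (Read.G x i i)
        (vecMulV (Read.p x) (Read.b x) (Read.d x i) (Read.z x i) (Read.XB x i)) else
      Read.G x k l)))) (.num 0))
  | .upd => PMF.pure (Val.pair (setW x (Val.list (List.ofFn fun k : Fin n =>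
      Val.list (List.ofFn fun l : Fin n => axpy (Read.p x) (Read.d x k) ((Read.p x - 1) * Read.rate x)
        (Read.W x k l) (Read.G x k l))))) (.num 0))
  | .call q => if q.fst = q.snd then PMF.pure (Val.pair x (.num 0)) else
      (idealSampleV S (q.side i₀) (callInput q x)).map fun v =>
        Val.pair (afterV q x (v.nth 1) (v.nth 2)) (v.nth 0)

theorem poly_stepV {S : Fin 2 → Prog} (hS : ∀ i, (S i).PolyTime) (i₀ : Fin n) (st : Step n) :
    PolyKernel (stepV S i₀ st) := by
  have hx : PolyFun fun x => x := PolyFun.id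
  cases st with
  | distW i =>
    refine PolyKernel.bindPure (g := fun x s => Val.pair (setW x (Val.list (List.ofFn fun k =>
        if k = i then s else (x.nth 2).nth k))) (if i₀ = i then s else s.nth i₀))
      (poly_shareV (Read.poly_p hx) (Read.poly_d hx i) (fun k => .const _) (Read.poly_w₀ hx i)) ?_
    exact (poly_setW hx.fst (.list_ofFn fun k => .ite_prop hx.snd
      ((hx.fst.nthConst 2).nthConst k))).pair (.ite_prop hx.snd (hx.snd.nthConst i₀))
  | distY =>
    refine PolyKernel.bindPure (g := fun x s =>
        Val.pair (setY x s) (if Read.owner x i₀ = 0 then s.nth i₀ else s))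
      (poly_shareV (Read.poly_p hx) (Read.poly_b hx) (Read.poly_owner hx) (Read.poly_yB hx)) ?_
    exact (poly_setY hx.fst hx.snd).pair (.ite (Read.poly_owner hx.fst i₀)
      (hx.snd.nthConst i₀) hx.snd)
  | localP i =>
    exact PolyFun.pair (poly_setZ hx (.list_ofFn fun k => .ite_prop
      (poly_axpy (Read.poly_p hx) (Read.poly_b hx) (.const 1) (Read.poly_z hx i)
        (poly_mulVecV (Read.poly_p hx) (Read.poly_b hx) (Read.poly_d hx i) (Read.poly_XB hx i)
          (Read.poly_W hx i i))) (Read.poly_z hx k))) (.constNum 0)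
  | err =>
    exact PolyFun.pair (poly_setZ hx (.list_ofFn fun k => poly_axpy (Read.poly_p hx)
      (Read.poly_b hx) ((Read.poly_p hx).sub (.const 1)) (Read.poly_z hx k) (Read.poly_y hx k)))
      (.constNum 0)
  | localG i =>
    exact PolyFun.pair (poly_setG hx (.list_ofFn fun k => .list_ofFn fun l => .ite_prop
      (poly_axpy (Read.poly_p hx) (Read.poly_d hx i) (.const 1) (Read.poly_G hx i i)
        (poly_vecMulV (Read.poly_p hx) (Read.poly_b hx) (Read.poly_d hx i) (Read.poly_z hx i)
          (Read.poly_XB hx i))) (Read.poly_G hx k l))) (.constNum 0)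
  | upd =>
    exact PolyFun.pair (poly_setW hx (.list_ofFn fun k => .list_ofFn fun l =>
      poly_axpy (Read.poly_p hx) (Read.poly_d hx k) (((Read.poly_p hx).sub (.const 1)).mul
        (Read.poly_rate hx)) (Read.poly_W hx k l) (Read.poly_G hx k l))) (.constNum 0)
  | call q =>
    unfold stepV
    by_cases h : q.fst = q.snd
    · simp only [h, if_true]
      exact hx.pair (.constNum 0)
    · simp only [h, if_false]
      exact PolyKernel.bindPure (g := fun x v =>
        Val.pair (afterV q x (v.nth 1) (v.nth 2)) (v.nth 0))
        ((poly_idealSampleV (hS _)).comp (poly_callInput q))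
        ((poly_afterV q).pair (hx.snd.nthConst 0))

/-- Each program on trees commutes with the encoding. Together with `poly_stepV` this makes every
ideal step a polynomial-time kernel, so that it can be absorbed into a distinguisher or used in the
simulator. -/
theorem stepV_enc (S : Fin 2 → Prog) (i₀ : Fin n) (st : Step n) (c : Core n) :
    stepV S i₀ st (encCore i₀ c) =
      (st.exec (idealSample S) i₀ c).map fun r => Val.pair (encCore i₀ r.1) r.2 := by
  cases st with
  | distW i =>
    simp only [stepV, Step.exec, Read.p_enc, Read.d_enc, Read.w₀_enc]
    rw [shareV_eq, PMF.map_comp, PMF.map_comp]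
    congr 1; funext s
    simp only [Function.comp_apply, shareEntry, Val.nth_list_ofFn]
    congr 1
    have : encCore i₀ { c with W := Function.update c.W i s } =
      setW (encCore i₀ c) (encShares (Function.update c.W i s)) := rfl
    rw [this, encShares]
    congr 3; funext k
    by_cases hk : k = i
    · subst hk; simp
    · have h2 : ((encCore i₀ c).nth 2).nth k = Val.list (List.ofFn fun j => encVec (c.W k j)) :=
        Val.nth_list_ofFn _ k
      simp [hk, h2]
  | distY =>
    have : Read.owner (encCore i₀ c) = fun k => if k = c.a.owner then 1 else 0 := by
      funext k; simp
    simp only [stepV, Step.exec, Read.p_enc, Read.b_enc, this, Read.yB_enc]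
    rw [shareV_eq, PMF.map_comp, PMF.map_comp]
    congr 1; funext s
    simp only [Function.comp_apply, shareEntry, Val.nth_list_ofFn]
    by_cases h : i₀ = c.a.owner
    · simp only [h, if_true, one_ne_zero, if_false]; rfl
    · simp only [h, if_true, if_false]; rfl
  | localP i =>
    simp only [stepV, Step.exec, Read.p_enc, Read.b_enc, Read.d_enc, Read.z_enc, Read.XB_enc,
      Read.W_enc, PMF.pure_map, mulVecV_enc, axpy_encVec]
    have : encCore i₀ { c with z := Function.update c.z i (c.z i + c.XB i *ᵥ c.W i i) } =
      setZ (encCore i₀ c) (encFam (Function.update c.z i (c.z i + c.XB i *ᵥ c.W i i))) := rfl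
    rw [this, encFam]
    congr 5; funext k
    by_cases hk : k = i
    · subst hk; simp
    · simp [hk]
  | err =>
    simp only [stepV, Step.exec, Read.p_enc, Read.b_enc, Read.z_enc, Read.y_enc, PMF.pure_map,
      axpy_encVec]
    have : encCore i₀ { c with z := fun j => c.z j - c.y j } =
      setZ (encCore i₀ c) (encFam fun j => c.z j - c.y j) := rfl
    rw [this, encFam]
    simp only [natCast_pred, neg_smul, one_smul, sub_eq_add_neg]
  | localG i =>
    simp only [stepV, Step.exec, Read.p_enc, Read.b_enc, Read.d_enc, Read.z_enc, Read.XB_enc,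
      Read.G_enc, PMF.pure_map, vecMulV_enc, axpy_encVec]
    have : encCore i₀ { c with G := c.G + Pi.single i (Pi.single i (c.z i ᵥ* c.XB i)) } =
      setG (encCore i₀ c) (encShares (c.G + Pi.single i (Pi.single i (c.z i ᵥ* c.XB i)))) := rfl
    rw [this, encShares]
    congr 5; funext k
    congr 2; funext l
    by_cases hk : k = i
    · subst hk
      by_cases hl : l = k
      · subst hl; simp
      · simp [hl]
    · simp [hk]
  | upd =>
    simp only [stepV, Step.exec, Read.p_enc, Read.d_enc, Read.W_enc, Read.G_enc, Read.rate_enc,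
      PMF.pure_map, axpy_encVec]
    have : encCore i₀ { c with W := fun i j => c.W i j - c.a.rate • c.G i j } =
      setW (encCore i₀ c) (encShares fun i j => c.W i j - c.a.rate • c.G i j) := rfl
    rw [this, encShares]
    simp only [Nat.cast_mul, natCast_pred, ZMod.natCast_val, ZMod.cast_id', id, neg_mul, one_mul,
      neg_smul, sub_eq_add_neg]
  | call q =>
    unfold stepV Step.exec
    by_cases h : q.fst = q.snd
    · simp only [h, if_true, PMF.pure_map]
    · simp only [h, if_false, callInput_enc, idealSampleV_eq, PMF.map_comp, afterV_enc]
      rfl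

end Regression

/-! ### Symmetry, transitivity and averaging for indistinguishability. -/

theorem UnifIndist.symm {ι : Type} {κ size : ι → ℕ} {X Y : ι → PMF Val}
    (h : UnifIndist κ size X Y) : UnifIndist κ size Y X := fun D hD Q P => by
  obtain ⟨μ, hμ, h0, hle⟩ := h D hD Q P
  exact ⟨μ, hμ, h0, fun a z ha hz => by rw [abs_sub_comm]; exact hle a z ha hz⟩

theorem UnifIndist.trans {ι : Type} {κ size : ι → ℕ} {X Y Z : ι → PMF Val}
    (h : UnifIndist κ size X Y) (h' : UnifIndist κ size Y Z) : UnifIndist κ size X Z :=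
  fun D hD Q P => by
    obtain ⟨μ, hμ, h0, hle⟩ := h D hD Q P
    obtain ⟨ν, hν, h0', hle'⟩ := h' D hD Q P
    refine ⟨fun k => μ k + ν k, hμ.add hν, fun k => add_nonneg (h0 k) (h0' k), fun a z ha hz => ?_⟩
    exact (abs_sub_le _ _ _).trans (add_le_add (hle a z ha hz) (hle' a z ha hz))

/-- The index may itself be random, for instance the state reached after some steps, since the bound
depends on it only through `κ`. The distribution `A` need not be samplable; only the sizes in its
support matter. -/
theorem UnifIndist.average {ι ι' : Type} {κ size : ι → ℕ} {X Y : ι → PMF Val}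
    (h : UnifIndist κ size X Y) {κ' size' : ι' → ℕ} (A : ι' → PMF ι)
    (hκ : ∀ a, ∀ s ∈ (A a).support, κ s = κ' a)
    (R : Polynomial ℕ) (hsize : ∀ a, ∀ s ∈ (A a).support, size s ≤ R.eval (κ' a + size' a)) :
    UnifIndist κ' size' (fun a => (A a).bind X) (fun a => (A a).bind Y) := by
  intro D hD Q P
  obtain ⟨μ, hμ, h0, hle⟩ := h D hD Q (R.comp (Polynomial.X + P))
  refine ⟨μ, hμ, h0, fun a z ha hz => abs_acceptProb_bind_le _ _ _ _ _ (h0 _) fun s hs => ?_⟩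
  rw [← hκ a s hs] at hz ⊢
  refine hle s z ((hsize a s hs).trans ?_) hz
  rw [Polynomial.eval_comp]
  refine R.eval_nat_mono ?_
  simp only [Polynomial.eval_add, Polynomial.eval_X, hκ a s hs]
  omega

theorem Val.size_mem_le {l : List Val} {v : Val} (h : v ∈ l) : v.size ≤ (Val.list l).size := by
  induction l with
  | nil => simp at h
  | cons a l ih =>
    simp only [List.mem_cons] at h
    simp only [list, size]
    rcases h with rfl | h
    · omega
    · have := ih h; omega

namespace Regression

variable {n : ℕ}

/-! ### Sizes -/

theorem size_encVec_le {p d : ℕ} [NeZero p] (v : Fin d → ZMod p) :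
    (encVec v).size ≤ d * (p.size + 2) + 1 := by
  -- An encoded vector is the reduced table of its own entries, so the bound for tables applies.
  rw [← tabMod_eq_encVec (fun k => (encVec v).entry k) v fun i => by simp]
  exact size_tabMod_le _ _ _

/-- Bounds for encodings of vectors, matrices, families and batches whose dimensions are at most
the argument. -/
def vecBound : Polynomial ℕ := Polynomial.X * (Polynomial.X + 2) + 1
def matBound : Polynomial ℕ := Polynomial.X * (vecBound + 1) + 1
def sharesBound (n : ℕ) : Polynomial ℕ := n * (n * (vecBound + 1) + 1 + 1) + 1
def batchBound (n : ℕ) : Polynomial ℕ := n * (matBound + 1) + 1 + vecBound + 1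

theorem size_encVec_le_vecBound {p d E : ℕ} [NeZero p] (v : Fin d → ZMod p) (hp : p.size ≤ E)
    (hd : d ≤ E) : (encVec v).size ≤ vecBound.eval E := by
  refine (size_encVec_le v).trans ?_
  simp only [vecBound, Polynomial.eval_add, Polynomial.eval_mul, Polynomial.eval_X,
    Polynomial.eval_one, Polynomial.eval_ofNat]
  gcongr

theorem size_encMat_le {p r c E : ℕ} [NeZero p] (A : Matrix (Fin r) (Fin c) (ZMod p))
    (hp : p.size ≤ E) (hr : r ≤ E) (hc : c ≤ E) : (encMat A).size ≤ matBound.eval E := by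
  refine (Val.size_list_le (c := vecBound.eval E) fun v hv => ?_).trans ?_
  · obtain ⟨i, rfl⟩ := List.mem_ofFn.1 hv
    exact size_encVec_le_vecBound _ hp hc
  · simp only [matBound, Polynomial.eval_add, Polynomial.eval_mul, Polynomial.eval_X,
      Polynomial.eval_one, List.length_ofFn]
    gcongr

theorem size_encFam_le {p E : ℕ} [NeZero p] {D : Fin n → ℕ} (v : ∀ i, Fin (D i) → ZMod p)
    (hp : p.size ≤ E) (hD : ∀ i, D i ≤ E) :
    (encFam v).size ≤ n * (vecBound.eval E + 1) + 1 := by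
  refine (Val.size_list_le (c := vecBound.eval E) fun v hv => ?_).trans ?_
  · obtain ⟨i, rfl⟩ := List.mem_ofFn.1 hv
    exact size_encVec_le_vecBound _ hp (hD i)
  · simp

theorem size_encShares_le {p E : ℕ} [NeZero p] {D : Fin n → ℕ} (W : ∀ i, Fin n → Fin (D i) → ZMod p)
    (hp : p.size ≤ E) (hD : ∀ i, D i ≤ E) : (encShares W).size ≤ (sharesBound n).eval E := by
  refine (Val.size_list_le (c := n * (vecBound.eval E + 1) + 1) fun v hv => ?_).trans ?_
  · obtain ⟨i, rfl⟩ := List.mem_ofFn.1 hv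
    exact size_encFam_le (D := fun _ => D i) (W i) hp fun _ => hD i
  · simp [sharesBound]

theorem size_encBatch_le {p b E : ℕ} [NeZero p] {D : Fin n → ℕ}
    (X : ∀ i, Matrix (Fin b) (Fin (D i)) (ZMod p)) (y : Fin b → ZMod p)
    (hp : p.size ≤ E) (hb : b ≤ E) (hD : ∀ i, D i ≤ E) :
    (encBatch X y).size ≤ (batchBound n).eval E := by
  have h1 := Val.size_list_le (l := List.ofFn fun i => encMat (X i)) (c := matBound.eval E)
    fun v hv => by
      obtain ⟨i, rfl⟩ := List.mem_ofFn.1 hv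
      exact size_encMat_le _ hp hb (hD i)
  have h2 := size_encVec_le_vecBound y hp hb
  rw [List.length_ofFn] at h1
  simp only [encBatch, Val.size, batchBound, Polynomial.eval_add, Polynomial.eval_mul,
    Polynomial.eval_natCast, Polynomial.eval_one, Nat.cast_id] at *
  omega

theorem le_size_unary (k : ℕ) : k ≤ (Val.unary k).size := by rw [Val.size_unary]; omega

/-- The size of the fixed data. -/
def envSize (i₀ : Fin n) (c : Core n) : ℕ := (encEnv i₀ c.κ c.a).size

section

variable (i₀ : Fin n) (κ : ℕ) (a : Regression n)

theorem p_le_encEnv : a.p.size ≤ (encEnv i₀ κ a).size :=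
  (Nat.le_succ _).trans (Val.size_nth_le (encEnv i₀ κ a) 2)

theorem d_le_encEnv (i : Fin n) : a.d i ≤ (encEnv i₀ κ a).size := by
  have h : ((encEnv i₀ κ a).nth 3).nth i = Val.unary (a.d i) := Val.nth_list_ofFn _ i
  have h1 := Val.size_nth_le ((encEnv i₀ κ a).nth 3) i
  rw [h] at h1
  exact (le_size_unary _).trans (h1.trans (Val.size_nth_le _ 3))

theorem b_le_encEnv : a.b ≤ (encEnv i₀ κ a).size :=
  (le_size_unary _).trans (Val.size_nth_le (encEnv i₀ κ a) 4)

theorem T_le_encEnv : a.T ≤ (encEnv i₀ κ a).size := by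
  have h : ((encEnv i₀ κ a).nth 8).length = a.T := by
    change (Val.list _).length = _
    simp
  exact h ▸ (Val.length_le_size _).trans (Val.size_nth_le _ 8)

end

def coreBound (n : ℕ) : Polynomial ℕ :=
  Polynomial.X + batchBound n + 2 * sharesBound n + 2 * ((n : Polynomial ℕ) * (vecBound + 1) + 1) + 7

/-- All variables are arrays of residues modulo `p` whose dimensions can be read off from the
environment. Hence states on the encoding side cannot grow, however many steps have been made. -/
theorem size_encCore_le (i₀ : Fin n) (c : Core n) :
    (encCore i₀ c).size ≤ (coreBound n).eval (envSize i₀ c) := by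
  have hp := p_le_encEnv i₀ c.κ c.a
  have hb := b_le_encEnv i₀ c.κ c.a
  have hd := d_le_encEnv i₀ c.κ c.a
  have h1 := size_encBatch_le c.XB c.yB hp hb hd
  have h2 := size_encShares_le c.W hp hd
  have h3 := size_encShares_le c.G hp hd
  have h4 := size_encFam_le (D := fun _ => c.a.b) c.y hp fun _ => hb
  have h5 := size_encFam_le (D := fun _ => c.a.b) c.z hp fun _ => hb
  simp only [encCore, Val.list, Val.size, coreBound, Polynomial.eval_add, Polynomial.eval_mul,
    Polynomial.eval_natCast, Polynomial.eval_one, Polynomial.eval_X, Polynomial.eval_ofNat,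
    envSize, Nat.size_zero, Nat.cast_id] at *
  omega

theorem envSize_le_encCore (i₀ : Fin n) (c : Core n) : envSize i₀ c ≤ (encCore i₀ c).size :=
  Val.size_nth_le (encCore i₀ c) 0

theorem envSize_le_encSt (i₀ : Fin n) (s : St n) : envSize i₀ s.1 ≤ (encSt i₀ s).size :=
  (envSize_le_encCore i₀ s.1).trans (Val.size_fst_le (encSt i₀ s))

theorem size_encSt_le (i₀ : Fin n) (s : St n) :
    (encSt i₀ s).size ≤ (coreBound n).eval (envSize i₀ s.1) + (Val.list s.2).size + 1 := by
  have := size_encCore_le i₀ s.1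
  simp only [encSt, Val.size]
  omega

theorem size_log_le_encSt (i₀ : Fin n) (s : St n) : (Val.list s.2).size ≤ (encSt i₀ s).size :=
  Val.size_snd_le (encSt i₀ s)

/-! ### Steps with logs on encodings -/

/-- The log is passed along and extended, never read; this is why it grows additively. -/
def stepLogV (S : Fin 2 → Prog) (i₀ : Fin n) (st : Step n) (x : Val) : PMF Val :=
  (stepV S i₀ st x.fst).map fun r =>
    Val.pair r.fst (if st.logs i₀ then Val.pair r.snd x.snd else x.snd)

def stepsV (S : Fin 2 → Prog) (i₀ : Fin n) : List (Step n) → Val → PMF Val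
  | [], x => PMF.pure x
  | st :: l, x => (stepLogV S i₀ st x).bind (stepsV S i₀ l)

/-- A sequence of steps. -/
def execSteps (smp : Fin 2 → ℕ → MatMulInstance → PMF Val) (i₀ : Fin n) :
    List (Step n) → St n → PMF (St n)
  | [], s => PMF.pure s
  | st :: l, s => (st.execLog smp i₀ s).bind (execSteps smp i₀ l)

theorem execSteps_append (smp : Fin 2 → ℕ → MatMulInstance → PMF Val) (i₀ : Fin n)
    (l l' : List (Step n)) (s : St n) :
    execSteps smp i₀ (l ++ l') s = (execSteps smp i₀ l s).bind (execSteps smp i₀ l') := by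
  induction l generalizing s with
  | nil => simp [execSteps]
  | cons st l ih => simp [execSteps, PMF.bind_bind, funext ih]

theorem stepLogV_enc (S : Fin 2 → Prog) (i₀ : Fin n) (st : Step n) (s : St n) :
    stepLogV S i₀ st (encSt i₀ s) = (st.execLog (idealSample S) i₀ s).map (encSt i₀) := by
  simp only [stepLogV, encSt, Val.fst_pair, Val.snd_pair, stepV_enc, PMF.map_comp, Step.execLog]
  congr 1; funext r
  simp only [Function.comp_apply, Val.fst_pair, Val.snd_pair, encSt]
  split <;> rfl

theorem stepsV_enc (S : Fin 2 → Prog) (i₀ : Fin n) (l : List (Step n)) (s : St n) :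
    stepsV S i₀ l (encSt i₀ s) = (execSteps (idealSample S) i₀ l s).map (encSt i₀) := by
  induction l generalizing s with
  | nil => simp [stepsV, execSteps, PMF.pure_map]
  | cons st l ih =>
    rw [stepsV, stepLogV_enc, PMF.bind_map, execSteps, PMF.map_bind]
    congr 1; funext s'
    exact ih s'

variable {S : Fin 2 → Prog} (hS : ∀ i, (S i).PolyTime) (i₀ : Fin n)
include hS

theorem poly_stepLogV (st : Step n) : PolyKernel (stepLogV S i₀ st) :=
  PolyKernel.bindPure (g := fun x r =>
    Val.pair r.fst (if st.logs i₀ then Val.pair r.snd x.snd else x.snd))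
    ((poly_stepV hS i₀ st).comp PolyFun.id.fst)
    (PolyFun.id.snd.fst.pair (.ite_prop (PolyFun.id.snd.snd.pair PolyFun.id.fst.snd)
      PolyFun.id.fst.snd))

theorem poly_stepsV (l : List (Step n)) : PolyKernel (stepsV S i₀ l) := by
  induction l with
  | nil => exact PolyFun.id
  | cons st l ih => exact ih.bind (poly_stepLogV hS i₀ st)

/-- The log grows by an amount that does not depend on its size. -/
theorem stepsV_growth (l : List (Step n)) : ∃ Q : Polynomial ℕ, ∀ x₁ x₂,
    ∀ y ∈ (stepsV S i₀ l (Val.pair x₁ x₂)).support, ∃ y₁ y₂, y = Val.pair y₁ y₂ ∧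
      y₁.size ≤ Q.eval x₁.size ∧ y₂.size ≤ x₂.size + Q.eval x₁.size := by
  induction l with
  | nil =>
    refine ⟨Polynomial.X, fun x₁ x₂ y hy => ?_⟩
    rw [stepsV, PMF.mem_support_pure_iff] at hy
    exact ⟨x₁, x₂, hy, by simp, by simp⟩
  | cons st l ih =>
    obtain ⟨Q, hQ⟩ := ih
    obtain ⟨P, hP⟩ := (poly_stepV hS i₀ st).size_le
    refine ⟨Q.comp P + P + 1, fun x₁ x₂ y hy => ?_⟩
    rw [stepsV, PMF.mem_support_bind_iff] at hy
    obtain ⟨w, hw, hy⟩ := hy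
    rw [stepLogV, PMF.mem_support_map_iff] at hw
    obtain ⟨r, hr, rfl⟩ := hw
    have h1 := hP _ _ hr
    obtain ⟨y₁, y₂, rfl, h2, h3⟩ := hQ _ _ y hy
    have h4 := (r.size_fst_le).trans h1
    have h5 := (r.size_snd_le).trans h1
    have h6 := Q.eval_nat_mono h4
    refine ⟨y₁, y₂, rfl, ?_, ?_⟩
    · simp only [Polynomial.eval_add, Polynomial.eval_comp, Val.fst_pair] at *
      omega
    · simp only [Polynomial.eval_add, Polynomial.eval_comp, Val.fst_pair, Val.snd_pair,
        Polynomial.eval_one] at *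
      have : r.fst.size + r.snd.size ≤ r.size + 1 := by
        cases r <;> simp [Val.size, Val.fst, Val.snd]; omega
      split at h3 <;> (try simp only [Val.size] at h3) <;> omega

omit hS

/-! ### The real execution -/

theorem exec_preserves {smp : Fin 2 → ℕ → MatMulInstance → PMF Val} {st : Step n} {c : Core n}
    {r : Core n × Val} (h : r ∈ (st.exec smp i₀ c).support) : r.1.κ = c.κ ∧ r.1.a = c.a := by
  cases st with
  | call q =>
    unfold Step.exec at h
    dsimp only at h
    split at h
    · rw [PMF.mem_support_pure_iff] at h
      subst h
      exact ⟨rfl, rfl⟩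
    · rw [PMF.mem_support_map_iff] at h
      obtain ⟨v, -, rfl⟩ := h
      cases q <;> exact ⟨rfl, rfl⟩
  | distW i =>
    obtain ⟨v, -, rfl⟩ := (PMF.mem_support_map_iff ..).1 h
    exact ⟨rfl, rfl⟩
  | distY =>
    obtain ⟨v, -, rfl⟩ := (PMF.mem_support_map_iff ..).1 h
    exact ⟨rfl, rfl⟩
  | _ =>
    obtain rfl := (PMF.mem_support_pure_iff ..).1 h
    exact ⟨rfl, rfl⟩

theorem exec_congr_smp {st : Step n} (h : ∀ q, st ≠ .call q)
    (smp smp' : Fin 2 → ℕ → MatMulInstance → PMF Val) (c : Core n) :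
    st.exec smp i₀ c = st.exec smp' i₀ c := by
  cases st with
  | call q => exact absurd rfl (h q)
  | _ => rfl

theorem size_view_le {π : TwoPartyProtocol} (hpoly : π.IsPolyTime) :
    ∃ P : Polynomial ℕ, ∀ κ m side, ∀ v ∈ (realSample π side κ m).support,
      (v.nth 0).size ≤ P.eval (κ + m.common.size + (m.input 0).size + (m.input 1).size) := by
  obtain ⟨P, hP⟩ := hpoly.views_poly
  refine ⟨P, fun κ m side v hv => ?_⟩
  obtain ⟨o, ho, rfl⟩ := (PMF.mem_support_map_iff ..).1 hv
  have h1 := hP _ _ _ _ o ho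
  have h2 : ∀ a b c : Val, (Val.list [a, b, c]).nth 0 = a := fun _ _ _ => rfl
  rw [h2]
  split <;> omega

include hS in
-- A step other than a multiplication does not depend on `smp`, so the size bound of the program for
-- the ideal step applies to it. For a multiplication the new entry is a view of `π`, bounded by the
-- assumption on its views.
theorem size_entry_le {π : TwoPartyProtocol} (hpoly : π.IsPolyTime) (st : Step n) :
    ∃ Q : Polynomial ℕ, ∀ c, ∀ r ∈ (st.exec (realSample π) i₀ c).support,
      r.2.size ≤ Q.eval (envSize i₀ c) := by
  obtain ⟨P, hP⟩ := (poly_stepV hS i₀ st).size_le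
  by_cases h : ∀ q, st ≠ .call q
  · refine ⟨P.comp (coreBound n), fun c r hr => ?_⟩
    rw [exec_congr_smp i₀ h _ (idealSample S)] at hr
    have h1 := hP (encCore i₀ c) (Val.pair (encCore i₀ r.1) r.2) (by
      rw [stepV_enc, PMF.mem_support_map_iff]
      exact ⟨r, hr, rfl⟩)
    have h2 := P.eval_nat_mono (size_encCore_le i₀ c)
    have h3 := Val.size_snd_le (Val.pair (encCore i₀ r.1) r.2)
    rw [Polynomial.eval_comp]
    simp only [Val.snd_pair] at h3
    omega
  · push Not at h
    obtain ⟨q, rfl⟩ := h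
    obtain ⟨V, hV⟩ := size_view_le hpoly
    obtain ⟨I, hI⟩ := (poly_callInput q).size_le
    refine ⟨V.comp (4 * I.comp (coreBound n)) + 1, fun c r hr => ?_⟩
    unfold Step.exec at hr
    dsimp only at hr
    split at hr
    · rw [PMF.mem_support_pure_iff] at hr
      subst hr
      simp [Val.size]
    · obtain ⟨v, hv, rfl⟩ := (PMF.mem_support_map_iff ..).1 hr
      rw [Polynomial.eval_add]
      refine (hV _ _ _ v hv).trans (le_trans ?_ (Nat.le_add_right _ _))
      simp only [Polynomial.eval_comp, Polynomial.eval_mul, Polynomial.eval_ofNat]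
      refine V.eval_nat_mono ?_
      have h1 := (hI (encCore i₀ c)).trans (I.eval_nat_mono (size_encCore_le i₀ c))
      rw [callInput_enc] at h1
      have h2 := le_size_unary c.κ
      simp only [Val.list, Val.size] at h1
      omega

include hS in
-- The increase of the log depends on the environment alone, which is constant, so over many
-- iterations the increases add up instead of compounding.
theorem execSteps_growth {π : TwoPartyProtocol} (hpoly : π.IsPolyTime) (l : List (Step n)) :
    ∃ Q : Polynomial ℕ, ∀ s, ∀ s' ∈ (execSteps (realSample π) i₀ l s).support,
      s'.1.κ = s.1.κ ∧ s'.1.a = s.1.a ∧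
      (Val.list s'.2).size ≤ (Val.list s.2).size + Q.eval (envSize i₀ s.1) := by
  induction l with
  | nil =>
    refine ⟨0, fun s s' h => ?_⟩
    rw [execSteps, PMF.mem_support_pure_iff] at h
    subst h
    simp
  | cons st l ih =>
    obtain ⟨Q, hQ⟩ := ih
    obtain ⟨P, hP⟩ := size_entry_le hS i₀ hpoly st
    refine ⟨Q + P + 1, fun s s' h => ?_⟩
    rw [execSteps, PMF.mem_support_bind_iff] at h
    obtain ⟨w, hw, h⟩ := h
    obtain ⟨r, hr, rfl⟩ := (PMF.mem_support_map_iff ..).1 hw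
    obtain ⟨h1, h2, h3⟩ := hQ _ _ h
    obtain ⟨h4, h5⟩ := exec_preserves i₀ hr
    have h6 := hP _ _ hr
    have h7 : envSize i₀ r.1 = envSize i₀ s.1 := by rw [envSize, h4, h5, envSize]
    refine ⟨h1.trans h4, h2.trans h5, ?_⟩
    rw [h7] at h3
    simp only [Polynomial.eval_add, Polynomial.eval_one]
    split at h3 <;> (try simp only [Val.list, Val.size] at h3) <;> omega

end Regression

namespace Regression

variable {n : ℕ}

/-! ### Replacing the multiplications by the ideal functionality -/

section Steps

variable {S : Fin 2 → Prog} (hS : ∀ i, (S i).PolyTime) (i₀ : Fin n) {π : TwoPartyProtocol}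
  (hsec : ∀ i, CompIndist MatMulInstance.size (idealSample S i) (realSample π i))
include hsec

/-- Steps other than multiplications between two different parties are the same on both sides. For
such a multiplication, the new state is a polynomial-time function of the view, the two outputs and
the old state. The old state enters as advice, so security of `π` on the instance `q.inst s.1` gives
the claim. -/
theorem step_indist (st : Step n) : UnifIndist (fun s : St n => s.1.κ) (fun s => (encSt i₀ s).size)
    (fun s => (st.execLog (realSample π) i₀ s).map (encSt i₀))
    (fun s => stepLogV S i₀ st (encSt i₀ s)) := by
  by_cases h : ∀ q, st ≠ .call q
  · refine .of_eq fun s => ?_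
    rw [stepLogV_enc, Step.execLog, Step.execLog, exec_congr_smp i₀ h]
  · push Not at h
    obtain ⟨q, rfl⟩ := h
    by_cases hq : q.fst = q.snd
    · refine .of_eq fun s => ?_
      rw [stepLogV_enc]
      simp only [Step.execLog, Step.exec, hq, if_true]
    · have hx : PolyFun fun x => x := PolyFun.id
      let k : Val → Val → Val := fun e v =>
        Val.pair (afterV q e.fst (v.nth 1) (v.nth 2))
          (if (Step.call q).logs i₀ then Val.pair (v.nth 0) e.snd else e.snd)
      have hk : PolyFun fun y => k y.fst y.snd :=
        ((poly_afterV q).comp (hx.fst.fst.pair hx.snd)).pair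
          (.ite_prop ((hx.snd.nthConst 0).pair hx.fst.snd) hx.fst.snd)
      obtain ⟨I, hI⟩ := (poly_callInput q).size_le
      have h1 := (hsec (q.side i₀)).unifIndist.symm.post (κ' := fun s : St n => s.1.κ)
        (size' := fun s => (encSt i₀ s).size) (fun s => (s.1.κ, q.inst s.1)) (fun _ => rfl)
        (I + Polynomial.X) (fun s => by
          have h1 := (hI (encCore i₀ s.1)).trans (I.eval_nat_mono (Val.size_fst_le (encSt i₀ s)))
          rw [callInput_enc] at h1
          simp only [Val.list, Val.size, MatMulInstance.size, Polynomial.eval_add,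
            Polynomial.eval_X] at *
          omega)
        (k := fun e v => PMF.pure (k e v)) hk (encSt i₀)
        (fun s => by simp only [Polynomial.eval_add, Polynomial.eval_X]; omega)
      have e : ∀ smp : Fin 2 → ℕ → MatMulInstance → PMF Val, ∀ s : St n,
          ((Step.call q).execLog smp i₀ s).map (encSt i₀) =
            (smp (q.side i₀) s.1.κ (q.inst s.1)).bind fun v => PMF.pure (k (encSt i₀ s) v) := by
        intro smp s
        simp only [Step.execLog, Step.exec, hq, if_false, PMF.map_comp]
        change _ = PMF.map _ _
        congr 1; funext v
        simp only [Function.comp_apply, k, encSt, Val.fst_pair, Val.snd_pair, afterV_enc]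
        split <;> rfl
      simp only [stepLogV_enc, e]
      exact h1

include hS in
-- A hybrid argument over a list of fixed length. After a real first step the tail is exchanged by
-- averaging over the state reached; then the first step is exchanged, with the ideal tail, which is
-- polynomial-time, as post-processing.
theorem steps_indist (hpoly : π.IsPolyTime) (l : List (Step n)) :
    UnifIndist (fun s : St n => s.1.κ) (fun s => (encSt i₀ s).size)
      (fun s => (execSteps (realSample π) i₀ l s).map (encSt i₀))
      (fun s => stepsV S i₀ l (encSt i₀ s)) := by
  induction l with
  | nil => exact .of_eq fun s => by rw [stepsV, execSteps, PMF.pure_map]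
  | cons st l ih =>
    have h1 := (step_indist i₀ hsec st).post (κ' := fun s : St n => s.1.κ)
      (size' := fun s => (encSt i₀ s).size) (fun s => s) (fun _ => rfl) (Polynomial.X + 1)
      (fun s => by simp) (k := fun _ => stepsV S i₀ l) ((poly_stepsV hS i₀ l).comp PolyFun.id.snd)
      (fun _ => Val.num 0) (fun s => by simp [Val.size])
    -- The state after one real step is the index for the tail, so its size has to be polynomial.
    obtain ⟨Q, hQ⟩ := execSteps_growth hS i₀ hpoly [st]
    simp only [execSteps, PMF.bind_pure] at hQ
    have h2 := ih.average (κ' := fun s : St n => s.1.κ) (size' := fun s => (encSt i₀ s).size)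
      (fun s => st.execLog (realSample π) i₀ s) (fun s s' hs => (hQ s s' hs).1)
      (coreBound n + Polynomial.X + Q + 1) (fun s s' hs => by
        obtain ⟨h1, h2, h3⟩ := hQ s s' hs
        have h4 : envSize i₀ s'.1 = envSize i₀ s.1 := by rw [envSize, h1, h2, envSize]
        have h5 := size_encSt_le i₀ s'
        rw [h4] at h5
        have h6 : envSize i₀ s.1 ≤ s.1.κ + (encSt i₀ s).size :=
          (envSize_le_encSt i₀ s).trans (Nat.le_add_left _ _)
        have h7 := (coreBound n).eval_nat_mono h6
        have h8 := Q.eval_nat_mono h6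
        have h9 := size_log_le_encSt i₀ s
        simp only [Polynomial.eval_add, Polynomial.eval_X, Polynomial.eval_one]
        omega)
    refine .trans (.trans (.of_eq fun s => ?_) h2) (.trans (.of_eq fun s => ?_) h1)
    · rw [execSteps, PMF.map_bind]
    · rw [PMF.bind_map]; rfl

end Steps

/-! ### The training loop -/

def predSteps (n : ℕ) : List (Step n) := (List.finRange n).flatMap fun i =>
  .localP i :: (List.finRange n).map fun j => .call (.pred i j)

def gradSteps (n : ℕ) : List (Step n) := (List.finRange n).flatMap fun i =>
  .localG i :: (List.finRange n).map fun j => .call (.grad i j)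

/-- The steps of an iteration. -/
def iterSteps (n : ℕ) : List (Step n) :=
  .distY :: (predSteps n ++ .err :: (gradSteps n ++ [.upd]))

def Core.load (c : Core n) (t : Fin c.a.T) : Core n :=
  { c with XB := fun i => c.a.XB i t, yB := c.a.yB t, y := 0, z := 0, G := 0 }

/-- Load the batch with `k` batches after it. -/
def St.load (k : ℕ) (s : St n) : St n :=
  if h : k < s.1.a.T then (s.1.load (Fin.rev ⟨k, h⟩), s.2) else s

/-- The last `k` iterations. -/
def execLoop (smp : Fin 2 → ℕ → MatMulInstance → PMF Val) (i₀ : Fin n) : ℕ → St n → PMF (St n)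
  | 0, s => PMF.pure s
  | k + 1, s => (execSteps smp i₀ (iterSteps n) (s.load k)).bind (execLoop smp i₀ k)

/-- The identity on encoded shares, but bounded in terms of `env` for every tree `v`. Applied at the
start of each iteration, it keeps the loop polynomial on malformed inputs, where the size bounds of
`T` successive iterations would otherwise be nested. -/
def normShares (n : ℕ) (env v : Val) : Val :=
  Val.list (List.ofFn fun i : Fin n => Val.list (List.ofFn fun j : Fin n =>
    tabMod (env.entry 2) ((env.nth 3).nth i).length fun r => ((v.nth i).nth j).entry r))

def normFam (n : ℕ) (env v : Val) : Val :=
  Val.list (List.ofFn fun i : Fin n =>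
    tabMod (env.entry 2) (env.nth 4).length fun r => (v.nth i).entry r)

theorem normShares_enc (i₀ : Fin n) (κ : ℕ) (a : Regression n) (v : Val) (W : a.Shares)
    (h : ∀ (i j : Fin n) (r : Fin (a.d i)), (((v.nth i).nth j).entry r : ZMod a.p) = W i j r) :
    normShares n (encEnv i₀ κ a) v = encShares W := by
  have hd : ∀ i : Fin n, (((encEnv i₀ κ a).nth 3).nth i).length = a.d i := fun i => by
    have h : ((encEnv i₀ κ a).nth 3).nth i = Val.unary (a.d i) := Val.nth_list_ofFn _ i
    rw [h, Val.length_unary]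
  rw [normShares, encShares]
  congr 2; funext i
  congr 2; funext j
  rw [hd]
  exact tabMod_eq_encVec (p := a.p) _ _ fun r => h i j r

theorem normFam_enc_zero (i₀ : Fin n) (κ : ℕ) (a : Regression n) :
    normFam n (encEnv i₀ κ a) (Val.num 0) = encFam (0 : Fin n → Fin a.b → ZMod a.p) := by
  have hb : ((encEnv i₀ κ a).nth 4).length = a.b := Val.length_unary _
  rw [normFam, encFam]
  congr 2; funext i
  rw [hb]
  exact tabMod_eq_encVec (p := a.p) _ _ fun r => by simp [nth_num_zero, Val.entry]

theorem size_normShares_le (n : ℕ) (env v : Val) :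
    (normShares n env v).size ≤ (sharesBound n).eval env.size := by
  refine (Val.size_list_le (c := n * (vecBound.eval env.size + 1) + 1) fun u hu => ?_).trans ?_
  · obtain ⟨i, rfl⟩ := List.mem_ofFn.1 hu
    refine (Val.size_list_le (c := vecBound.eval env.size) fun u hu => ?_).trans (by simp)
    obtain ⟨j, rfl⟩ := List.mem_ofFn.1 hu
    refine (size_tabMod_le _ _ _).trans ?_
    have h1 : ((env.nth 3).nth i).length ≤ env.size :=
      (Val.length_le_size _).trans ((Val.size_nth_le _ _).trans (Val.size_nth_le _ _))
    have h2 : (env.entry 2).size ≤ env.size :=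
      (Nat.le_succ _).trans ((Val.size_toNat_le (env.nth 2)).trans (Val.size_nth_le _ _))
    simp only [vecBound, Polynomial.eval_add, Polynomial.eval_mul, Polynomial.eval_X,
      Polynomial.eval_one, Polynomial.eval_ofNat]
    gcongr
  · simp [sharesBound]

/-- Load a batch into an encoded state, and reduce the shares modulo `p`. -/
def loadV (n : ℕ) (env : Val) (k : ℕ) (x : Val) : Val :=
  Val.pair (Val.list [env, (env.nth 8).nth k, normShares n env (x.fst.nth 2),
    normFam n env (Val.num 0), normFam n env (Val.num 0), normShares n env (Val.num 0)]) x.snd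

theorem loadV_enc (i₀ : Fin n) (s : St n) {k : ℕ} (hk : k < s.1.a.T) :
    loadV n (encEnv i₀ s.1.κ s.1.a) k (encSt i₀ s) = encSt i₀ (s.load k) := by
  have h8 : ((encEnv i₀ s.1.κ s.1.a).nth 8).nth k =
      encBatch (fun i => s.1.a.XB i (Fin.rev ⟨k, hk⟩)) (s.1.a.yB (Fin.rev ⟨k, hk⟩)) :=
    Val.nth_list_ofFn _ (⟨k, hk⟩ : Fin s.1.a.T)
  have hW : normShares n (encEnv i₀ s.1.κ s.1.a) ((encSt i₀ s).fst.nth 2) = encShares s.1.W :=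
    normShares_enc _ _ _ _ _ fun i j r => by
      change (((((encShares s.1.W).nth i).nth j).entry r : ℕ) : ZMod s.1.a.p) = _
      simp [encShares]
  have hG : normShares n (encEnv i₀ s.1.κ s.1.a) (Val.num 0) = encShares (0 : s.1.a.Shares) :=
    normShares_enc _ _ _ _ _ fun i j r => by simp [nth_num_zero, Val.entry]
  rw [loadV, h8, hW, hG, normFam_enc_zero, St.load, dif_pos hk]
  rfl

/-- `execLoop` on encodings. -/
def loopV (S : Fin 2 → Prog) (i₀ : Fin n) (env : Val) (k : ℕ) (x : Val) : PMF Val :=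
  downM (fun k x => stepsV S i₀ (iterSteps n) (loadV n env k x)) k x

theorem load_preserves (k : ℕ) (s : St n) : (s.load k).1.κ = s.1.κ ∧ (s.load k).1.a = s.1.a ∧
    (s.load k).2 = s.2 := by
  unfold St.load
  split <;> exact ⟨rfl, rfl, rfl⟩

theorem execSteps_preserves {smp : Fin 2 → ℕ → MatMulInstance → PMF Val} {i₀ : Fin n}
    {l : List (Step n)} {s s' : St n} (h : s' ∈ (execSteps smp i₀ l s).support) :
    s'.1.κ = s.1.κ ∧ s'.1.a = s.1.a := by
  induction l generalizing s with
  | nil =>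
    rw [execSteps, PMF.mem_support_pure_iff] at h
    subst h
    exact ⟨rfl, rfl⟩
  | cons st l ih =>
    rw [execSteps, PMF.mem_support_bind_iff] at h
    obtain ⟨w, hw, h⟩ := h
    obtain ⟨r, hr, rfl⟩ := (PMF.mem_support_map_iff ..).1 hw
    obtain ⟨h1, h2⟩ := ih h
    obtain ⟨h3, h4⟩ := exec_preserves i₀ hr
    exact ⟨h1.trans h3, h2.trans h4⟩

/-- The environment is a separate argument of the program. It can be kept fixed since no step
changes `κ` or the instance. -/
theorem loopV_enc (S : Fin 2 → Prog) (i₀ : Fin n) {k : ℕ} (s : St n) (hk : k ≤ s.1.a.T) :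
    loopV S i₀ (encEnv i₀ s.1.κ s.1.a) k (encSt i₀ s) =
      (execLoop (idealSample S) i₀ k s).map (encSt i₀) := by
  induction k generalizing s with
  | zero => simp [loopV, downM, execLoop, PMF.pure_map]
  | succ k ih =>
    rw [loopV, downM, loadV_enc i₀ s hk, stepsV_enc, PMF.bind_map, execLoop, PMF.map_bind]
    refine PMF.bind_congr_support _ fun s' hs' => ?_
    obtain ⟨h1, h2⟩ := execSteps_preserves hs'
    obtain ⟨h3, h4, -⟩ := load_preserves k s
    have := ih s' (by rw [h2, h4]; omega)
    rw [h1, h2, h3, h4] at this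
    exact this

section Loop

variable {S : Fin 2 → Prog} (hS : ∀ i, (S i).PolyTime) (i₀ : Fin n)

theorem poly_normShares {f g : Val → Val} (hf : PolyFun f) (hg : PolyFun g) :
    PolyFun fun x => normShares n (f x) (g x) :=
  .list_ofFn fun i => .list_ofFn fun j => .tabMod (PolyNat.entryConst hf 2)
    (.length ((hf.nthConst 3).nthConst i))
    (PolyNat.entry (((hg.comp PolyFun.id.fst).nthConst i).nthConst j) (.length PolyFun.id.snd))

theorem poly_normFam {f g : Val → Val} (hf : PolyFun f) (hg : PolyFun g) :
    PolyFun fun x => normFam n (f x) (g x) :=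
  .list_ofFn fun i => .tabMod (PolyNat.entryConst hf 2) (.length (hf.nthConst 4))
    (PolyNat.entry ((hg.comp PolyFun.id.fst).nthConst i) (.length PolyFun.id.snd))

theorem poly_loadV {f g : Val → Val} {k : Val → ℕ} (hf : PolyFun f) (hk : PolyUnary k)
    (hg : PolyFun g) : PolyFun fun x => loadV n (f x) (k x) (g x) :=
  (PolyFun.list6 hf ((hf.nthConst 8).nth hk) (poly_normShares hf (hg.fst.nthConst 2))
    (poly_normFam hf (.constNum 0)) (poly_normFam hf (.constNum 0))
    (poly_normShares hf (.constNum 0))).pair hg.snd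

/-- The bound does not involve `x`: loading resets the size of everything except the log. -/
theorem size_loadV_le (n : ℕ) : ∃ P : Polynomial ℕ, ∀ env k x,
    (loadV n env k x).fst.size ≤ P.eval env.size := by
  obtain ⟨F, hF⟩ := (poly_normFam (n := n) PolyFun.id (.constNum 0)).size_le
  refine ⟨2 * Polynomial.X + 2 * sharesBound n + 2 * F + 7, fun env k x => ?_⟩
  have h1 := size_normShares_le n env (x.fst.nth 2)
  have h2 := size_normShares_le n env (Val.num 0)
  have h3 := hF env
  have h4 := (Val.size_nth_le (env.nth 8) k).trans (Val.size_nth_le env 8)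
  simp only [loadV, Val.fst_pair, Val.list, Val.size, Polynomial.eval_add, Polynomial.eval_mul,
    Polynomial.eval_X, Polynomial.eval_ofNat, Nat.size_zero]
  omega

include hS

/-- After each pass the first component is bounded in terms of the environment and the log has grown
by a bounded amount, so the growth per pass is additive, as `PolyKernel.downM` demands. -/
theorem poly_loopV : PolyKernel fun y => loopV S i₀ y.fst.snd y.fst.fst.length y.snd := by
  have hx : PolyFun fun x => x := PolyFun.id
  obtain ⟨P, hP⟩ := size_loadV_le n
  obtain ⟨Q, hQ⟩ := stepsV_growth hS i₀ (iterSteps n)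
  refine PolyKernel.downM
    (f := fun y k x => stepsV S i₀ (iterSteps n) (loadV n y.fst.snd k x)) (.length hx.fst.fst) hx.snd
    ((poly_stepsV hS i₀ _).comp (poly_loadV hx.fst.fst.snd (.length hx.snd.fst) hx.snd.snd))
    (2 * Q.comp P + 1) fun y k a _ w hw => ?_
  obtain ⟨w₁, w₂, rfl, h1, h2⟩ := hQ _ _ w hw
  have h3 : (loadV n y.fst.snd k a).fst.size ≤ P.eval y.size := (hP _ _ _).trans
    (P.eval_nat_mono ((Val.size_snd_le _).trans (Val.size_fst_le _)))
  have h4 := Q.eval_nat_mono h3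
  have h5 := a.size_snd_le
  simp only [loadV, Val.fst_pair] at h1 h2 h3 h4
  simp only [Val.size, Polynomial.eval_add, Polynomial.eval_mul, Polynomial.eval_comp,
    Polynomial.eval_one, Polynomial.eval_ofNat]
  omega

variable {π : TwoPartyProtocol} (hpoly : π.IsPolyTime)
  (hsec : ∀ i, CompIndist MatMulInstance.size (idealSample S i) (realSample π i))
include hpoly hsec

/-- A hybrid argument with a variable number of rounds: in each round one real iteration is
exchanged for an ideal one, followed by ideal iterations only. Each exchange costs at most the same
`μ κ`, and there are at most polynomially many. -/
theorem loop_indist : UnifIndist (fun s : St n => s.1.κ) (fun s => (encSt i₀ s).size)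
    (fun s => (execLoop (realSample π) i₀ s.1.a.T s).map (encSt i₀))
    (fun s => (execLoop (idealSample S) i₀ s.1.a.T s).map (encSt i₀)) := by
  intro D hD Q P
  obtain ⟨B, hB⟩ := execSteps_growth hS i₀ hpoly (iterSteps n)
  -- The number `k` of iterations still to come is part of the index, and is handed over as advice
  -- along with the environment. One distinguisher, hence one `μ`, covers all hybrids.
  have h := (steps_indist hS i₀ hsec hpoly (iterSteps n)).post
    (κ' := fun s : St n × ℕ => s.1.1.κ)
    (size' := fun s => envSize i₀ s.1.1 + (Val.list s.1.2).size + s.2)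
    (fun s => s.1.load s.2) (fun s => (load_preserves s.2 s.1).1)
    (coreBound n + 2 * Polynomial.X + 2) (fun s => by
      obtain ⟨h1, h2, h3⟩ := load_preserves s.2 s.1
      have h4 := size_encSt_le i₀ (s.1.load s.2)
      have h5 : envSize i₀ (s.1.load s.2).1 = envSize i₀ s.1.1 := by rw [envSize, h1, h2, envSize]
      rw [h3, h5] at h4
      have h6 := (coreBound n).eval_nat_mono
        (show envSize i₀ s.1.1 ≤ envSize i₀ s.1.1 + (Val.list s.1.2).size + s.2 by omega)
      simp only [Polynomial.eval_add, Polynomial.eval_mul, Polynomial.eval_X, Polynomial.eval_ofNat]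
      omega)
    (k := fun e x => loopV S i₀ e.snd e.fst.length x) (poly_loopV hS i₀)
    (fun s => Val.pair (Val.unary s.2) (encEnv i₀ s.1.1.κ s.1.1.a)) (fun s => by
      simp only [Val.size, Val.size_unary, Polynomial.eval_add, Polynomial.eval_mul,
        Polynomial.eval_X, Polynomial.eval_ofNat]
      change _ + envSize i₀ s.1.1 + 1 ≤ _
      omega)
  -- The environment and the initial log contribute at most `P` together, the number of iterations
  -- at most `P`, and the growth of the log over all iterations at most `P * B.comp P`.
  obtain ⟨μ, hμ, h0, hle⟩ := h D hD Q (2 * P + P * B.comp P)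
  -- The summand `k * B` is a reserve for the future growth of the log: an iteration lengthens the
  -- log by at most `B` and lowers `k` by one, so the size hypothesis is inherited by the next
  -- state.
  have key : ∀ k (s : St n), k ≤ s.1.a.T → ∀ z : Val, z.size ≤ Q.eval s.1.κ →
      envSize i₀ s.1 + (Val.list s.2).size + k + k * B.eval (envSize i₀ s.1) ≤
        (2 * P + P * B.comp P).eval s.1.κ →
      |acceptProb D z ((execLoop (realSample π) i₀ k s).map (encSt i₀)) -
        acceptProb D z (loopV S i₀ (encEnv i₀ s.1.κ s.1.a) k (encSt i₀ s))| ≤ k * μ s.1.κ := by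
    intro k
    induction k with
    | zero =>
      intro s _ z _ _
      simp [execLoop, loopV, downM, PMF.pure_map]
    | succ k ih =>
      intro s hk z hz hs
      obtain ⟨l1, l2, l3⟩ := load_preserves k s
      have hs' : envSize i₀ s.1 + (Val.list s.2).size + k ≤ (2 * P + P * B.comp P).eval s.1.κ := by
        omega
      have h1 := hle (s, k) z hs' hz
      simp only [Val.fst_pair, Val.snd_pair, Val.length_unary] at h1
      have h2 := abs_acceptProb_bind_le D z (execSteps (realSample π) i₀ (iterSteps n) (s.load k))
        (fun s' => (execLoop (realSample π) i₀ k s').map (encSt i₀))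
        (fun s' => loopV S i₀ (encEnv i₀ s.1.κ s.1.a) k (encSt i₀ s'))
        (ε := k * μ s.1.κ) (mul_nonneg (Nat.cast_nonneg _) (h0 _)) (fun s' hs' => by
          obtain ⟨e1, e2, e3⟩ := hB _ _ hs'
          rw [l1] at e1
          rw [l2] at e2
          have e4 : envSize i₀ (s.load k).1 = envSize i₀ s.1 := by rw [envSize, l1, l2, envSize]
          have e5 : envSize i₀ s'.1 = envSize i₀ s.1 := by rw [envSize, e1, e2, envSize]
          rw [l3, e4] at e3
          have := ih s' (by rw [e2]; omega) z (by rwa [e1]) (by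
            rw [e1, e5]
            rw [add_mul, one_mul] at hs
            omega)
          rwa [e1, e2] at this)
      have e1 : (execLoop (realSample π) i₀ (k + 1) s).map (encSt i₀) =
          (execSteps (realSample π) i₀ (iterSteps n) (s.load k)).bind fun s' =>
            (execLoop (realSample π) i₀ k s').map (encSt i₀) := by
        rw [execLoop, PMF.map_bind]
      have e2 : loopV S i₀ (encEnv i₀ s.1.κ s.1.a) (k + 1) (encSt i₀ s) =
          (stepsV S i₀ (iterSteps n) (encSt i₀ (s.load k))).bind
            (loopV S i₀ (encEnv i₀ s.1.κ s.1.a) k) := by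
        rw [loopV, downM, loadV_enc i₀ s hk]
        rfl
      rw [PMF.bind_map] at h1
      rw [e1, e2]
      push_cast
      rw [add_mul, one_mul]
      exact (abs_sub_le _ _ _).trans (add_le_add h2 h1)
  refine ⟨fun k => (P.eval k : ℕ) * μ k, ?_, fun k => mul_nonneg (Nat.cast_nonneg _) (h0 k),
    fun s z hs hz => ?_⟩
  · have := Asymptotics.SuperpolynomialDecay.polynomial_mul hμ (P.map (Nat.castRingHom ℝ))
    refine this.congr fun k => ?_
    simp [Polynomial.eval_natCast_map]
  · dsimp only at hs hz
    have hE : envSize i₀ s.1 ≤ P.eval s.1.κ := (envSize_le_encSt i₀ s).trans hs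
    have hT : s.1.a.T ≤ P.eval s.1.κ := (T_le_encEnv i₀ s.1.κ s.1.a).trans hE
    have hL : envSize i₀ s.1 + (Val.list s.2).size ≤ (encSt i₀ s).size := by
      have := envSize_le_encCore i₀ s.1
      simp only [encSt, Val.size]; omega
    have h1 := key _ s le_rfl z hz (by
      have h2 := Nat.mul_le_mul hT (B.eval_nat_mono hE)
      simp only [Polynomial.eval_add, Polynomial.eval_mul, Polynomial.eval_comp,
        Polynomial.eval_ofNat]
      omega)
    rw [loopV_enc S i₀ s le_rfl] at h1
    refine h1.trans (mul_le_mul_of_nonneg_right ?_ (h0 _))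
    exact_mod_cast hT

end Loop

/-! ### The whole execution -/

/-- The zeros are placeholders: the coefficient shares are set by the initial steps, and the
remaining variables when a batch is loaded. -/
def Core.init (κ : ℕ) (a : Regression n) : Core n := ⟨κ, a, 0, 0, 0, 0, 0, 0⟩

def initSteps (n : ℕ) : List (Step n) := (List.finRange n).map .distW

/-- The final state, with the log of party `i₀`. -/
def finalSt (smp : Fin 2 → ℕ → MatMulInstance → PMF Val) (i₀ : Fin n) (κ : ℕ) (a : Regression n) :
    PMF (St n) :=
  (execSteps smp i₀ (initSteps n) (Core.init κ a, [])).bind (execLoop smp i₀ a.T)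

theorem execSteps_congr_smp {l : List (Step n)} (h : ∀ q, .call q ∉ l) (i₀ : Fin n)
    (smp smp' : Fin 2 → ℕ → MatMulInstance → PMF Val) (s : St n) :
    execSteps smp i₀ l s = execSteps smp' i₀ l s := by
  induction l generalizing s with
  | nil => rfl
  | cons st l ih =>
    rw [execSteps, execSteps, Step.execLog, Step.execLog,
      exec_congr_smp i₀ (fun q hq => h q (by simp [hq])) smp smp']
    congr 1; funext s'
    exact ih (fun q hq => h q (by simp [hq])) s'

theorem call_not_mem_initSteps (q : Call n) : Step.call q ∉ initSteps n := by
  simp [initSteps]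

theorem size_encEnv_le (n : ℕ) : ∃ P : Polynomial ℕ, ∀ (i₀ : Fin n) κ (a : Regression n),
    (encEnv i₀ κ a).size ≤ P.eval (κ + (a.input i₀).size) := by
  refine ⟨7 * Polynomial.X + (n : Polynomial ℕ) * 3 + ((n : Polynomial ℕ) * (vecBound + 1)) +
    Polynomial.X * (batchBound n + 1) + 30, fun i₀ κ a => ?_⟩
  set I := κ + (a.input i₀).size with hI
  have hpub : ∀ k, (a.pub.nth k).size ≤ (a.input i₀).size := fun k =>
    (Val.size_nth_le a.pub k).trans (Val.size_nth_le (a.input i₀) 0)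
  have hp : a.p.size + 1 ≤ (a.input i₀).size := hpub 0
  have hds : (Val.list (List.ofFn fun i => Val.unary (a.d i))).size ≤ (a.input i₀).size := hpub 2
  have hb : (Val.unary a.b).size ≤ (a.input i₀).size := hpub 3
  have hrate : (Val.num a.rate.val).size ≤ (a.input i₀).size := hpub 6
  have hT : a.T ≤ (a.input i₀).size := by
    have h : (a.pub.nth 4).length = a.T := by
      change (Val.list _).length = _
      simp
    exact h ▸ (Val.length_le_size _).trans (hpub 4)
  have hd : ∀ i, a.d i ≤ I := fun i => by
    have h1 := Val.size_mem_le (l := List.ofFn fun i => Val.unary (a.d i)) (v := Val.unary (a.d i))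
      (List.mem_ofFn.2 ⟨i, rfl⟩)
    have h2 := le_size_unary (a.d i)
    omega
  have hb' : a.b ≤ I := by have := le_size_unary a.b; omega
  have hp' : a.p.size ≤ I := by omega
  have h1 := size_encFam_le a.w₀ hp' hd
  have h2 := Val.size_list_le (l := List.ofFn fun t : Fin a.T =>
    encBatch (fun i => a.XB i t.rev) (a.yB t.rev)) (c := (batchBound n).eval I) fun v hv => by
      obtain ⟨t, rfl⟩ := List.mem_ofFn.1 hv
      exact size_encBatch_le _ _ hp' hb' hd
  have h3 := Val.size_list_le (l := List.ofFn fun i => Val.num (if i = a.owner then 1 else 0))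
    (c := 2) fun v hv => by
      obtain ⟨t, rfl⟩ := List.mem_ofFn.1 hv
      split <;> simp [Val.size]
  rw [List.length_ofFn] at h2 h3
  have h4 : a.T * ((batchBound n).eval I + 1) ≤ I * ((batchBound n).eval I + 1) :=
    Nat.mul_le_mul_right _ (by omega)
  simp only [encEnv, Val.list, Val.size, Val.size_unary, Polynomial.eval_add, Polynomial.eval_mul,
    Polynomial.eval_natCast, Polynomial.eval_one, Polynomial.eval_X, Polynomial.eval_ofNat,
    Nat.size_zero, Nat.cast_id] at *
  omega

/-- The initial sharing contains no multiplication and is the same on both sides, so the statement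
about the loop is averaged over its outcome. -/
theorem final_indist {S : Fin 2 → Prog} (hS : ∀ i, (S i).PolyTime) (i₀ : Fin n)
    {π : TwoPartyProtocol} (hpoly : π.IsPolyTime)
    (hsec : ∀ i, CompIndist MatMulInstance.size (idealSample S i) (realSample π i)) :
    UnifIndist (ι := ℕ × Regression n) Prod.fst (fun x => ∑ j, (x.2.input j).size)
      (fun x => (finalSt (realSample π) i₀ x.1 x.2).map (encSt i₀))
      (fun x => (finalSt (idealSample S) i₀ x.1 x.2).map (encSt i₀)) := by
  obtain ⟨E, hE⟩ := size_encEnv_le n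
  obtain ⟨B, hB⟩ := execSteps_growth hS i₀ hpoly (initSteps n)
  have h := (loop_indist hS i₀ hpoly hsec).average
    (κ' := fun x : ℕ × Regression n => x.1) (size' := fun x => ∑ j, (x.2.input j).size)
    (fun x => execSteps (realSample π) i₀ (initSteps n) (Core.init x.1 x.2, []))
    (fun x s hs => (hB _ s hs).1) ((coreBound n).comp E + B.comp E + 2) (fun x s hs => by
      obtain ⟨h1, h2, h3⟩ := hB _ s hs
      have h4 : envSize i₀ s.1 = envSize i₀ (Core.init x.1 x.2) := by rw [envSize, h1, h2, envSize]
      have h5 : envSize i₀ (Core.init x.1 x.2) ≤ E.eval (x.1 + ∑ j, (x.2.input j).size) :=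
        (hE i₀ x.1 x.2).trans (E.eval_nat_mono (Nat.add_le_add_left
          (Finset.single_le_sum (f := fun j => (x.2.input j).size) (fun _ _ => Nat.zero_le _)
            (Finset.mem_univ i₀)) _))
      have h6 := size_encSt_le i₀ s
      rw [h4] at h6
      have h7 := (coreBound n).eval_nat_mono h5
      have h8 := B.eval_nat_mono h5
      simp only [Val.list, Val.size, Nat.size_zero] at h3
      simp only [Polynomial.eval_add, Polynomial.eval_comp, Polynomial.eval_ofNat]
      omega)
  refine .trans (.of_eq fun x => ?_) (h.trans (.of_eq fun x => ?_))
  · rw [finalSt, PMF.map_bind]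
    refine PMF.bind_congr_support _ fun s hs => ?_
    have : s.1.a = x.2 := (hB _ s hs).2.1
    rw [this]
  · rw [finalSt, PMF.map_bind,
      execSteps_congr_smp call_not_mem_initSteps i₀ (realSample π) (idealSample S)]
    refine PMF.bind_congr_support _ fun s hs => ?_
    have : s.1.a = x.2 := (execSteps_preserves hs).2
    rw [this]

end Regression

namespace Regression

variable {n : ℕ}

/-! ## Correctness of the ideal execution -/

/-- The variables of the protocol, for given dimensions. -/
structure Vars (n p b : ℕ) (d : Fin n → ℕ) where
  XB : ∀ i, Matrix (Fin b) (Fin (d i)) (ZMod p)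
  yB : Fin b → ZMod p
  W : ∀ i : Fin n, Fin n → Fin (d i) → ZMod p
  y : Fin n → Fin b → ZMod p
  z : Fin n → Fin b → ZMod p
  G : ∀ i : Fin n, Fin n → Fin (d i) → ZMod p

/-- The type of the variables depends on the dimensions and the field only. Executions on two
instances with the same public parameters thus have variables in one type, which can be compared
directly. -/
def Vars.core (κ : ℕ) (a : Regression n) (x : Vars n a.p a.b a.d) : Core n :=
  ⟨κ, a, x.XB, x.yB, x.W, x.y, x.z, x.G⟩

theorem exec_call_of_eq {smp : Fin 2 → ℕ → MatMulInstance → PMF Val} {i₀ : Fin n} {q : Call n}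
    (h : q.fst = q.snd) (c : Core n) : (Step.call q).exec smp i₀ c = PMF.pure (c, .num 0) :=
  if_pos h

theorem exec_call_of_ne {smp : Fin 2 → ℕ → MatMulInstance → PMF Val} {i₀ : Fin n} {q : Call n}
    (h : q.fst ≠ q.snd) (c : Core n) : (Step.call q).exec smp i₀ c =
      (smp (q.side i₀) c.κ (q.inst c)).map fun v => (q.after c (v.nth 1) (v.nth 2), v.nth 0) :=
  if_neg h

theorem share_sum {p D : ℕ} [NeZero p] {i : Fin n} {v : Fin D → ZMod p}
    {s : Fin n → Fin D → ZMod p} (h : s ∈ (share i v).support) : ∑ j, s j = v := by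
  obtain ⟨r, -, rfl⟩ := (PMF.mem_support_map_iff ..).1 h
  rw [← Finset.add_sum_erase _ _ (Finset.mem_univ i)]
  have : ∑ j ∈ Finset.univ.erase i, Function.update r i (v - ∑ j ∈ Finset.univ.erase i, r j) j =
      ∑ j ∈ Finset.univ.erase i, r j :=
    Finset.sum_congr rfl fun j hj => by rw [Function.update_of_ne (Finset.ne_of_mem_erase hj)]
  rw [this]
  simp

/-- The input of the simulator of a secure multiplication. -/
def simInput (side : Fin 2) (κ : ℕ) (com A B R R' : Val) : Val :=
  Val.pair (Val.unary κ) (Val.pair (Val.pair com (if side = 0 then A else B))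
    (if side = 0 then R else R'))

def Vars.addPred {p b : ℕ} {d : Fin n → ℕ} (x : Vars n p b d) (i j : Fin n)
    (R R' : Matrix (Fin b) (Fin 1) (ZMod p)) : Vars n p b d :=
  { x with z := x.z + Pi.single i (fun r => R r 0) + Pi.single j (fun r => R' r 0) }

def Vars.addGrad {p b : ℕ} {d : Fin n → ℕ} (x : Vars n p b d) (i j : Fin n)
    (R R' : Matrix (Fin 1) (Fin (d j)) (ZMod p)) : Vars n p b d :=
  { x with G := x.G + Pi.single j (Pi.single i (R 0)) + Pi.single j (Pi.single j (R' 0)) }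

theorem idealSample_map {α : Type} (S : Fin 2 → Prog) (side : Fin 2) (κ : ℕ) (m : MatMulInstance)
    (g : Val → Val → Val → α) :
    ((idealSample S side κ m).map fun v => g (v.nth 0) (v.nth 1) (v.nth 2)) =
      (PMF.uniformOfFintype (Fin m.r → Fin m.c → ZMod m.p)).bind fun R =>
        ((S side).eval (simInput side κ m.common (encMat m.A) (encMat m.B) (encMat (Matrix.of R))
          (encMat (m.A * m.B - Matrix.of R)))).map fun v =>
            g v (encMat (Matrix.of R)) (encMat (m.A * m.B - Matrix.of R)) := by
  have h : idealSample S side κ m = (PMF.uniformOfFintype (Fin m.r → Fin m.c → ZMod m.p)).bind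
      fun R => ((S side).eval (simInput side κ m.common (encMat m.A) (encMat m.B)
        (encMat (Matrix.of R)) (encMat (m.A * m.B - Matrix.of R)))).map fun v =>
          Val.list [v, encMat (Matrix.of R), encMat (m.A * m.B - Matrix.of R)] := by
    simp only [idealSample, MatMulInstance.shares, bind_assoc, pure_bind]
    rfl
  rw [h, PMF.map_bind]
  congr 1; funext R
  rw [PMF.map_comp]
  rfl

section Exec

variable (S : Fin 2 → Prog) (i₀ : Fin n) (κ : ℕ) (a : Regression n) (x : Vars n a.p a.b a.d)
  {i j : Fin n}

/-- Exposes the uniform mask `R` of the ideal multiplication: the state depends on `R` alone and the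
new entry on `R` and the coins of the simulator. Both correctness and the coupling use this form. -/
theorem exec_pred_ideal (hij : i ≠ j) :
    (Step.call (.pred i j)).exec (idealSample S) i₀ (x.core κ a) =
      (PMF.uniformOfFintype (Matrix (Fin a.b) (Fin 1) (ZMod a.p))).bind fun R =>
        ((S (Call.side i₀ (.pred i j))).eval (simInput (Call.side i₀ (.pred i j)) κ
          (matMulCommon a.p a.b (a.d i) 1) (encMat (x.XB i))
          (encMat (Matrix.replicateCol (Fin 1) (x.W i j))) (encMat R)
          (encMat (x.XB i * Matrix.replicateCol (Fin 1) (x.W i j) - R)))).map fun v =>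
            ((x.addPred i j R (x.XB i * Matrix.replicateCol (Fin 1) (x.W i j) - R)).core κ a, v) := by
  have hd : ∀ R : Matrix (Fin a.b) (Fin 1) (ZMod a.p), decMat a.p a.b 1 (encMat R) = R :=
    fun R => decMat_encMat R
  have ha : ∀ R R' : Matrix (Fin a.b) (Fin 1) (ZMod a.p),
      (Call.pred i j).after (x.core κ a) (encMat R) (encMat R') = (x.addPred i j R R').core κ a := by
    intro R R'
    simp only [Call.after, Vars.core, Vars.addPred, hd]
    rfl
  rw [exec_call_of_ne (by exact hij), idealSample_map S _ _ _ fun v u w =>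
    ((Call.pred i j).after (x.core κ a) u w, v)]
  refine congrArg (PMF.bind _) (funext fun R => congrArg (fun g => PMF.map g _) (funext fun v => ?_))
  exact Prod.ext (ha _ _) rfl

theorem exec_grad_ideal (hij : i ≠ j) :
    (Step.call (.grad i j)).exec (idealSample S) i₀ (x.core κ a) =
      (PMF.uniformOfFintype (Matrix (Fin 1) (Fin (a.d j)) (ZMod a.p))).bind fun R =>
        ((S (Call.side i₀ (.grad i j))).eval (simInput (Call.side i₀ (.grad i j)) κ
          (matMulCommon a.p 1 a.b (a.d j)) (encMat (Matrix.replicateRow (Fin 1) (x.z i)))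
          (encMat (x.XB j)) (encMat R)
          (encMat (Matrix.replicateRow (Fin 1) (x.z i) * x.XB j - R)))).map fun v =>
            ((x.addGrad i j R (Matrix.replicateRow (Fin 1) (x.z i) * x.XB j - R)).core κ a, v) := by
  have hd : ∀ R : Matrix (Fin 1) (Fin (a.d j)) (ZMod a.p), decMat a.p 1 (a.d j) (encMat R) = R :=
    fun R => decMat_encMat R
  have ha : ∀ R R' : Matrix (Fin 1) (Fin (a.d j)) (ZMod a.p),
      (Call.grad i j).after (x.core κ a) (encMat R) (encMat R') = (x.addGrad i j R R').core κ a := by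
    intro R R'
    simp only [Call.after, Vars.core, Vars.addGrad, hd]
    rfl
  rw [exec_call_of_ne (by exact hij), idealSample_map S _ _ _ fun v u w =>
    ((Call.grad i j).after (x.core κ a) u w, v)]
  refine congrArg (PMF.bind _) (funext fun R => congrArg (fun g => PMF.map g _) (funext fun v => ?_))
  exact Prod.ext (ha _ _) rfl

end Exec

theorem mem_execSteps_cons {smp : Fin 2 → ℕ → MatMulInstance → PMF Val} {i₀ : Fin n} {st : Step n}
    {l : List (Step n)} {s s' : St n} (h : s' ∈ (execSteps smp i₀ (st :: l) s).support) :
    ∃ r ∈ (st.exec smp i₀ s.1).support, ∃ L, s' ∈ (execSteps smp i₀ l (r.1, L)).support := by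
  rw [execSteps, PMF.mem_support_bind_iff] at h
  obtain ⟨w, hw, h⟩ := h
  obtain ⟨r, hr, rfl⟩ := (PMF.mem_support_map_iff ..).1 hw
  exact ⟨r, hr, _, h⟩

theorem mem_execSteps_append {smp : Fin 2 → ℕ → MatMulInstance → PMF Val} {i₀ : Fin n}
    {l l' : List (Step n)} {s s' : St n} (h : s' ∈ (execSteps smp i₀ (l ++ l') s).support) :
    ∃ w ∈ (execSteps smp i₀ l s).support, s' ∈ (execSteps smp i₀ l' w).support := by
  rw [execSteps_append] at h
  exact (PMF.mem_support_bind_iff ..).1 h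

section Correct

variable {S : Fin 2 → Prog} {i₀ : Fin n} {κ : ℕ} {a : Regression n}

theorem sum_single_add {p D : ℕ} (i : Fin n) (u : Fin D → ZMod p) :
    ∑ k, (Pi.single i u : Fin n → Fin D → ZMod p) k = u := by
  rw [Finset.sum_pi_single']; simp

/-- The mask cancels in the sum of the shares, so a call adds exactly one product to the shared
total. -/
theorem callPred_mem {x : Vars n a.p a.b a.d} {i j : Fin n} {r : Core n × Val}
    (h : r ∈ ((Step.call (.pred i j)).exec (idealSample S) i₀ (x.core κ a)).support) :
    ∃ z, r.1 = Vars.core κ a { x with z := z } ∧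
      ∑ k, z k = ∑ k, x.z k + if j = i then 0 else x.XB i *ᵥ x.W i j := by
  by_cases hij : i = j
  · rw [exec_call_of_eq (by exact hij), PMF.mem_support_pure_iff] at h
    subst h
    exact ⟨x.z, rfl, by simp [hij]⟩
  · rw [exec_pred_ideal _ _ _ _ _ hij, PMF.mem_support_bind_iff] at h
    obtain ⟨R, -, h⟩ := h
    obtain ⟨v, -, rfl⟩ := (PMF.mem_support_map_iff ..).1 h
    refine ⟨_, rfl, ?_⟩
    rw [if_neg (Ne.symm hij)]
    simp only [Pi.add_apply, Finset.sum_add_distrib, sum_single_add]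
    rw [add_assoc]
    congr 1
    funext r
    simp [Matrix.mul_apply, Matrix.mulVec, dotProduct]

theorem callGrad_mem {x : Vars n a.p a.b a.d} {i j : Fin n} {r : Core n × Val}
    (h : r ∈ ((Step.call (.grad i j)).exec (idealSample S) i₀ (x.core κ a)).support) :
    ∃ G, r.1 = Vars.core κ a { x with G := G } ∧
      ∀ l, ∑ k, G l k = ∑ k, x.G l k + if j = i then 0 else
        if l = j then x.z i ᵥ* x.XB l else 0 := by
  by_cases hij : i = j
  · rw [exec_call_of_eq (by exact hij), PMF.mem_support_pure_iff] at h
    subst h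
    exact ⟨x.G, rfl, by simp [hij]⟩
  · rw [exec_grad_ideal _ _ _ _ _ hij, PMF.mem_support_bind_iff] at h
    obtain ⟨R, -, h⟩ := h
    obtain ⟨v, -, rfl⟩ := (PMF.mem_support_map_iff ..).1 h
    refine ⟨_, rfl, fun l => ?_⟩
    rw [if_neg (Ne.symm hij)]
    simp only [Pi.add_apply, Finset.sum_add_distrib]
    rw [add_assoc]
    congr 1
    by_cases hl : l = j
    · subst hl
      rw [Pi.single_eq_same, Pi.single_eq_same, sum_single_add, sum_single_add, if_pos rfl]
      funext r
      simp [Matrix.mul_apply, Matrix.vecMul, dotProduct]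
    · simp [hl]

theorem predRow_mem {l : List (Fin n)} {i : Fin n} {x : Vars n a.p a.b a.d} {L : List Val}
    {s : St n} (h : s ∈ (execSteps (idealSample S) i₀
      (l.map fun j => .call (.pred i j)) (x.core κ a, L)).support) :
    ∃ z, s.1 = Vars.core κ a { x with z := z } ∧
      ∑ k, z k = ∑ k, x.z k + (l.map fun j => if j = i then 0 else x.XB i *ᵥ x.W i j).sum := by
  induction l generalizing x L with
  | nil =>
    obtain rfl := (PMF.mem_support_pure_iff ..).1 h
    exact ⟨x.z, rfl, by simp⟩
  | cons j l ih =>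
    obtain ⟨r, hr, L', h⟩ := mem_execSteps_cons h
    obtain ⟨z, hz, e⟩ := callPred_mem hr
    rw [hz] at h
    obtain ⟨z', hz', e'⟩ := ih h
    refine ⟨z', hz', ?_⟩
    rw [e', List.map_cons, List.sum_cons, ← add_assoc, ← e]

/-- The local product is the diagonal term `j = i` that the calls leave out. By linearity, the row
of party `i` contributes its features times its reconstructed coefficients. -/
theorem pred_mem {l : List (Fin n)} {x : Vars n a.p a.b a.d} {L : List Val}
    {s : St n} (h : s ∈ (execSteps (idealSample S) i₀ (l.flatMap fun i =>
      .localP i :: (List.finRange n).map fun j => .call (.pred i j)) (x.core κ a, L)).support) :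
    ∃ z, s.1 = Vars.core κ a { x with z := z } ∧
      ∑ k, z k = ∑ k, x.z k + (l.map fun i => x.XB i *ᵥ ∑ j, x.W i j).sum := by
  induction l generalizing x L with
  | nil =>
    obtain rfl := (PMF.mem_support_pure_iff ..).1 h
    exact ⟨x.z, rfl, by simp⟩
  | cons i l ih =>
    rw [List.flatMap_cons, List.cons_append] at h
    obtain ⟨r, hr, L', h⟩ := mem_execSteps_cons h
    obtain rfl := (PMF.mem_support_pure_iff ..).1 hr
    obtain ⟨w, hw, h⟩ := mem_execSteps_append h
    obtain ⟨z, hz, e⟩ := predRow_mem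
      (x := { x with z := Function.update x.z i (x.z i + x.XB i *ᵥ x.W i i) }) hw
    rw [← Prod.mk.eta (p := w), hz] at h
    obtain ⟨z', hz', e'⟩ := ih h
    refine ⟨z', hz', ?_⟩
    rw [e', List.map_cons, List.sum_cons, ← add_assoc, e]
    congr 1
    rw [← Fin.sum_univ_def]
    have h1 : ∑ k, Function.update x.z i (x.z i + x.XB i *ᵥ x.W i i) k =
        ∑ k, x.z k + x.XB i *ᵥ x.W i i := by
      rw [Finset.sum_update_of_mem (Finset.mem_univ i),
        ← Finset.add_sum_erase _ x.z (Finset.mem_univ i), Finset.sdiff_singleton_eq_erase]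
      abel
    dsimp only
    rw [h1, add_assoc]
    congr 1
    rw [Matrix.mulVec_sum, ← Finset.add_sum_erase _ (fun j => x.XB i *ᵥ x.W i j) (Finset.mem_univ i)]
    congr 1
    rw [← Finset.add_sum_erase _ _ (Finset.mem_univ i), if_pos rfl, zero_add]
    exact Finset.sum_congr rfl fun j hj => if_neg (Finset.ne_of_mem_erase hj)

theorem gradRow_mem {l : List (Fin n)} {i : Fin n} {x : Vars n a.p a.b a.d} {L : List Val}
    {s : St n} (h : s ∈ (execSteps (idealSample S) i₀
      (l.map fun j => .call (.grad i j)) (x.core κ a, L)).support) :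
    ∃ G, s.1 = Vars.core κ a { x with G := G } ∧
      ∀ m, ∑ k, G m k = ∑ k, x.G m k + (l.map fun j => if j = i then 0 else
        if m = j then x.z i ᵥ* x.XB m else 0).sum := by
  induction l generalizing x L with
  | nil =>
    obtain rfl := (PMF.mem_support_pure_iff ..).1 h
    exact ⟨x.G, rfl, by simp⟩
  | cons j l ih =>
    obtain ⟨r, hr, L', h⟩ := mem_execSteps_cons h
    obtain ⟨z, hz, e⟩ := callGrad_mem hr
    rw [hz] at h
    obtain ⟨z', hz', e'⟩ := ih h
    refine ⟨z', hz', fun m => ?_⟩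
    rw [e', List.map_cons, List.sum_cons, ← add_assoc, ← e]

theorem grad_mem {l : List (Fin n)} {x : Vars n a.p a.b a.d} {L : List Val}
    {s : St n} (h : s ∈ (execSteps (idealSample S) i₀ (l.flatMap fun i =>
      .localG i :: (List.finRange n).map fun j => .call (.grad i j)) (x.core κ a, L)).support) :
    ∃ G, s.1 = Vars.core κ a { x with G := G } ∧
      ∀ m, ∑ k, G m k = ∑ k, x.G m k + (l.map fun i => x.z i ᵥ* x.XB m).sum := by
  induction l generalizing x L with
  | nil =>
    obtain rfl := (PMF.mem_support_pure_iff ..).1 h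
    exact ⟨x.G, rfl, by simp⟩
  | cons i l ih =>
    rw [List.flatMap_cons, List.cons_append] at h
    obtain ⟨r, hr, L', h⟩ := mem_execSteps_cons h
    obtain rfl := (PMF.mem_support_pure_iff ..).1 hr
    obtain ⟨w, hw, h⟩ := mem_execSteps_append h
    obtain ⟨z, hz, e⟩ := gradRow_mem
      (x := { x with G := x.G + Pi.single i (Pi.single i (x.z i ᵥ* x.XB i)) }) hw
    rw [← Prod.mk.eta (p := w), hz] at h
    obtain ⟨z', hz', e'⟩ := ih h
    refine ⟨z', hz', fun m => ?_⟩
    rw [e', List.map_cons, List.sum_cons, ← add_assoc, e]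
    congr 1
    rw [← Fin.sum_univ_def]
    dsimp only
    simp only [Pi.add_apply, Finset.sum_add_distrib]
    rw [add_assoc]
    congr 1
    by_cases hm : m = i
    · subst hm
      rw [Pi.single_eq_same, sum_single_add]
      simp only [add_eq_left]
      refine Finset.sum_eq_zero fun j _ => ?_
      by_cases hj : j = m
      · simp [hj]
      · simp [hj, Ne.symm hj]
    · rw [Pi.single_eq_of_ne hm]
      simp only [Pi.zero_apply, Finset.sum_const_zero, zero_add]
      rw [Finset.sum_eq_single m]
      · simp only [if_neg hm, if_true]
      · intro j _ hj
        simp [Ne.symm hj]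
      · simp

/-- The reconstructed coefficients. -/
def totals (x : Vars n a.p a.b a.d) : (Σ i, Fin (a.d i)) → ZMod a.p :=
  fun c => ∑ j, x.W c.1 j c.2

/-- Every step is linear in the shares, so after summing over the holders only the plain gradient
step remains: the masks cancel and the error shares add up to the prediction minus the labels. -/
theorem iter_mem {x : Vars n a.p a.b a.d} {L : List Val} {s : St n} {t : Fin a.T}
    (h : s ∈ (execSteps (idealSample S) i₀ (iterSteps n) ((x.core κ a).load t, L)).support) :
    ∃ x' : Vars n a.p a.b a.d, s.1 = x'.core κ a ∧ totals x' = a.update (totals x) t := by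
  rw [iterSteps] at h
  obtain ⟨r, hr, L', h⟩ := mem_execSteps_cons h
  obtain ⟨y, hy, rfl⟩ := (PMF.mem_support_map_iff ..).1 hr
  change Fin n → Fin a.b → ZMod a.p at y
  have hy : ∑ j, y j = a.yB t := share_sum hy
  obtain ⟨w, hw, h⟩ := mem_execSteps_append h
  obtain ⟨z, hz, ez⟩ := pred_mem (x := ⟨fun i => a.XB i t, a.yB t, x.W, y, 0, 0⟩) hw
  obtain ⟨r, hr, L', h⟩ := mem_execSteps_cons h
  rw [hz] at hr
  obtain rfl := (PMF.mem_support_pure_iff ..).1 hr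
  obtain ⟨w, hw, h⟩ := mem_execSteps_append h
  obtain ⟨G, hG, eG⟩ := grad_mem
    (x := ⟨fun i => a.XB i t, a.yB t, x.W, y, fun j => z j - y j, 0⟩) hw
  obtain ⟨r, hr, L', h⟩ := mem_execSteps_cons h
  rw [hG] at hr
  obtain rfl := (PMF.mem_support_pure_iff ..).1 hr
  obtain rfl := (PMF.mem_support_pure_iff ..).1 h
  refine ⟨⟨fun i => a.XB i t, a.yB t, fun i j => x.W i j - a.rate • G i j, y,
    fun j => z j - y j, G⟩, rfl, ?_⟩
  rw [← Fin.sum_univ_def] at ez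
  simp only [← Fin.sum_univ_def] at eG
  have herr : ∑ j, (z j - y j) = a.jointXB t *ᵥ totals x - a.yB t := by
    rw [Finset.sum_sub_distrib, ez, hy]
    congr 1
    funext r
    simp only [Pi.zero_apply, Finset.sum_const_zero, zero_add, Finset.sum_apply, Matrix.mulVec,
      dotProduct, Fintype.sum_sigma, jointXB, totals, Matrix.of_apply]
  funext c
  have h2 := congrFun (eG c.1) c.2
  have h3 : ∑ i, (z i - y i) ᵥ* a.XB c.1 t = (∑ i, (z i - y i)) ᵥ* a.XB c.1 t := by
    rw [Matrix.sum_vecMul]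
  rw [h3, herr] at h2
  simp only [Pi.zero_apply, Finset.sum_const_zero, zero_add, Finset.sum_apply] at h2
  simp only [totals, update, Pi.sub_apply, Pi.smul_apply, Finset.sum_sub_distrib, ← Finset.smul_sum,
    h2]
  congr 2
  simp only [Matrix.mulVec, Matrix.vecMul, dotProduct, Matrix.transpose_apply, jointXB,
    Matrix.of_apply, mul_comm]

/-- The batch with `k` successors has index `T - 1 - k`. This relates the downward counting of the
loop to the order of the batches. -/
theorem drop_finRange {T k : ℕ} (hk : k < T) : (List.finRange T).drop (T - (k + 1)) =
    Fin.rev ⟨k, hk⟩ :: (List.finRange T).drop (T - k) := by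
  rw [List.drop_eq_getElem_cons (by simp; omega)]
  congr 1
  · simp [Fin.rev]
  · congr 1; omega

theorem execLoop_mem {k : ℕ} (hk : k ≤ a.T) {x : Vars n a.p a.b a.d} {L : List Val} {s : St n}
    (h : s ∈ (execLoop (idealSample S) i₀ k (x.core κ a, L)).support) :
    ∃ x' : Vars n a.p a.b a.d, s.1 = x'.core κ a ∧
      totals x' = ((List.finRange a.T).drop (a.T - k)).foldl a.update (totals x) := by
  induction k generalizing x L with
  | zero =>
    obtain rfl := (PMF.mem_support_pure_iff ..).1 h
    exact ⟨x, rfl, by rw [Nat.sub_zero, List.drop_eq_nil_of_le (by simp), List.foldl_nil]⟩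
  | succ k ih =>
    obtain ⟨w, hw, h⟩ := (PMF.mem_support_bind_iff ..).1 h
    rw [St.load, dif_pos (show k < (x.core κ a, L).1.a.T from hk)] at hw
    obtain ⟨x', hx', e⟩ := iter_mem (t := Fin.rev ⟨k, hk⟩) hw
    rw [← Prod.mk.eta (p := w), hx'] at h
    obtain ⟨x'', hx'', e'⟩ := ih (by omega) h
    exact ⟨x'', hx'', by rw [e', e, drop_finRange hk, List.foldl_cons]⟩

theorem initSteps_mem {l : List (Fin n)} {x : Vars n a.p a.b a.d} {L : List Val} {s : St n}
    (h : s ∈ (execSteps (idealSample S) i₀ (l.map .distW) (x.core κ a, L)).support) :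
    ∃ W, s.1 = Vars.core κ a { x with W := W } ∧
      ∀ i, ∑ j, W i j = if i ∈ l then a.w₀ i else ∑ j, x.W i j := by
  induction l generalizing x L with
  | nil =>
    obtain rfl := (PMF.mem_support_pure_iff ..).1 h
    exact ⟨x.W, rfl, by simp⟩
  | cons i l ih =>
    obtain ⟨r, hr, L', h⟩ := mem_execSteps_cons h
    obtain ⟨q, hq, rfl⟩ := (PMF.mem_support_map_iff ..).1 hr
    change Fin n → Fin (a.d i) → ZMod a.p at q
    have hq : ∑ j, q j = a.w₀ i := share_sum hq
    obtain ⟨W, hW, e⟩ := ih (x := { x with W := Function.update x.W i q }) h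
    refine ⟨W, hW, fun k => ?_⟩
    rw [e]
    by_cases hk : k = i
    · subst hk
      simp only [Function.update_self, List.mem_cons, true_or, if_true]
      split
      · rfl
      · exact hq
    · dsimp only
      rw [Function.update_of_ne hk]
      simp [hk]

/-- Correctness holds for every outcome of the ideal execution, not merely with high probability. -/
theorem finalSt_mem {s : St n} (h : s ∈ (finalSt (idealSample S) i₀ κ a).support) :
    ∃ x : Vars n a.p a.b a.d, s.1 = x.core κ a ∧ totals x = a.trained := by
  obtain ⟨w, hw, h⟩ := (PMF.mem_support_bind_iff ..).1 h
  obtain ⟨W, hW, e⟩ := initSteps_mem (x := ⟨0, 0, 0, 0, 0, 0⟩) hw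
  rw [← Prod.mk.eta (p := w), hW] at h
  obtain ⟨x, hx, e'⟩ := execLoop_mem le_rfl h
  refine ⟨x, hx, ?_⟩
  rw [e', Nat.sub_self, List.drop_zero, trained]
  congr 1
  funext c
  have := congrFun (e c.1) c.2
  simp only [List.mem_finRange, if_true, Finset.sum_apply] at this
  exact this

end Correct

end Regression

/-! ## Couplings -/

/-- The distributions `X` and `Y` have a coupling supported on `R`, as seen by the functions that
respect `R`. -/
def Coupled {α β : Type} (R : α → β → Prop) (X : PMF α) (Y : PMF β) : Prop :=
  ∀ (φ : α → PMF Val) (ψ : β → PMF Val), (∀ x y, R x y → φ x = ψ y) → X.bind φ = Y.bind ψ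

namespace Coupled

variable {α β γ δ : Type} {R : α → β → Prop} {R' : γ → δ → Prop} {X : PMF α} {Y : PMF β}

theorem pure {x : α} {y : β} (h : R x y) : Coupled R (PMF.pure x) (PMF.pure y) := by
  intro φ ψ e
  rw [PMF.pure_bind, PMF.pure_bind, e x y h]

theorem bind {f : α → PMF γ} {g : β → PMF δ} (h : Coupled R X Y)
    (h' : ∀ x y, R x y → Coupled R' (f x) (g y)) : Coupled R' (X.bind f) (Y.bind g) := by
  intro φ ψ e
  rw [PMF.bind_bind, PMF.bind_bind]
  exact h _ _ fun x y hxy => h' x y hxy φ ψ e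

theorem map {f : α → γ} {g : β → δ} (h : Coupled R X Y) (h' : ∀ x y, R x y → R' (f x) (g y)) :
    Coupled R' (X.map f) (Y.map g) :=
  h.bind fun x y hxy => pure (h' x y hxy)

theorem refl (X : PMF α) : Coupled Eq X X := by
  intro φ ψ e
  rw [show φ = ψ from funext fun x => e x x rfl]

/-- Functions that agree on all pairs are equal to one and the same constant, because neither
distribution has empty support. -/
theorem trivial (X : PMF α) (Y : PMF β) : Coupled (fun _ _ => True) X Y := by
  intro φ ψ e
  obtain ⟨x, -⟩ := X.support_nonempty
  obtain ⟨y, -⟩ := Y.support_nonempty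
  rw [show φ = fun _ => ψ y from funext fun z => e z y True.intro,
    show ψ = fun _ => ψ y from funext fun z => (e x z True.intro).symm.trans (e x y True.intro),
    PMF.bind_const, PMF.bind_const]

/-- The source of all non-trivial couplings below: a one-time pad is invariant under shifts. -/
theorem uniform {ρ : Type} [Fintype ρ] [Nonempty ρ] (e : ρ ≃ ρ) :
    Coupled (fun x y => y = e x) (PMF.uniformOfFintype ρ) (PMF.uniformOfFintype ρ) := by
  intro φ ψ h
  conv_rhs => rw [← PMF.uniformOfFintype_map_equiv e, PMF.bind_map]
  exact congrArg _ (funext fun x => h x _ rfl)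

theorem map_eq {f : α → Val} {g : β → Val} (h : Coupled R X Y) (h' : ∀ x y, R x y → f x = g y) :
    X.map f = Y.map g :=
  h _ _ fun x y hxy => congrArg PMF.pure (h' x y hxy)

end Coupled

namespace Regression

variable {n : ℕ}

/-! ## Perfect simulation of the ideal execution on dummy data -/

/-- The instance with the same public parameters and other data. -/
abbrev withData (a : Regression n) (X : ∀ i, Matrix (Fin a.m) (Fin (a.d i)) (ZMod a.p))
    (w₀ : ∀ i, Fin (a.d i) → ZMod a.p) (y : Fin a.m → ZMod a.p) : Regression n :=
  { a with X := X, w₀ := w₀, y := y }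

/-- If the simulated view is recorded, the simulator must get the same input on both sides once the
masks are matched by `e`; then its coins are coupled identically. -/
theorem coupled_sample {ρ : Type} [Fintype ρ] [Nonempty ρ] (e : ρ ≃ ρ) (E : Val → PMF Val)
    {inp inp' : ρ → Val} {f f' : ρ → Core n} {logs : Bool} {L : List Val}
    {Rel : St n → St n → Prop} (h₁ : logs = true → ∀ R, inp R = inp' (e R))
    (h₂ : ∀ R L, Rel (f R, L) (f' (e R), L)) :
    Coupled Rel
      (((PMF.uniformOfFintype ρ).bind fun R => (E (inp R)).map fun v => (f R, v)).map
        fun r => (r.1, if logs then r.2 :: L else L))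
      (((PMF.uniformOfFintype ρ).bind fun R => (E (inp' R)).map fun v => (f' R, v)).map
        fun r => (r.1, if logs then r.2 :: L else L)) := by
  rw [PMF.map_bind, PMF.map_bind]
  refine (Coupled.uniform e).bind ?_
  rintro R _ rfl
  rw [PMF.map_comp, PMF.map_comp]
  cases logs with
  | true =>
    rw [h₁ rfl R]
    refine (Coupled.refl _).map ?_
    rintro v _ rfl
    exact h₂ _ _
  -- The view is discarded here, so the inputs of the simulator need not agree.
  | false => exact (Coupled.trivial _ _).map fun _ _ _ => h₂ _ _

section Coupling

variable (κ : ℕ) (a : Regression n) (X' : ∀ i, Matrix (Fin a.m) (Fin (a.d i)) (ZMod a.p))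
  (w' : ∀ i, Fin (a.d i) → ZMod a.p) (y' : Fin a.m → ZMod a.p)

/-- States of the executions on `a` and on `a.withData X' w' y'` with the same log of the corrupted
party, and with related variables. -/
def SameLog (P : Vars n a.p a.b a.d → Vars n a.p a.b a.d → Prop) (s s' : St n) : Prop :=
  ∃ (x x' : Vars n a.p a.b a.d) (L : List Val), s = (x.core κ a, L) ∧
    s' = (Vars.core κ (a.withData X' w' y') x', L) ∧ P x x'

/-- A list of steps of the ideal execution leads from variables related by `P` to variables related
by `Q`. -/
def Leads (S : Fin 2 → Prog) (i₀ : Fin n) (l : List (Step n))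
    (P Q : Vars n a.p a.b a.d → Vars n a.p a.b a.d → Prop) : Prop :=
  ∀ s s', SameLog κ a X' w' y' P s s' → Coupled (SameLog κ a X' w' y' Q)
    (execSteps (idealSample S) i₀ l s) (execSteps (idealSample S) i₀ l s')

variable {κ a X' w' y'} {S : Fin 2 → Prog} {i₀ : Fin n}
  {P Q Q' : Vars n a.p a.b a.d → Vars n a.p a.b a.d → Prop} {l l' : List (Step n)}

theorem Leads.nil (h : ∀ x x', P x x' → Q x x') : Leads κ a X' w' y' S i₀ [] P Q := by
  rintro _ _ ⟨x, x', L, rfl, rfl, hP⟩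
  exact .pure ⟨x, x', L, rfl, rfl, h _ _ hP⟩

theorem Leads.append (h : Leads κ a X' w' y' S i₀ l P Q) (h' : Leads κ a X' w' y' S i₀ l' Q Q') :
    Leads κ a X' w' y' S i₀ (l ++ l') P Q' := by
  intro s s' hs
  rw [execSteps_append, execSteps_append]
  exact (h s s' hs).bind h'

theorem Leads.cons {st : Step n} (h : Leads κ a X' w' y' S i₀ [st] P Q)
    (h' : Leads κ a X' w' y' S i₀ l Q Q') : Leads κ a X' w' y' S i₀ (st :: l) P Q' :=
  h.append h'

theorem Leads.of_step {st : Step n} (h : ∀ x x' L, P x x' →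
    Coupled (SameLog κ a X' w' y' Q) (st.execLog (idealSample S) i₀ (x.core κ a, L))
      (st.execLog (idealSample S) i₀ (Vars.core κ (a.withData X' w' y') x', L))) :
    Leads κ a X' w' y' S i₀ [st] P Q := by
  rintro _ _ ⟨x, x', L, rfl, rfl, hP⟩
  simp only [execSteps, PMF.bind_pure]
  exact h x x' L hP

theorem Leads.flatMap {ι : Type} {f : ι → List (Step n)} {l : List ι}
    (h : ∀ i ∈ l, Leads κ a X' w' y' S i₀ (f i) P P) :
    Leads κ a X' w' y' S i₀ (l.flatMap f) P P := by
  induction l with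
  | nil => exact .nil fun _ _ => id
  | cons i l ih =>
    rw [List.flatMap_cons]
    exact (h i (by simp)).append (ih fun j hj => h j (by simp [hj]))

theorem Leads.map {ι : Type} {f : ι → Step n} {l : List ι}
    (h : ∀ i ∈ l, Leads κ a X' w' y' S i₀ [f i] P P) : Leads κ a X' w' y' S i₀ (l.map f) P P := by
  rw [List.map_eq_flatMap]
  exact .flatMap h

theorem leads_local {st : Step n} (f : Vars n a.p a.b a.d → Vars n a.p a.b a.d)
    (h₁ : ∀ x, st.exec (idealSample S) i₀ (x.core κ a) = PMF.pure ((f x).core κ a, .num 0))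
    (h₂ : ∀ x, st.exec (idealSample S) i₀ (Vars.core κ (a.withData X' w' y') x) =
      PMF.pure (Vars.core κ (a.withData X' w' y') (f x), .num 0))
    (h : ∀ x x', P x x' → Q (f x) (f x')) : Leads κ a X' w' y' S i₀ [st] P Q := by
  refine .of_step fun x x' L hP => ?_
  rw [Step.execLog, Step.execLog, h₁, h₂, PMF.pure_map, PMF.pure_map]
  exact .pure ⟨_, _, _, rfl, rfl, h x x' hP⟩

theorem leads_call_self {q : Call n} (h : q.fst = q.snd) (hPQ : ∀ x x', P x x' → Q x x') :
    Leads κ a X' w' y' S i₀ [.call q] P Q := by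
  refine .of_step fun x x' L hP => ?_
  rw [Step.execLog, Step.execLog, exec_call_of_eq h, exec_call_of_eq h, PMF.pure_map, PMF.pure_map]
  refine .pure ⟨x, x', L, ?_, ?_, hPQ _ _ hP⟩ <;> simp [Step.logs, h]

/-- The mask is shifted by a constant `Δ` that may depend on the variables. The first party sees
`R`, so if it is corrupted there must be no shift. The second sees the product minus `R`, so if it
is corrupted the shift must be the difference of the products. Otherwise `Δ` is free and may be used
to align shares of honest parties. -/
theorem leads_pred {i j : Fin n} (hij : i ≠ j)
    (h : ∀ x x', P x x' → ∃ Δ : Matrix (Fin a.b) (Fin 1) (ZMod a.p),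
      (i₀ = i → x.XB i = x'.XB i ∧ Δ = 0) ∧
      (i₀ = j → x.W i j = x'.W i j ∧ Δ = x'.XB i * Matrix.replicateCol (Fin 1) (x'.W i j) -
        x.XB i * Matrix.replicateCol (Fin 1) (x.W i j)) ∧
      ∀ R, Q (x.addPred i j R (x.XB i * Matrix.replicateCol (Fin 1) (x.W i j) - R))
        (x'.addPred i j (R + Δ)
          (x'.XB i * Matrix.replicateCol (Fin 1) (x'.W i j) - (R + Δ)))) :
    Leads κ a X' w' y' S i₀ [.call (.pred i j)] P Q := by
  refine .of_step fun x x' L hP => ?_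
  obtain ⟨Δ, h₀, h₁, h₂⟩ := h x x' hP
  rw [Step.execLog, Step.execLog, exec_pred_ideal _ _ _ _ _ hij, exec_pred_ideal _ _ _ _ _ hij]
  refine coupled_sample (Equiv.addRight Δ) _ ?_ fun R L => ⟨_, _, L, rfl, rfl, h₂ R⟩
  intro hl R
  have hl : i₀ = i ∨ i₀ = j := by simpa [Step.logs, Call.fst, Call.snd, hij] using hl
  rcases hl with rfl | rfl
  · have hs : Call.side i₀ (.pred i₀ j) = 0 := if_neg hij
    obtain ⟨hX, rfl⟩ := h₀ rfl
    rw [hs, simInput, simInput]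
    simp [hX]
  · have hs : Call.side i₀ (.pred i i₀) = 1 := if_pos rfl
    obtain ⟨hW, rfl⟩ := h₁ rfl
    rw [hs, simInput, simInput]
    simp only [one_ne_zero, if_false, hW, Equiv.coe_addRight]
    congr 3
    abel

theorem leads_grad {i j : Fin n} (hij : i ≠ j)
    (h : ∀ x x', P x x' → ∃ Δ : Matrix (Fin 1) (Fin (a.d j)) (ZMod a.p),
      (i₀ = i → x.z i = x'.z i ∧ Δ = 0) ∧
      (i₀ = j → x.XB j = x'.XB j ∧ Δ = Matrix.replicateRow (Fin 1) (x'.z i) * x'.XB j -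
        Matrix.replicateRow (Fin 1) (x.z i) * x.XB j) ∧
      ∀ R, Q (x.addGrad i j R (Matrix.replicateRow (Fin 1) (x.z i) * x.XB j - R))
        (x'.addGrad i j (R + Δ)
          (Matrix.replicateRow (Fin 1) (x'.z i) * x'.XB j - (R + Δ)))) :
    Leads κ a X' w' y' S i₀ [.call (.grad i j)] P Q := by
  refine .of_step fun x x' L hP => ?_
  obtain ⟨Δ, h₀, h₁, h₂⟩ := h x x' hP
  rw [Step.execLog, Step.execLog, exec_grad_ideal _ _ _ _ _ hij, exec_grad_ideal _ _ _ _ _ hij]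
  refine coupled_sample (Equiv.addRight Δ) _ ?_ fun R L => ⟨_, _, L, rfl, rfl, h₂ R⟩
  intro hl R
  have hl : i₀ = i ∨ i₀ = j := by simpa [Step.logs, Call.fst, Call.snd, hij] using hl
  rcases hl with rfl | rfl
  · have hs : Call.side i₀ (.grad i₀ j) = 0 := if_neg hij
    obtain ⟨hX, rfl⟩ := h₀ rfl
    rw [hs, simInput, simInput]
    simp [hX]
  · have hs : Call.side i₀ (.grad i i₀) = 1 := if_pos rfl
    obtain ⟨hW, rfl⟩ := h₁ rfl
    rw [hs, simInput, simInput]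
    simp only [one_ne_zero, if_false, hW, Equiv.coe_addRight]
    congr 3
    abel

/-- With this shift the share of the second party is the same in both executions. -/
theorem sub_eq_sub_add_sub_self {A : Type} [AddCommGroup A] (u v r : A) :
    u - r = v - (r + (v - u)) := by abel

/-- Agreement of what the corrupted party sees of the features and coefficients. The shares of its
own coefficients agree except for the one held by `j₀`. -/
structure AgreeBase (i₀ j₀ : Fin n) (x x' : Vars n a.p a.b a.d) : Prop where
  XB : x.XB i₀ = x'.XB i₀
  seen : ∀ k, x.W k i₀ = x'.W k i₀
  own : ∀ j, j ≠ j₀ → x.W i₀ j = x'.W i₀ j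

/-- Agreement during the computation of the prediction; the errors already agree for the parties
in `D`. -/
structure AgreePred (i₀ j₀ : Fin n) (D : Set (Fin n)) (x x' : Vars n a.p a.b a.d) : Prop extends
    AgreeBase i₀ j₀ x x' where
  y : x.y i₀ = x'.y i₀
  G : x.G = x'.G
  z : x.z i₀ = x'.z i₀
  err : ∀ j ∈ D, j ≠ j₀ → x.z j - x.y j = x'.z j - x'.y j

/-- Agreement during the computation of the gradient. -/
structure AgreeGrad (i₀ j₀ : Fin n) (x x' : Vars n a.p a.b a.d) : Prop extends
    AgreeBase i₀ j₀ x x' where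
  z : ∀ j, j ≠ j₀ → x.z j = x'.z j
  seenG : ∀ k, x.G k i₀ = x'.G k i₀
  ownG : ∀ j, j ≠ j₀ → x.G i₀ j = x'.G i₀ j

def Vars.addLocalP {p b : ℕ} {d : Fin n → ℕ} (i : Fin n) (x : Vars n p b d) : Vars n p b d :=
  { x with z := Function.update x.z i (x.z i + x.XB i *ᵥ x.W i i) }

theorem leads_localP {i : Fin n} (h : ∀ x x', P x x' → Q (x.addLocalP i) (x'.addLocalP i)) :
    Leads κ a X' w' y' S i₀ [.localP i] P Q :=
  leads_local _ (fun _ => rfl) (fun _ => rfl) h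

variable {j₀ : Fin n}

/-- The rows of the prediction for the corrupted party. -/
theorem leads_predRow_self (hj₀ : j₀ ≠ i₀) (D : Set (Fin n)) :
    Leads κ a X' w' y' S i₀ (.localP i₀ :: (List.finRange n).map fun j => .call (.pred i₀ j))
      (AgreePred i₀ j₀ D) (AgreePred i₀ j₀ D) := by
  refine .cons (leads_localP fun x x' h => ?_) (.map fun j _ => ?_)
  · have e : x.XB i₀ *ᵥ x.W i₀ i₀ = x'.XB i₀ *ᵥ x'.W i₀ i₀ := by rw [h.XB, h.seen]
    refine ⟨⟨h.XB, h.seen, h.own⟩, h.y, h.G, ?_, fun j hD hj => ?_⟩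
    · simp only [Vars.addLocalP, Function.update_self]
      rw [h.z, e]
    · have := h.err j hD hj
      by_cases hji : j = i₀
      · subst hji
        simp only [Vars.addLocalP, Function.update_self]
        rw [h.z, e, h.y]
      · simpa only [Vars.addLocalP, Function.update_of_ne hji] using this
  · by_cases hj : i₀ = j
    · exact leads_call_self hj fun _ _ => id
    -- The corrupted party sees the mask, so there is no freedom. The share of `j` agrees
    -- nevertheless, since for `j ≠ j₀` both factors of the product agree.
    · refine leads_pred hj fun x x' h => ⟨0, fun _ => ⟨h.XB, rfl⟩, fun e => (hj e).elim, fun R => ?_⟩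
      rw [add_zero]
      refine ⟨⟨h.XB, h.seen, h.own⟩, h.y, h.G, ?_, fun k hD hk => ?_⟩
      · simp [Vars.addPred, h.z, hj]
      · have := h.err k hD hk
        by_cases hkj : k = j
        · subst hkj
          simp only [Vars.addPred, Pi.add_apply, h.XB, h.own k hk]
          rw [add_sub_right_comm, add_sub_right_comm, this, add_sub_right_comm, add_sub_right_comm]
        · simp only [Vars.addPred, Pi.add_apply, Pi.single_eq_of_ne hkj, add_zero]
          rw [add_sub_right_comm, add_sub_right_comm, this]

/-- The rows of the prediction for the other parties. -/
theorem leads_predRow_other {i : Fin n} (hi : i ≠ i₀) :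
    Leads κ a X' w' y' S i₀ (.localP i :: (List.finRange n).map fun j => .call (.pred i j))
      (AgreePred i₀ j₀ ∅) (AgreePred i₀ j₀ ∅) := by
  refine .cons (leads_localP fun x x' h => ?_) (.map fun j _ => ?_)
  · refine ⟨⟨h.XB, h.seen, h.own⟩, h.y, h.G, ?_, fun j hD => hD.elim⟩
    simp only [Vars.addLocalP, Function.update_of_ne hi.symm, h.z]
  · by_cases hij : i = j
    · exact leads_call_self hij fun _ _ => id
    · refine leads_pred hij fun x x' h => ⟨x'.XB i * Matrix.replicateCol (Fin 1) (x'.W i j) -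
        x.XB i * Matrix.replicateCol (Fin 1) (x.W i j), fun e => (hi e.symm).elim, ?_, fun R => ?_⟩
      · rintro rfl
        exact ⟨h.seen i, rfl⟩
      refine ⟨⟨h.XB, h.seen, h.own⟩, h.y, h.G, ?_, fun j hD => hD.elim⟩
      simp only [Vars.addPred, Pi.add_apply, Pi.single_eq_of_ne hi.symm, h.z]
      congr 2
      rw [← sub_eq_sub_add_sub_self]

theorem leads_predRow (hj₀ : j₀ ≠ i₀) (i : Fin n) :
    Leads κ a X' w' y' S i₀ (.localP i :: (List.finRange n).map fun j => .call (.pred i j))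
      (AgreePred i₀ j₀ ∅) (AgreePred i₀ j₀ ∅) := by
  by_cases hi : i = i₀
  · subst hi
    exact leads_predRow_self hj₀ ∅
  · exact leads_predRow_other hi

/-- The products of `j₀` with the parties `j` have masks that appear in the shares of `j₀` and `j`
only. Each mask can therefore be chosen to make the error share of `j` agree, and the discrepancy is
pushed into the share of `j₀`, about which nothing is claimed. -/
theorem leads_predCalls_last (hj₀ : j₀ ≠ i₀) (D : Set (Fin n)) (l : List (Fin n)) :
    Leads κ a X' w' y' S i₀ (l.map fun j => .call (.pred j₀ j))
      (AgreePred i₀ j₀ D) (AgreePred i₀ j₀ (D ∪ {j | j ∈ l})) := by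
  induction l generalizing D with
  | nil => exact .nil fun x x' h => by simpa using h
  | cons j l ih =>
    have hD : D ∪ {k | k ∈ j :: l} = (D ∪ {j}) ∪ {k | k ∈ l} := by
      ext k; simp only [Set.mem_union, Set.mem_ofPred_eq, List.mem_cons, Set.mem_singleton_iff]; tauto
    rw [hD, List.map_cons]
    refine .cons ?_ (ih _)
    by_cases hj : j₀ = j
    -- The call of `j₀` with itself does nothing, and adding `j₀` to `D` asserts nothing new.
    · refine leads_call_self hj fun x x' h => ⟨h.1, h.y, h.G, h.z, fun k hk hk' => ?_⟩
      rcases hk with hk | hk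
      · exact h.err k hk hk'
      · exact (hk' (hk.trans hj.symm)).elim
    -- The difference of the products would align the new summand of `j`; the additional column also
    -- removes the discrepancy that `j` has accumulated. For `j = i₀` that discrepancy is zero, so
    -- the shift is the prescribed one.
    refine leads_pred hj fun x x' h => ⟨x'.XB j₀ * Matrix.replicateCol (Fin 1) (x'.W j₀ j) -
        x.XB j₀ * Matrix.replicateCol (Fin 1) (x.W j₀ j) +
        Matrix.replicateCol (Fin 1) ((x'.z j - x'.y j) - (x.z j - x.y j)),
        fun e => (hj₀ e.symm).elim, ?_, fun R => ?_⟩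
    · rintro rfl
      refine ⟨h.seen j₀, ?_⟩
      rw [h.z, h.y]
      ext
      simp
    refine ⟨⟨h.XB, h.seen, h.own⟩, h.y, h.G, ?_, fun k hk hk' => ?_⟩
    · simp only [Vars.addPred, Pi.add_apply, Pi.single_eq_of_ne hj₀.symm, h.z]
      congr 1
      by_cases hji : i₀ = j
      · subst hji
        rw [h.z, h.y, Pi.single_eq_same, Pi.single_eq_same]
        funext r
        simp only [sub_self, Matrix.sub_apply, Matrix.add_apply, Matrix.replicateCol_apply,
          Pi.zero_apply, add_zero]
        abel
      · rw [Pi.single_eq_of_ne hji, Pi.single_eq_of_ne hji]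
    · by_cases hkj : k = j
      · subst hkj
        funext r
        simp only [Vars.addPred, Pi.add_apply, Pi.single_eq_of_ne hk', Pi.single_eq_same,
          Pi.sub_apply, Matrix.sub_apply, Matrix.add_apply, Matrix.replicateCol_apply]
        simp only [Pi.zero_apply]
        abel
      · have := h.err k (hk.resolve_right hkj) hk'
        simpa only [Vars.addPred, Pi.add_apply, Pi.single_eq_of_ne hk', Pi.single_eq_of_ne hkj,
          add_zero] using this

theorem leads_predRow_last (hj₀ : j₀ ≠ i₀) :
    Leads κ a X' w' y' S i₀ (.localP j₀ :: (List.finRange n).map fun j => .call (.pred j₀ j))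
      (AgreePred i₀ j₀ ∅) (AgreePred i₀ j₀ Set.univ) := by
  have := leads_predCalls_last (κ := κ) (a := a) (X' := X') (w' := w') (y' := y') (S := S) hj₀ ∅
    (List.finRange n)
  rw [show (∅ : Set (Fin n)) ∪ {j | j ∈ List.finRange n} = Set.univ by ext; simp] at this
  refine .cons (leads_localP fun x x' h => ?_) this
  refine ⟨⟨h.XB, h.seen, h.own⟩, h.y, h.G, ?_, fun j hD => hD.elim⟩
  simp only [Vars.addLocalP, Function.update_of_ne hj₀.symm, h.z]

/-- The alignment has to come after the rows of all honest parties, since such a row adds unknown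
terms to the shares. This is why `j₀` is the last honest party. Only the row of `i₀` can follow, and
it preserves the agreement. -/
theorem leads_pred_steps (hj₀ : j₀ ≠ i₀) {l₁ l₂ : List (Fin n)}
    (hl : List.finRange n = l₁ ++ j₀ :: l₂) (hl₂ : ∀ i ∈ l₂, i = i₀) :
    Leads κ a X' w' y' S i₀ (predSteps n) (AgreePred i₀ j₀ ∅) (AgreePred i₀ j₀ Set.univ) := by
  have e : predSteps n = (l₁ ++ j₀ :: l₂).flatMap fun i =>
    .localP i :: (List.finRange n).map fun j => .call (.pred i j) := by rw [← hl]; rfl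
  rw [e, List.flatMap_append, List.flatMap_cons]
  refine (Leads.flatMap fun i _ => leads_predRow hj₀ i).append ((leads_predRow_last hj₀).append
    (.flatMap fun i hi => ?_))
  rw [hl₂ i hi]
  exact leads_predRow_self hj₀ Set.univ

/-- The share that `i ≠ i₀` holds of the gradient of `i₀` is its error share times the features of
`i₀`, minus the mask seen by `i₀`. It agrees as soon as the error share of `i` does, that is for `i
≠ j₀`. Products among honest parties contribute to other gradients and leave no trace at `i₀`. -/
theorem leads_grad_steps (hj₀ : j₀ ≠ i₀) :
    Leads κ a X' w' y' S i₀ (gradSteps n) (AgreeGrad i₀ j₀) (AgreeGrad i₀ j₀) := by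
  refine .flatMap fun i _ => .cons (leads_local (fun x =>
    { x with G := x.G + Pi.single i (Pi.single i (x.z i ᵥ* x.XB i)) }) (fun _ => rfl) (fun _ => rfl)
    fun x x' h => ?_) (.map fun j _ => ?_)
  · refine ⟨⟨h.XB, h.seen, h.own⟩, h.z, fun k => ?_, fun j hj => ?_⟩
    · simp only [Pi.add_apply, h.seenG]
      congr 1
      by_cases hi : i = i₀
      · subst hi
        rw [h.XB, h.z _ hj₀.symm]
      · by_cases hk : k = i
        · subst hk
          simp [Ne.symm hi]
        · simp [hk]
    · simp only [Pi.add_apply, h.ownG j hj]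
      congr 1
      by_cases hi : i = i₀
      · subst hi
        rw [h.XB, h.z _ hj₀.symm]
      · simp [Ne.symm hi]
  · by_cases hij : i = j
    · exact leads_call_self hij fun _ _ => id
    by_cases hi : i₀ = i
    · subst hi
      refine leads_grad hij fun x x' h => ⟨0, fun _ => ⟨h.z _ hj₀.symm, rfl⟩, fun e => (hij e).elim,
        fun R => ⟨⟨h.XB, h.seen, h.own⟩, h.z, fun k => ?_, fun k hk => ?_⟩⟩
      · rw [add_zero]
        simp only [Vars.addGrad, Pi.add_apply, h.seenG]
        congr 1
        by_cases hk : k = j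
        · subst hk
          simp [hij]
        · simp [hk]
      · simp [Vars.addGrad, hij, h.ownG k hk]
    · by_cases hj : i₀ = j
      · subst hj
        refine leads_grad hij fun x x' h => ⟨Matrix.replicateRow (Fin 1) (x'.z i) * x'.XB i₀ -
          Matrix.replicateRow (Fin 1) (x.z i) * x.XB i₀, fun e => (hi e).elim, fun _ => ⟨h.XB, rfl⟩,
          fun R => ⟨⟨h.XB, h.seen, h.own⟩, h.z, fun k => ?_, fun k hk => ?_⟩⟩
        · simp only [Vars.addGrad, Pi.add_apply, h.seenG]
          by_cases hk : k = i₀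
          · subst hk
            simp only [Pi.single_eq_same, Pi.single_eq_of_ne hi, add_zero]
            congr 1
            exact congrFun (sub_eq_sub_add_sub_self _ _ _) 0
          · simp [hk]
        · simp only [Vars.addGrad, Pi.add_apply, h.ownG k hk, Pi.single_eq_same]
          by_cases hki : k = i
          · subst hki
            rw [h.z k hk, h.XB]
            simp
          · simp only [Pi.single_eq_of_ne hki, add_zero]
            congr 2
            exact congrFun (sub_eq_sub_add_sub_self _ _ _) 0
      · refine leads_grad hij fun x x' h => ⟨0, fun e => (hi e).elim, fun e => (hj e).elim,
          fun R => ⟨⟨h.XB, h.seen, h.own⟩, h.z, fun k => ?_, fun k hk => ?_⟩⟩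
        · simp only [Vars.addGrad, Pi.add_apply, h.seenG]
          by_cases hk : k = j
          · subst hk
            simp [hi, hj]
          · simp [hk]
        · simp [Vars.addGrad, h.ownG k hk, hj]

/-- With the same random choices only the dependent share differs, and it stays with the dealer. -/
theorem coupled_share {p D : ℕ} [NeZero p] {i : Fin n} {v v' : Fin D → ZMod p}
    (h : i₀ = i → v = v') :
    Coupled (fun s s' => s i₀ = s' i₀ ∧ (i₀ = i → s = s')) (share i v) (share i v') := by
  refine (Coupled.refl _).map ?_
  rintro r _ rfl
  by_cases hi : i₀ = i
  · simp [h hi]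
  · simp [hi]

theorem shareEntry_congr {p D : ℕ} {i : Fin n} {s s' : Fin n → Fin D → ZMod p}
    (h : s i₀ = s' i₀ ∧ (i₀ = i → s = s')) : shareEntry i₀ i s = shareEntry i₀ i s' := by
  unfold shareEntry
  split
  · rw [h.2 ‹_›]
  · rw [h.1]

theorem leads_distW (hw : a.w₀ i₀ = w' i₀) (i : Fin n) :
    Leads κ a X' w' y' S i₀ [.distW i] (AgreeBase i₀ j₀) (AgreeBase i₀ j₀) := by
  refine .of_step fun x x' L h => ?_
  refine Coupled.map (Coupled.map (coupled_share (i₀ := i₀) (i := i) (v := a.w₀ i) (v' := w' i)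
    (by rintro rfl; exact hw)) (R' := fun r r' => SameLog κ a X' w' y' (AgreeBase i₀ j₀)
      (r.1, r.2 :: L) (r'.1, r'.2 :: L)) fun s s' hs => ?_) fun r r' hr => hr
  change Fin n → Fin (a.d i) → ZMod a.p at s s'
  refine ⟨{ x with W := Function.update x.W i s }, { x' with W := Function.update x'.W i s' },
    shareEntry i₀ i s :: L, rfl, ?_, h.XB, fun k => ?_, fun j hj => ?_⟩
  · rw [shareEntry_congr hs]
    rfl
  · by_cases hk : k = i
    · subst hk
      simp only [Function.update_self, hs.1]
    · simp only [Function.update_of_ne hk, h.seen]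
  · by_cases hk : i₀ = i
    · subst hk
      simp only [Function.update_self, hs.2 rfl]
    · simp only [Function.update_of_ne hk, h.own j hj]

/-- An iteration restores the agreement with which it began: both the shares that `i₀` holds and the
shares of its coefficients held by parties other than `j₀` are updated with agreeing gradient
shares. -/
theorem leads_iter (hj₀ : j₀ ≠ i₀) {l₁ l₂ : List (Fin n)}
    (hl : List.finRange n = l₁ ++ j₀ :: l₂) (hl₂ : ∀ i ∈ l₂, i = i₀) :
    Leads κ a X' w' y' S i₀ (iterSteps n)
      (fun x x' => AgreeBase i₀ j₀ x x' ∧ x.z i₀ = x'.z i₀ ∧ x.G = x'.G ∧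
        (i₀ = a.owner → x.yB = x'.yB)) (AgreeBase i₀ j₀) := by
  refine .cons ?_ (.append (leads_pred_steps hj₀ hl hl₂)
    (.cons ?_ ((leads_grad_steps hj₀).append ?_)))
  · refine .of_step fun x x' L ⟨h, hz, hG, hy⟩ => ?_
    refine Coupled.map (Coupled.map (coupled_share (i := a.owner) (v := x.yB) (v' := x'.yB) hy)
      (R' := fun r r' => SameLog κ a X' w' y' (AgreePred i₀ j₀ ∅)
        (r.1, r.2 :: L) (r'.1, r'.2 :: L)) fun s s' hs => ?_) fun r r' hr => hr
    exact ⟨{ x with y := s }, { x' with y := s' }, shareEntry i₀ a.owner s :: L, rfl,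
      by rw [shareEntry_congr hs]; rfl, ⟨h.XB, h.seen, h.own⟩, hs.1, hG, hz, fun j hj => hj.elim⟩
  · refine leads_local (fun x => { x with z := fun j => x.z j - x.y j }) (fun _ => rfl)
      (fun _ => rfl) fun x x' h => ⟨⟨h.XB, h.seen, h.own⟩, fun j hj => h.err j trivial hj,
        fun k => by rw [h.G], fun j _ => by rw [h.G]⟩
  · refine leads_local (fun x => { x with W := fun i j => x.W i j - a.rate • x.G i j })
      (fun _ => rfl) (fun _ => rfl) fun x x' h => ⟨h.XB, fun k => ?_, fun j hj => ?_⟩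
    · simp only [h.seen, h.seenG]
    · simp only [h.own j hj, h.ownG j hj]

theorem coupled_loop (hX : a.X i₀ = X' i₀) (hy : i₀ = a.owner → a.y = y') (hj₀ : j₀ ≠ i₀)
    {l₁ l₂ : List (Fin n)} (hl : List.finRange n = l₁ ++ j₀ :: l₂) (hl₂ : ∀ i ∈ l₂, i = i₀)
    {k : ℕ} (hk : k ≤ a.T) {s s' : St n} (h : SameLog κ a X' w' y' (AgreeBase i₀ j₀) s s') :
    Coupled (SameLog κ a X' w' y' (AgreeBase i₀ j₀)) (execLoop (idealSample S) i₀ k s)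
      (execLoop (idealSample S) i₀ k s') := by
  induction k generalizing s s' with
  | zero => exact .pure h
  | succ k ih =>
    refine Coupled.bind ?_ fun s s' => ih (by omega)
    obtain ⟨x, x', L, rfl, rfl, h⟩ := h
    refine leads_iter hj₀ hl hl₂ _ _ ?_
    rw [St.load, St.load, dif_pos (show k < (x.core κ a, L).1.a.T from hk),
      dif_pos (show k < (Vars.core κ (a.withData X' w' y') x', L).1.a.T from hk)]
    refine ⟨⟨fun i => a.XB i (Fin.rev ⟨k, hk⟩), a.yB (Fin.rev ⟨k, hk⟩), x.W, 0, 0, 0⟩,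
      ⟨fun i => (a.withData X' w' y').XB i (Fin.rev ⟨k, hk⟩),
        (a.withData X' w' y').yB (Fin.rev ⟨k, hk⟩), x'.W, 0, 0, 0⟩, L, rfl, rfl,
      ⟨?_, h.seen, h.own⟩, rfl, rfl, fun ho => ?_⟩
    · simp only [Regression.XB, hX]
    · unfold Regression.yB
      rw [hy ho]

theorem coupled_final (hX : a.X i₀ = X' i₀) (hw : a.w₀ i₀ = w' i₀)
    (hy : i₀ = a.owner → a.y = y') (hj₀ : j₀ ≠ i₀)
    {l₁ l₂ : List (Fin n)} (hl : List.finRange n = l₁ ++ j₀ :: l₂) (hl₂ : ∀ i ∈ l₂, i = i₀) :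
    Coupled (SameLog κ a X' w' y' (AgreeBase i₀ j₀)) (finalSt (idealSample S) i₀ κ a)
      (finalSt (idealSample S) i₀ κ (a.withData X' w' y')) := by
  refine Coupled.bind (Leads.map (fun i _ => leads_distW hw i) _ _
    ⟨⟨0, 0, 0, 0, 0, 0⟩, ⟨0, 0, 0, 0, 0, 0⟩, [], rfl, rfl, rfl, fun _ => rfl, fun _ _ => rfl⟩)
    fun s s' h => coupled_loop hX hy hj₀ hl hl₂ le_rfl h

end Coupling

end Regression

namespace Regression

variable {n : ℕ}

/-! ## The protocol and its sequence of steps -/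

section Link

variable {smp : Fin 2 → ℕ → MatMulInstance → PMF Val} {i₀ : Fin n} {κ : ℕ} {a : Regression n}
  {π : TwoPartyProtocol}

/-- Turns a loop of the protocol into a block of the step sequence; the invariant is the relation
itself. -/
theorem coupled_foldlM {A ι : Type} {R : A → St n → Prop} {l : List ι} {f : A → ι → PMF A}
    {g : ι → List (Step n)}
    (h : ∀ i ∈ l, ∀ x s, R x s → Coupled R (f x i) (execSteps smp i₀ (g i) s)) {x : A} {s : St n}
    (hx : R x s) : Coupled R (l.foldlM f x) (execSteps smp i₀ (l.flatMap g) s) := by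
  induction l generalizing x s with
  | nil => exact .pure hx
  | cons i l ih =>
    rw [List.foldlM_cons, List.flatMap_cons, execSteps_append]
    exact (h i (by simp) x s hx).bind fun x s hx => ih (fun j hj => h j (by simp [hj])) hx

theorem execSteps_singleton (st : Step n) (s : St n) :
    execSteps smp i₀ [st] s = st.execLog smp i₀ s :=
  PMF.bind_pure _

theorem coupled_distribute {p D : ℕ} [NeZero p] (i : Fin n) (v : Fin D → ZMod p) (L : Log n) :
    Coupled (fun q s => q.1 = s ∧ q.2 i₀ = shareEntry i₀ i s :: L i₀) (distribute i v L)
      (share i v) := by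
  refine Coupled.bind (Coupled.refl _) ?_
  rintro r _ rfl
  exact .pure ⟨rfl, rfl⟩

/-- A single sample contains the outputs of both parties but the view of one role only. That
suffices because the log of a single party is tracked, and this party has at most one role when `i ≠
j`. -/
theorem coupled_multiply {p r s c : ℕ} (hp : p.Prime) {i j : Fin n} (hij : i ≠ j)
    (A : Matrix (Fin r) (Fin s) (ZMod p)) (B : Matrix (Fin s) (Fin c) (ZMod p)) (L : Log n) :
    Coupled (fun o v => o.1 = decMat p r c (v.nth 1) ∧ o.2.1 = decMat p r c (v.nth 2) ∧
        o.2.2 i₀ = if i₀ = i ∨ i₀ = j then v.nth 0 :: L i₀ else L i₀)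
      (multiply π κ i j A B L)
      (realSample π (if i₀ = j then 1 else 0) κ ⟨p, hp, r, s, c, A, B⟩) := by
  refine Coupled.bind (Coupled.refl _) ?_
  rintro o _ rfl
  refine .pure ⟨rfl, rfl, ?_⟩
  by_cases hj : i₀ = j
  · subst hj
    simp only [or_true, if_true, Log.record, Function.update_self, Function.update_of_ne hij.symm]
    rfl
  · by_cases hi : i₀ = i
    · subst hi
      simp only [true_or, if_true, Log.record, Function.update_self, Function.update_of_ne hj,
        if_neg hj]
      rfl
    · simp only [hi, hj, or_self, if_false, Log.record, Function.update_of_ne hi,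
        Function.update_of_ne hj]

theorem coupled_shareWeights :
    Coupled (fun q s => ∃ x : Vars n a.p a.b a.d, s = (x.core κ a, q.2 i₀) ∧ x.W = q.1)
      a.shareWeights (execSteps smp i₀ (initSteps n) (Core.init κ a, [])) := by
  rw [initSteps, List.map_eq_flatMap]
  refine coupled_foldlM (fun i _ q s hq => ?_) ⟨⟨0, 0, 0, 0, 0, 0⟩, rfl, rfl⟩
  obtain ⟨x, rfl, hx⟩ := hq
  rw [execSteps_singleton, Step.execLog, Step.exec, PMF.map_comp]
  refine Coupled.bind (coupled_distribute (i₀ := i₀) i (a.w₀ i) q.2) fun r s hr => .pure ?_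
  obtain ⟨rfl, hr⟩ := hr
  exact ⟨{ x with W := Function.update x.W i r.1 }, Prod.ext rfl hr.symm, by rw [← hx]⟩

theorem coupled_predict (t : Fin a.T) (x : Vars n a.p a.b a.d) (hX : x.XB = fun i => a.XB i t)
    (hz : x.z = 0) (L : Log n) :
    Coupled (fun q s => s = (Vars.core κ a { x with z := q.1 }, q.2 i₀))
      (a.predict π κ t x.W L) (execSteps (realSample π) i₀ (predSteps n) (x.core κ a, L i₀)) := by
  obtain ⟨XB, yB, W, y, z, G⟩ := x
  subst hX hz
  refine coupled_foldlM (fun i _ q s hq => ?_) rfl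
  subst hq
  rw [show ∀ st : Step n, ∀ l, st :: l = [st] ++ l from fun _ _ => rfl, execSteps_append,
    execSteps_singleton, Step.execLog]
  have e : (Step.localP i).exec (realSample π) i₀ (Vars.core κ a ⟨fun i => a.XB i t, yB, W, y, q.1, G⟩) =
    PMF.pure (Vars.core κ a ⟨fun i => a.XB i t, yB, W, y,
      Function.update q.1 i (q.1 i + a.XB i t *ᵥ W i i), G⟩, .num 0) := rfl
  rw [e, PMF.pure_map, PMF.pure_bind, List.map_eq_flatMap]
  refine coupled_foldlM (fun j _ q s hq => ?_) rfl
  subst hq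
  rw [execSteps_singleton, Step.execLog]
  by_cases hij : i = j
  · rw [if_pos hij.symm, exec_call_of_eq (by exact hij), PMF.pure_map]
    refine .pure ?_
    simp [Step.logs, Call.fst, Call.snd, hij]
  · rw [if_neg (Ne.symm hij), exec_call_of_ne (by exact hij), PMF.map_comp]
    have := coupled_multiply (π := π) (κ := κ) (i₀ := i₀) a.prime hij (a.XB i t)
      (Matrix.replicateCol (Fin 1) (W i j)) q.2
    refine Coupled.bind this fun o v ho => .pure ?_
    obtain ⟨h₁, h₂, h₃⟩ := ho
    rw [h₁, h₂, h₃]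
    refine Prod.ext rfl ?_
    simp [Step.logs, Call.fst, Call.snd, hij]

theorem coupled_gradient (t : Fin a.T) (x : Vars n a.p a.b a.d) (hX : x.XB = fun i => a.XB i t)
    (hG : x.G = 0) (L : Log n) :
    Coupled (fun q s => s = (Vars.core κ a { x with G := q.1 }, q.2 i₀))
      (a.gradient π κ t x.z L) (execSteps (realSample π) i₀ (gradSteps n) (x.core κ a, L i₀)) := by
  obtain ⟨XB, yB, W, y, z, G⟩ := x
  subst hX hG
  refine coupled_foldlM (fun i _ q s hq => ?_) rfl
  subst hq
  rw [show ∀ st : Step n, ∀ l, st :: l = [st] ++ l from fun _ _ => rfl, execSteps_append,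
    execSteps_singleton, Step.execLog]
  have e : (Step.localG i).exec (realSample π) i₀ (Vars.core κ a ⟨fun i => a.XB i t, yB, W, y, z, q.1⟩) =
    PMF.pure (Vars.core κ a ⟨fun i => a.XB i t, yB, W, y, z,
      q.1 + Pi.single i (Pi.single i (z i ᵥ* a.XB i t))⟩, .num 0) := rfl
  rw [e, PMF.pure_map, PMF.pure_bind, List.map_eq_flatMap]
  refine coupled_foldlM (fun j _ q s hq => ?_) rfl
  subst hq
  rw [execSteps_singleton, Step.execLog]
  by_cases hij : i = j
  · rw [if_pos hij.symm, exec_call_of_eq (by exact hij), PMF.pure_map]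
    refine .pure ?_
    simp [Step.logs, Call.fst, Call.snd, hij]
  · rw [if_neg (Ne.symm hij), exec_call_of_ne (by exact hij), PMF.map_comp]
    have := coupled_multiply (π := π) (κ := κ) (i₀ := i₀) a.prime hij
      (Matrix.replicateRow (Fin 1) (z i)) (a.XB j t) q.2
    refine Coupled.bind this fun o v ho => .pure ?_
    obtain ⟨h₁, h₂, h₃⟩ := ho
    rw [h₁, h₂, h₃]
    refine Prod.ext rfl ?_
    simp [Step.logs, Call.fst, Call.snd, hij]

/-- The state of the step sequence that corresponds to a state of the protocol. -/
def Represents (i₀ : Fin n) (κ : ℕ) (a : Regression n) (q : a.Shares × Log n) (s : St n) : Prop :=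
  ∃ x : Vars n a.p a.b a.d, s = (x.core κ a, q.2 i₀) ∧ x.W = q.1

theorem coupled_iteration {q : a.Shares × Log n} {x : Vars n a.p a.b a.d} (hx : x.W = q.1)
    (t : Fin a.T) :
    Coupled (Represents i₀ κ a) (a.iteration π κ q t)
      (execSteps (realSample π) i₀ (iterSteps n) ((x.core κ a).load t, q.2 i₀)) := by
  obtain ⟨W, L⟩ := q
  subst hx
  rw [iterSteps, execSteps, Step.execLog, Step.exec, PMF.map_comp, PMF.bind_map]
  refine Coupled.bind (coupled_distribute (i₀ := i₀) a.owner (a.yB t) L) fun y s hy => ?_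
  obtain ⟨rfl, hy⟩ := hy
  change Coupled _ _ (execSteps (realSample π) i₀ (predSteps n ++ _)
    (Vars.core κ a ⟨fun i => a.XB i t, a.yB t, x.W, y.1, 0, 0⟩, shareEntry i₀ a.owner y.1 :: L i₀))
  rw [execSteps_append]
  have h₁ := coupled_predict (π := π) (κ := κ) (i₀ := i₀) t
    ⟨fun i => a.XB i t, a.yB t, x.W, y.1, 0, 0⟩ rfl rfl y.2
  rw [hy] at h₁
  refine Coupled.bind h₁ ?_
  rintro z _ rfl
  rw [execSteps, Step.execLog, Step.exec, PMF.pure_map, PMF.pure_bind, execSteps_append]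
  refine Coupled.bind (coupled_gradient (π := π) (κ := κ) (i₀ := i₀) t
    ⟨fun i => a.XB i t, a.yB t, x.W, y.1, fun j => z.1 j - y.1 j, 0⟩ rfl rfl z.2) ?_
  rintro g _ rfl
  rw [execSteps_singleton, Step.execLog, Step.exec, PMF.pure_map]
  exact .pure ⟨⟨fun i => a.XB i t, a.yB t, fun i j => x.W i j - a.rate • g.1 i j, y.1,
    fun j => z.1 j - y.1 j, g.1⟩, rfl, rfl⟩

theorem coupled_iterations {k : ℕ} (hk : k ≤ a.T) {q : a.Shares × Log n} {s : St n}
    (h : Represents i₀ κ a q s) :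
    Coupled (Represents i₀ κ a)
      (((List.finRange a.T).drop (a.T - k)).foldlM (a.iteration π κ) q)
      (execLoop (realSample π) i₀ k s) := by
  induction k generalizing q s with
  | zero =>
    rw [Nat.sub_zero, List.drop_eq_nil_of_le (by simp)]
    exact .pure h
  | succ k ih =>
    obtain ⟨x, rfl, hx⟩ := h
    rw [drop_finRange hk, List.foldlM_cons, execLoop, St.load,
      dif_pos (show k < (x.core κ a, q.2 i₀).1.a.T from hk)]
    exact (coupled_iteration hx _).bind fun q s h => ih (by omega) h

theorem reveal_inner (W : a.Shares) (i k : Fin n) (l : List (Fin n)) (L : Log n) :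
    (l.foldl (fun L j => if j = i then L else Log.record L i (encVec (W i j))) L) k =
      if k = i then ((l.filter (· ≠ i)).map fun j => encVec (W i j)).reverse ++ L i else L k := by
  induction l generalizing L with
  | nil =>
    by_cases h : k = i
    · subst h; simp
    · simp [h]
  | cons j l ih =>
    rw [List.foldl_cons, ih]
    by_cases hj : j = i
    · simp [hj]
    · by_cases hk : k = i
      · simp [hk, hj, Log.record]
      · simp [hk, hj, Log.record]

/-- The messages that party `i` receives at the end, most recent first. -/
def revealed (W : a.Shares) (i : Fin n) : List Val :=
  (((List.finRange n).filter (· ≠ i)).map fun j => encVec (W i j)).reverse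

theorem reveal_apply (W : a.Shares) (L : Log n) (i : Fin n) :
    a.reveal W L i = revealed W i ++ L i := by
  have key : ∀ (l : List (Fin n)), l.Nodup → ∀ L : Log n, (l.foldl (fun L i =>
      (List.finRange n).foldl (fun L j => if j = i then L else Log.record L i (encVec (W i j))) L)
        L) i = if i ∈ l then revealed W i ++ L i else L i := by
    intro l
    induction l with
    | nil => simp
    | cons j l ih =>
      intro hl L
      rw [List.nodup_cons] at hl
      rw [List.foldl_cons, ih hl.2, reveal_inner]
      by_cases hj : i = j
      · subst hj
        simp [hl.1, revealed]
      · simp [hj]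
  have := key _ (List.nodup_finRange n) L
  rwa [if_pos (List.mem_finRange i)] at this

/-- Links the protocol as defined with the step sequence. The last messages are not steps: they are
functions of the final shares and are added when the view is formed. -/
theorem coupled_exec :
    Coupled (fun o s => ∃ (x : Vars n a.p a.b a.d) (L : List Val), s = (x.core κ a, L) ∧
        (o i₀).1 = Val.pair (Val.unary κ) (Val.pair (a.input i₀)
          (Val.list (revealed (a := a) x.W i₀ ++ L))) ∧
        ∀ i, (o i).2 = encVec (∑ j, x.W i j))
      (a.exec π κ) (finalSt (realSample π) i₀ κ a) := by
  refine Coupled.bind coupled_shareWeights fun q s h => ?_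
  have := coupled_iterations (π := π) le_rfl h
  rw [Nat.sub_self, List.drop_zero] at this
  -- Makes room on the right for a step matching the formation of views and outputs on the left.
  rw [← PMF.bind_pure (execLoop _ _ _ _)]
  refine Coupled.bind this fun q s h => ?_
  obtain ⟨x, rfl, hx⟩ := h
  refine .pure ⟨x, _, rfl, ?_, fun i => by rw [hx]⟩
  dsimp only
  rw [hx, reveal_apply]

end Link

end Regression

namespace Regression

variable {n : ℕ}

/-! ## The simulator -/

/-- The instance in which the data unknown to party `i₀` are replaced by zeros. -/
def dummy (i₀ : Fin n) (a : Regression n) : Regression n :=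
  a.withData (fun i => if i = i₀ then a.X i else 0) (fun i => if i = i₀ then a.w₀ i else 0)
    (if i₀ = a.owner then a.y else 0)

theorem input_dummy (i₀ : Fin n) (a : Regression n) : (a.dummy i₀).input i₀ = a.input i₀ := by
  have hX : encMat ((a.dummy i₀).X i₀) = encMat (a.X i₀) :=
    congrArg (encMat (p := a.p)) (if_pos rfl)
  have hw : encVec ((a.dummy i₀).w₀ i₀) = encVec (a.w₀ i₀) :=
    congrArg (encVec (p := a.p)) (if_pos rfl)
  have hy : (if i₀ = a.owner then encVec (a.dummy i₀).y else Val.num 0) =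
      if i₀ = a.owner then encVec a.y else Val.num 0 := by
    split
    · exact congrArg (encVec (p := a.p)) (if_pos ‹_›)
    · rfl
  rw [input, input, hX, hw]
  change Val.list [a.pub, _, _, if i₀ = a.owner then encVec (a.dummy i₀).y else Val.num 0] = _
  rw [hy]

/-- The row index at position `r` of the batch `k`, counted from the end, from the input of a
party. -/
def rowIndex (inp : Val) (k r : ℕ) : ℕ :=
  min ((((inp.nth 0).nth 4).nth (min (((inp.nth 0).nth 4).length - 1 - k)
    ((inp.nth 0).nth 4).length)).entry r) ((inp.nth 0).nth 1).length

/-- Row indices are written in binary, while positions in a list are needed in unary. The caps make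
the conversion possible and have no effect on genuine inputs. -/
theorem poly_rowIndex {f : Val → Val} {k r : Val → ℕ} (hf : PolyFun f) (hk : PolyUnary k)
    (hr : PolyUnary r) : PolyUnary fun x => rowIndex (f x) (k x) (r x) :=
  have hb : PolyFun fun x => ((f x).nth 0).nth 4 := (hf.nthConst 0).nthConst 4
  .min (PolyNat.entry (hb.nth (.min (((PolyUnary.length hb).nat.sub (.const 1)).sub hk.nat)
    (.length hb))) hr) (.length ((hf.nthConst 0).nthConst 1))

theorem rowIndex_input (i₀ : Fin n) (a : Regression n) (t : Fin a.T) (r : Fin a.b) :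
    rowIndex (a.input i₀) t r = a.batch t.rev r := by
  have h : ((a.input i₀).nth 0).nth 4 =
    Val.list (List.ofFn fun t => Val.list (List.ofFn fun r => Val.num (a.batch t r))) := rfl
  have h' : ((a.input i₀).nth 0).nth 1 = Val.unary a.m := rfl
  have ht : min (a.T - 1 - t) a.T = (t.rev : ℕ) := by rw [Fin.val_rev]; omega
  rw [rowIndex, h, h', Val.length_list, Val.length_unary, List.length_ofFn, ht, Val.nth_list_ofFn,
    Val.entry, Val.nth_list_ofFn, Val.toNat_num]
  exact min_eq_left (a.batch t.rev r).2.le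

def zeroVec (p d : ℕ) : Val := tabMod p d fun _ => 0

theorem poly_zeroVec {p d : Val → ℕ} (hp : PolyNat p) (hd : PolyUnary d) :
    PolyFun fun x => zeroVec (p x) (d x) := .tabMod hp hd (.const 0)

theorem zeroVec_eq (p d : ℕ) [NeZero p] : zeroVec p d = encVec (0 : Fin d → ZMod p) :=
  tabMod_eq_encVec _ _ fun _ => by simp

/-- The features of party `i` in the dummy batch `k`, counted from the end. -/
def dummyX (i₀ i : Fin n) (inp : Val) (k : ℕ) : Val :=
  Val.tab ((inp.nth 0).nth 3).length fun r => if i = i₀ then (inp.nth 1).nth (rowIndex inp k r) else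
    zeroVec ((inp.nth 0).entry 0) (((inp.nth 0).nth 2).nth i).length

def dummyY (inp : Val) (k : ℕ) : Val :=
  tabMod ((inp.nth 0).entry 0) ((inp.nth 0).nth 3).length fun r =>
    (inp.nth 3).entry (rowIndex inp k r)

def dummyW (i₀ i : Fin n) (inp : Val) : Val := if i = i₀ then inp.nth 2 else
  zeroVec ((inp.nth 0).entry 0) (((inp.nth 0).nth 2).nth i).length

section

variable {f : Val → Val} {k : Val → ℕ} (hf : PolyFun f) (hk : PolyUnary k) (i₀ i : Fin n)
include hf

theorem poly_dummyW : PolyFun fun x => dummyW i₀ i (f x) :=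
  .ite_prop (hf.nthConst 2) (poly_zeroVec (PolyNat.entryConst (hf.nthConst 0) 0)
    (.length (((hf.nthConst 0).nthConst 2).nthConst i)))

include hk

theorem poly_dummyX : PolyFun fun x => dummyX i₀ i (f x) (k x) :=
  have hf' : PolyFun fun y => f y.fst := hf.comp PolyFun.id.fst
  .tab (.length ((hf.nthConst 0).nthConst 3))
    (.ite_prop ((hf'.nthConst 1).nth (poly_rowIndex hf' (hk.comp PolyFun.id.fst)
      (.length PolyFun.id.snd))) (poly_zeroVec (PolyNat.entryConst (hf'.nthConst 0) 0)
        (.length (((hf'.nthConst 0).nthConst 2).nthConst i))))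

theorem poly_dummyY : PolyFun fun x => dummyY (f x) (k x) :=
  have hf' : PolyFun fun y => f y.fst := hf.comp PolyFun.id.fst
  .tabMod (PolyNat.entryConst (hf.nthConst 0) 0) (.length ((hf.nthConst 0).nthConst 3))
    (PolyNat.entry (hf'.nthConst 3) (poly_rowIndex hf' (hk.comp PolyFun.id.fst)
      (.length PolyFun.id.snd)))

end

section

variable (i₀ i : Fin n) (a : Regression n)

theorem length_dims_input : ((((a.input i₀).nth 0).nth 2).nth i).length = a.d i := by
  have h : (((a.input i₀).nth 0).nth 2).nth i = Val.unary (a.d i) := Val.nth_list_ofFn _ i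
  rw [h, Val.length_unary]

theorem length_batch_input : (((a.input i₀).nth 0).nth 3).length = a.b := Val.length_unary _

theorem dummyX_input (t : Fin a.T) :
    dummyX i₀ i (a.input i₀) t = encMat ((a.dummy i₀).XB i t.rev) := by
  rw [dummyX, length_batch_input, length_dims_input, Val.tab, encMat]
  congr 2
  funext r
  rw [rowIndex_input]
  by_cases hi : i = i₀
  · subst hi
    rw [if_pos rfl]
    refine (nth_encMat (a.X i) _).trans ?_
    simp [XB, dummy, Matrix.submatrix]
    rfl
  · rw [if_neg hi]
    refine (zeroVec_eq a.p _).trans ?_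
    simp [XB, dummy, Matrix.submatrix, hi]
    rfl

/-- For a party without labels the last input is the number `0`, all of whose entries read as `0`.
This is exactly the dummy label vector, so no case distinction is needed in the program. -/
theorem dummyY_input (t : Fin a.T) : dummyY (a.input i₀) t = encVec ((a.dummy i₀).yB t.rev) := by
  rw [dummyY, length_batch_input]
  refine tabMod_eq_encVec (p := a.p) _ _ fun r => ?_
  rw [rowIndex_input]
  have h : (a.input i₀).nth 3 = if i₀ = a.owner then encVec a.y else Val.num 0 := rfl
  rw [h]
  by_cases ho : i₀ = a.owner
  · simp [ho, yB, dummy]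
  · simp [ho, yB, dummy, Val.entry, nth_num_zero]

theorem dummyW_input : dummyW i₀ i (a.input i₀) = encVec ((a.dummy i₀).w₀ i) := by
  rw [dummyW, length_dims_input]
  by_cases hi : i = i₀
  · subst hi
    simp only [dummy, if_true]
    rfl
  · rw [if_neg hi]
    refine (zeroVec_eq a.p _).trans ?_
    simp [dummy, hi]

end

/-- The environment of the dummy instance, from the input of party `i₀`. -/
def dummyEnv (i₀ : Fin n) (u inp : Val) : Val :=
  Val.list [u, inp, Val.num ((inp.nth 0).entry 0), (inp.nth 0).nth 2, (inp.nth 0).nth 3,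
    Val.num ((inp.nth 0).entry 6),
    -- With truncated subtraction, this is the indicator of equality of `i` and the owner.
    Val.list (List.ofFn fun i : Fin n => Val.num (1 - (((inp.nth 0).entry 7 - i) +
      (i - (inp.nth 0).entry 7)))),
    Val.list (List.ofFn fun i => dummyW i₀ i inp),
    Val.tab ((inp.nth 0).nth 4).length fun k =>
      Val.pair (Val.list (List.ofFn fun i => dummyX i₀ i inp k)) (dummyY inp k)]

theorem poly_dummyEnv {f g : Val → Val} (hf : PolyFun f) (hg : PolyFun g) (i₀ : Fin n) :
    PolyFun fun x => dummyEnv i₀ (f x) (g x) :=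
  have hp : PolyFun fun x => (g x).nth 0 := hg.nthConst 0
  have hg' : PolyFun fun y => g y.fst := hg.comp PolyFun.id.fst
  hf.pair (hg.pair ((PolyNat.entryConst hp 0).num.pair ((hp.nthConst 2).pair ((hp.nthConst 3).pair
    ((PolyNat.entryConst hp 6).num.pair ((PolyFun.list_ofFn fun i =>
      (((PolyNat.const 1).sub (((PolyNat.entryConst hp 7).sub (.const i)).add
        ((PolyNat.const i).sub (PolyNat.entryConst hp 7)))).num)).pair
    ((PolyFun.list_ofFn fun i => poly_dummyW hg i₀ i).pair ((PolyFun.tab (.length (hp.nthConst 4))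
      ((PolyFun.list_ofFn fun i => poly_dummyX hg' (.length PolyFun.id.snd) i₀ i).pair
        (poly_dummyY hg' (.length PolyFun.id.snd)))).pair (.constNum 0)))))))))

theorem dummyEnv_enc (i₀ : Fin n) (κ : ℕ) (a : Regression n) :
    dummyEnv i₀ (Val.unary κ) (a.input i₀) = encEnv i₀ κ (a.dummy i₀) := by
  have h₁ : (Val.list (List.ofFn fun i : Fin n => Val.num (1 -
      ((((a.input i₀).nth 0).entry 7 - i) + (i - ((a.input i₀).nth 0).entry 7))))) =
      Val.list (List.ofFn fun i => Val.num (if i = a.owner then 1 else 0)) := by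
    congr 2
    funext i
    have h : ((a.input i₀).nth 0).entry 7 = a.owner := rfl
    rw [h]
    congr 1
    split
    · simp_all
    · have : (i : ℕ) ≠ a.owner := fun h => ‹¬ _› (Fin.ext h)
      omega
  have hT : (((a.input i₀).nth 0).nth 4).length = a.T := by
    have h : ((a.input i₀).nth 0).nth 4 =
      Val.list (List.ofFn fun t => Val.list (List.ofFn fun r => Val.num (a.batch t r))) := rfl
    rw [h]; simp
  rw [dummyEnv, h₁, hT, encEnv, input_dummy, Val.tab]
  simp only [dummyX_input, dummyY_input, dummyW_input]
  rfl

/-- The initial state, from the environment. -/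
def initV (n : ℕ) (env : Val) : Val :=
  Val.pair (Val.list [env,
    Val.pair (Val.list (List.ofFn fun i : Fin n => Val.tab (env.nth 4).length fun _ =>
      zeroVec (env.entry 2) ((env.nth 3).nth i).length)) (zeroVec (env.entry 2) (env.nth 4).length),
    normShares n env (Val.num 0), normFam n env (Val.num 0), normFam n env (Val.num 0),
    normShares n env (Val.num 0)]) (Val.num 0)

theorem poly_initV {f : Val → Val} (hf : PolyFun f) : PolyFun fun x => initV n (f x) :=
  have hf' : PolyFun fun y => f y.fst := hf.comp PolyFun.id.fst
  (PolyFun.list6 hf ((PolyFun.list_ofFn fun i => .tab (.length (hf.nthConst 4))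
    (poly_zeroVec (PolyNat.entryConst hf' 2) (.length ((hf'.nthConst 3).nthConst i)))).pair
      (poly_zeroVec (PolyNat.entryConst hf 2) (.length (hf.nthConst 4))))
    (poly_normShares hf (.constNum 0)) (poly_normFam hf (.constNum 0))
    (poly_normFam hf (.constNum 0)) (poly_normShares hf (.constNum 0))).pair (.constNum 0)

theorem initV_enc (i₀ : Fin n) (κ : ℕ) (a : Regression n) :
    initV n (encEnv i₀ κ a) = encSt i₀ (Core.init κ a, []) := by
  have hS : normShares n (encEnv i₀ κ a) (Val.num 0) = encShares (0 : a.Shares) :=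
    normShares_enc _ _ _ _ _ fun i j r => by simp [nth_num_zero, Val.entry]
  have hd : ∀ i : Fin n, (((encEnv i₀ κ a).nth 3).nth i).length = a.d i := fun i => by
    have h : ((encEnv i₀ κ a).nth 3).nth i = Val.unary (a.d i) := Val.nth_list_ofFn _ i
    rw [h, Val.length_unary]
  have hb : ((encEnv i₀ κ a).nth 4).length = a.b := Val.length_unary _
  have hp : (encEnv i₀ κ a).entry 2 = a.p := rfl
  rw [initV, hS, normFam_enc_zero]
  simp only [hd, hb, hp, zeroVec_eq]
  rfl

/-! ### The view -/

/-- The parties other than `i₀`, in the order in which their last messages appear in the log. -/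
def others (i₀ : Fin n) : List (Fin n) := ((List.finRange n).filter (· ≠ i₀)).reverse

def prepend (l : List (Fin n)) (g : Fin n → Val) (v : Val) : Val :=
  l.foldr (fun j v => Val.pair (g j) v) v

theorem poly_prepend (l : List (Fin n)) {g : Fin n → Val → Val} {v : Val → Val}
    (hg : ∀ j, PolyFun (g j)) (hv : PolyFun v) :
    PolyFun fun x => prepend l (fun j => g j x) (v x) := by
  induction l with
  | nil => exact hv
  | cons j l ih => exact (hg j).pair ih

theorem prepend_list (l : List (Fin n)) (g : Fin n → Val) (L : List Val) :
    prepend l g (Val.list L) = Val.list (l.map g ++ L) := by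
  induction l with
  | nil => rfl
  | cons j l ih => exact congrArg (Val.pair (g j)) ih

/-- The view of party `i₀` for a final state, with `g j` as the last message of party `j`. -/
def viewV (i₀ : Fin n) (g : Fin n → Val) (x : Val) : Val :=
  Val.pair ((x.fst.nth 0).nth 0) (Val.pair ((x.fst.nth 0).nth 1) (prepend (others i₀) g x.snd))

theorem poly_viewV (i₀ : Fin n) {g : Fin n → Val → Val} {f : Val → Val}
    (hg : ∀ j, PolyFun (g j)) (hf : PolyFun f) :
    PolyFun fun x => viewV i₀ (fun j => g j x) (f x) :=
  ((hf.fst.nthConst 0).nthConst 0).pair (((hf.fst.nthConst 0).nthConst 1).pair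
    (poly_prepend _ hg hf.snd))

theorem viewV_enc (i₀ : Fin n) (g : Fin n → Val) (c : Core n) (L : List Val) :
    viewV i₀ g (encSt i₀ (c, L)) = Val.pair (Val.unary c.κ) (Val.pair (c.a.input i₀)
      (Val.list ((others i₀).map g ++ L))) := by
  rw [← prepend_list]
  rfl

/-- The last message of party `j` in the simulated view: the share of `j₀` is determined by the
output `f` of party `i₀` and the other shares. -/
def simReveal (i₀ j₀ : Fin n) (f x : Val) (j : Fin n) : Val :=
  if j = j₀ then tabMod (Read.p x) (Read.d x i₀) fun k =>
    f.entry k + (Read.p x - 1) * ∑ l ∈ Finset.univ.erase j₀, (Read.W x i₀ l).entry k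
  else Read.W x i₀ j

theorem poly_simReveal (i₀ j₀ j : Fin n) {f g : Val → Val} (hf : PolyFun f) (hg : PolyFun g) :
    PolyFun fun x => simReveal i₀ j₀ (f x) (g x) j :=
  have hg' : PolyFun fun y => g y.fst := hg.comp PolyFun.id.fst
  .ite_prop (.tabMod (Read.poly_p hg) (Read.poly_d hg i₀)
    ((PolyNat.entry (hf.comp PolyFun.id.fst) (.length PolyFun.id.snd)).add
      (((Read.poly_p hg').sub (.const 1)).mul (PolyNat.finset_sum _ fun l =>
        PolyNat.entry (Read.poly_W hg' i₀ l) (.length PolyFun.id.snd)))))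
    (Read.poly_W hg i₀ j)

theorem simReveal_enc (i₀ j₀ j : Fin n) (κ : ℕ) (a : Regression n) (x : Vars n a.p a.b a.d)
    (v : Fin (a.d i₀) → ZMod a.p) :
    simReveal i₀ j₀ (encVec v) (encCore i₀ (x.core κ a)) j =
      encVec (if j = j₀ then v - ∑ l ∈ Finset.univ.erase j₀, x.W i₀ l else x.W i₀ j) := by
  unfold simReveal
  split
  · rw [Read.p_enc, Read.d_enc]
    refine tabMod_eq_encVec (p := a.p) _ _ fun k => ?_
    change Fin (a.d i₀) at k
    change ((((encVec v).entry k + (a.p - 1) * ∑ l ∈ Finset.univ.erase j₀,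
      (Read.W (encCore i₀ (x.core κ a)) i₀ l).entry k : ℕ)) : ZMod a.p) = _
    have h : ∀ l, (Read.W (encCore i₀ (x.core κ a)) i₀ l).entry k = (x.W i₀ l k).val := fun l => by
      rw [Read.W_enc]
      exact entry_encVec (x.W i₀ l) k
    simp only [h]
    rw [Nat.cast_add, Nat.cast_mul, natCast_pred, Nat.cast_sum, entry_encVec]
    simp only [ZMod.natCast_val, ZMod.cast_id', id, Pi.sub_apply, Finset.sum_apply]
    ring
  · exact Read.W_enc _ _ _ _

/-- The simulated view from the simulated final state. -/
def simView (i₀ j₀ : Fin n) (f x : Val) : Val := viewV i₀ (simReveal i₀ j₀ f x.fst) x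

/-- The simulator: run the ideal execution on the dummy instance. -/
def simV (S : Fin 2 → Prog) (i₀ j₀ : Fin n) (u : Val) : PMF Val :=
  ((stepsV S i₀ (initSteps n) (initV n (dummyEnv i₀ u.fst u.snd.fst))).bind
    (loopV S i₀ (dummyEnv i₀ u.fst u.snd.fst) ((u.snd.fst.nth 0).nth 4).length)).map
      (simView i₀ j₀ u.snd.snd)

theorem poly_simV {S : Fin 2 → Prog} (hS : ∀ i, (S i).PolyTime) (i₀ j₀ : Fin n) :
    PolyKernel (simV S i₀ j₀) := by
  have hx : PolyFun fun x => x := PolyFun.id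
  refine PolyKernel.bindPure (PolyKernel.bind' ((poly_stepsV hS i₀ _).comp
    (poly_initV (poly_dummyEnv hx.fst hx.snd.fst i₀))) ?_)
    (poly_viewV i₀ (fun j => poly_simReveal i₀ j₀ j hx.fst.snd.snd hx.snd.fst) hx.snd)
  exact (poly_loopV hS i₀).comp (g := fun y => Val.pair (Val.pair ((y.fst.snd.fst.nth 0).nth 4)
    (dummyEnv i₀ y.fst.fst y.fst.snd.fst)) y.snd)
    (((((hx.fst.snd.fst.nthConst 0).nthConst 4).pair
      (poly_dummyEnv hx.fst.fst hx.fst.snd.fst i₀))).pair hx.snd)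

/-- The whole ideal execution can be run from the environment alone. The simulator applies this to
the dummy environment, which it can compute from the input of `i₀`. -/
theorem finalV_enc (S : Fin 2 → Prog) (i₀ : Fin n) (κ : ℕ) (a : Regression n) :
    (stepsV S i₀ (initSteps n) (initV n (encEnv i₀ κ a))).bind (loopV S i₀ (encEnv i₀ κ a) a.T) =
      (finalSt (idealSample S) i₀ κ a).map (encSt i₀) := by
  rw [initV_enc, stepsV_enc, PMF.bind_map, finalSt, PMF.map_bind]
  refine PMF.bind_congr_support _ fun s hs => ?_
  obtain ⟨h₁, h₂⟩ := execSteps_preserves hs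
  have h₁ : s.1.κ = κ := h₁
  have h₂ : s.1.a = a := h₂
  subst h₁ h₂
  exact loopV_enc S i₀ s le_rfl

theorem simV_eq (S : Fin 2 → Prog) (i₀ j₀ : Fin n) (κ : ℕ) (a : Regression n) (f : Val) :
    simV S i₀ j₀ (Val.pair (Val.unary κ) (Val.pair (a.input i₀) f)) =
      (finalSt (idealSample S) i₀ κ (a.dummy i₀)).map fun s => simView i₀ j₀ f (encSt i₀ s) := by
  have hT : (((a.input i₀).nth 0).nth 4).length = (a.dummy i₀).T := by
    have h : ((a.input i₀).nth 0).nth 4 =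
      Val.list (List.ofFn fun t => Val.list (List.ofFn fun r => Val.num (a.batch t r))) := rfl
    rw [h]; simp [dummy]
  simp only [simV, Val.fst_pair, Val.snd_pair]
  rw [dummyEnv_enc, hT, finalV_enc, PMF.map_comp]
  rfl

/-- The last of the parties other than `i₀`. -/
theorem exists_last_other {i₀ : Fin n} (h : ∃ j, j ≠ i₀) : ∃ j₀ ≠ i₀, ∃ l₁ l₂,
    List.finRange n = l₁ ++ j₀ :: l₂ ∧ ∀ i ∈ l₂, i = i₀ := by
  have key : ∀ l : List (Fin n), (∃ j ∈ l, j ≠ i₀) → ∃ j₀ ≠ i₀, ∃ l₁ l₂,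
      l = l₁ ++ j₀ :: l₂ ∧ ∀ i ∈ l₂, i = i₀ := by
    intro l
    induction l with
    | nil => simp
    | cons j l ih =>
      intro hj
      by_cases hl : ∃ k ∈ l, k ≠ i₀
      · obtain ⟨j₀, h₀, l₁, l₂, rfl, h₂⟩ := ih hl
        exact ⟨j₀, h₀, j :: l₁, l₂, rfl, h₂⟩
      · push Not at hl
        obtain ⟨k, hk, hk'⟩ := hj
        rcases List.mem_cons.1 hk with rfl | hk
        · exact ⟨k, hk', [], l, rfl, hl⟩
        · exact (hk' (hl k hk)).elim
  obtain ⟨j, hj⟩ := h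
  exact key _ ⟨j, List.mem_finRange j, hj⟩

/-- The simulated view does not depend on the data of the other parties. -/
theorem exists_simView_eq (S : Fin 2 → Prog) (i₀ : Fin n) : ∃ j₀ : Fin n,
    ∀ (κ : ℕ) (a : Regression n) (v : Fin (a.d i₀) → ZMod a.p),
      ((finalSt (idealSample S) i₀ κ a).map fun s => simView i₀ j₀ (encVec v) (encSt i₀ s)) =
        (finalSt (idealSample S) i₀ κ (a.dummy i₀)).map fun s =>
          simView i₀ j₀ (encVec v) (encSt i₀ s) := by
  by_cases h : ∃ j, j ≠ i₀
  · obtain ⟨j₀, hj₀, l₁, l₂, hl, hl₂⟩ := exists_last_other h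
    refine ⟨j₀, fun κ a v => Coupled.map_eq (coupled_final (if_pos rfl).symm (if_pos rfl).symm
      (fun ho => (if_pos ho).symm) hj₀ hl hl₂) ?_⟩
    rintro _ _ ⟨x, x', L, rfl, rfl, hx⟩
    have e : ∀ j, simReveal i₀ j₀ (encVec v) (encCore i₀ (x.core κ a)) j =
        simReveal i₀ j₀ (encVec v) (encCore i₀ (Vars.core κ (a.dummy i₀) x')) j := fun j => by
      rw [simReveal_enc]
      refine Eq.trans ?_ (simReveal_enc i₀ j₀ j κ (a.dummy i₀) x' v).symm
      by_cases hj : j = j₀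
      · rw [if_pos hj, if_pos hj]
        exact congrArg (fun w => encVec (v - w)) (Finset.sum_congr rfl fun l hl =>
          hx.own l (Finset.ne_of_mem_erase hl))
      · rw [if_neg hj, if_neg hj]
        exact congrArg encVec (hx.own j hj)
    refine (viewV_enc _ _ _ _).trans (Eq.trans ?_ (viewV_enc _ _ _ _).symm)
    have hi : (Vars.core κ (a.dummy i₀) x').a.input i₀ = (x.core κ a).a.input i₀ := input_dummy i₀ a
    refine congrArg₂ Val.pair rfl (congrArg₂ Val.pair hi.symm (congrArg (fun l => Val.list (l ++ L))
      (List.map_congr_left fun j _ => e j)))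
  · push Not at h
    -- Without other parties the dummy instance is the true one, and the choice of `j₀` is
    -- irrelevant.
    refine ⟨i₀, fun κ a v => ?_⟩
    have : a.dummy i₀ = a := by
      rw [dummy, show (fun i => if i = i₀ then a.X i else 0) = a.X from
        funext fun i => if_pos (h i), show (fun i => if i = i₀ then a.w₀ i else 0) = a.w₀ from
        funext fun i => if_pos (h i), if_pos (h a.owner).symm]
    rw [this]

/-- The real view, with the ideal functionality in place of the multiplication protocol, has the
form of the simulated view. -/
theorem ideal_view_eq (S : Fin 2 → Prog) (i₀ j₀ : Fin n) (κ : ℕ) (a : Regression n) :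
    ((finalSt (idealSample S) i₀ κ a).map fun s =>
      viewV i₀ (Read.W (encSt i₀ s).fst i₀) (encSt i₀ s)) =
      (finalSt (idealSample S) i₀ κ a).map fun s =>
        simView i₀ j₀ (a.functionality i₀) (encSt i₀ s) := by
  refine PMF.bind_congr_support _ fun s hs => congrArg PMF.pure ?_
  obtain ⟨x, hx, ht⟩ := finalSt_mem hs
  obtain ⟨c, L⟩ := s
  subst hx
  refine congrArg (fun g => viewV i₀ g (encSt i₀ (x.core κ a, L))) (funext fun j => ?_)
  refine (Read.W_enc i₀ j i₀ (x.core κ a)).trans (Eq.trans ?_ (simReveal_enc i₀ j₀ j κ a x _).symm)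
  by_cases hj : j = j₀
  · rw [if_pos hj, ← ht]
    subst hj
    refine congrArg (encVec (p := a.p)) (eq_sub_of_add_eq
      (?_ : x.W i₀ j + ∑ l ∈ Finset.univ.erase j, x.W i₀ l = _))
    rw [Finset.add_sum_erase _ _ (Finset.mem_univ j)]
    funext c
    simp [totals]
  · rw [if_neg hj]
    rfl

end Regression

/-- Post-processing by a polynomial-time function. -/
theorem UnifIndist.map {ι : Type} {κ size : ι → ℕ} {X Y : ι → PMF Val} (h : UnifIndist κ size X Y)
    {g : Val → Val} (hg : PolyFun g) :
    UnifIndist κ size (fun a => (X a).map g) (fun a => (Y a).map g) :=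
  h.post id (fun _ => rfl) (Polynomial.X + 1) (by simp) (k := fun _ x => PMF.pure (g x))
    (hg.comp PolyFun.id.snd) (fun _ => Val.num 0) (by simp [Val.size])

/-! ### Views and outputs as functions of the final state. -/

namespace Regression

variable {n : ℕ}

theorem real_view_eq (π : TwoPartyProtocol) (i₀ : Fin n) (κ : ℕ) (a : Regression n) :
    ((a.exec π κ).map fun o => (o i₀).1) =
      (finalSt (realSample π) i₀ κ a).map fun s =>
        viewV i₀ (Read.W (encSt i₀ s).fst i₀) (encSt i₀ s) := by
  refine Coupled.map_eq coupled_exec ?_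
  rintro o _ ⟨x, L, rfl, h, -⟩
  rw [h, viewV_enc, revealed, ← List.map_reverse]
  refine congrArg₂ Val.pair rfl (congrArg₂ Val.pair rfl (congrArg (fun l => Val.list (l ++ L)) ?_))
  exact List.map_congr_left fun j _ => (Read.W_enc i₀ j i₀ (x.core κ a)).symm

/-- The outputs for a final state. -/
def outV (n : ℕ) (x : Val) : Val :=
  Val.list (List.ofFn fun i : Fin n => tabMod (Read.p x.fst) (Read.d x.fst i) fun k =>
    ∑ j : Fin n, (Read.W x.fst i j).entry k)

theorem poly_outV (n : ℕ) : PolyFun (outV n) :=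
  have h : PolyFun fun x => x.fst := PolyFun.id.fst
  .list_ofFn fun i => .tabMod (Read.poly_p h) (Read.poly_d h i)
    (PolyNat.finset_sum _ fun j => PolyNat.entry (Read.poly_W PolyFun.id.fst.fst i j)
      (.length PolyFun.id.snd))

theorem outV_enc (i₀ : Fin n) (κ : ℕ) (a : Regression n) (x : Vars n a.p a.b a.d) (L : List Val) :
    outV n (encSt i₀ (x.core κ a, L)) =
      Val.list (List.ofFn fun i => encVec fun c => totals (a := a) x ⟨i, c⟩) := by
  refine congrArg Val.list (congrArg List.ofFn (funext fun i => ?_))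
  have hd : Read.d (encSt i₀ (x.core κ a, L)).fst i = a.d i := Read.d_enc i i₀ (x.core κ a)
  rw [hd]
  refine tabMod_eq_encVec (p := a.p) _ _ fun k => ?_
  have h : ∀ j, (Read.W (encSt i₀ (x.core κ a, L)).fst i j).entry k = (x.W i j k).val := fun j => by
    refine (congrArg (fun v => v.entry k) (Read.W_enc i j i₀ (x.core κ a))).trans ?_
    exact entry_encVec (x.W i j) k
  simp [h, totals]

theorem real_output_eq (π : TwoPartyProtocol) (i₀ : Fin n) (κ : ℕ) (a : Regression n) :
    ((a.exec π κ).map fun o => Val.list (List.ofFn fun i => (o i).2)) =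
      (finalSt (realSample π) i₀ κ a).map fun s => outV n (encSt i₀ s) := by
  refine Coupled.map_eq coupled_exec ?_
  rintro o _ ⟨x, L, rfl, -, h⟩
  rw [outV_enc]
  refine congrArg Val.list (congrArg List.ofFn (funext fun i => ?_))
  rw [h]
  refine congrArg encVec (funext fun c => ?_)
  simp [totals]

/-- By `finalSt_mem` the output is the same for every outcome of the ideal execution, so its
distribution is a point mass. -/
theorem ideal_output_eq (S : Fin 2 → Prog) (i₀ : Fin n) (κ : ℕ) (a : Regression n) :
    ((finalSt (idealSample S) i₀ κ a).map fun s => outV n (encSt i₀ s)) =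
      PMF.pure (Val.list (List.ofFn a.functionality)) := by
  rw [← PMF.bind_const (finalSt (idealSample S) i₀ κ a)
    (PMF.pure (Val.list (List.ofFn a.functionality)))]
  refine PMF.bind_congr_support _ fun s hs => congrArg PMF.pure ?_
  obtain ⟨x, hx, ht⟩ := finalSt_mem hs
  obtain ⟨c, L⟩ := s
  subst hx
  refine (outV_enc i₀ κ a x L).trans ?_
  rw [ht]
  rfl

end Regression

/-! ### Assembly of the security and correctness statements. -/

theorem theorem1 (n : ℕ) (π : TwoPartyProtocol) (hpoly : π.IsPolyTime)
    (hsec : π.IsSecureMatMul) :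
    SecurelyComputes (n := n) (ι := Regression n) Regression.input Regression.functionality
      (Regression.exec π) := by
  choose S hS hind using hsec
  have key := fun i₀ : Fin n => Regression.final_indist hS i₀ hpoly hind
  constructor
  · intro i₀
    obtain ⟨j₀, hj₀⟩ := Regression.exists_simView_eq S i₀
    obtain ⟨q, hq, hqe⟩ := Regression.poly_simV hS i₀ j₀
    refine ⟨q, hq, UnifIndist.compIndist ?_⟩
    have hv : PolyFun fun x => Regression.viewV i₀ (Regression.Read.W x.fst i₀) x :=
      Regression.poly_viewV i₀ (fun j => Regression.Read.poly_W PolyFun.id.fst i₀ j) PolyFun.id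
    refine UnifIndist.trans (.of_eq fun x => ?_) (((key i₀).map hv).symm.trans (.of_eq fun x => ?_))
    · rw [hqe, Regression.simV_eq, PMF.map_comp]
      exact ((Regression.ideal_view_eq S i₀ j₀ x.1 x.2).trans (hj₀ x.1 x.2 _)).symm
    · rw [Regression.real_view_eq, PMF.map_comp]
      rfl
  · cases n with
    -- Without parties there is no instance, since the owner of the labels is one of them.
    | zero => exact fun _ _ _ _ _ => ⟨0, Asymptotics.superpolynomialDecay_zero _ _,
        fun _ a => a.owner.elim0⟩
    | succ n =>
      -- The outputs can be read off from the final state no matter whose log is attached to it; the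
      -- log of party `0` is used.
      refine UnifIndist.compIndist (UnifIndist.trans (.of_eq fun x => ?_)
        (((key 0).map (Regression.poly_outV (n + 1))).trans (.of_eq fun x => ?_)))
      · rw [Regression.real_output_eq π 0, PMF.map_comp]
        rfl
      · rw [PMF.map_comp]
        exact Regression.ideal_output_eq S 0 x.1 x.2
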